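/- **Setting.** Let $1<p<\infty$, $\sigma>1$, write $p'=\frac p{p-1}$, $\sigma'=\frac\sigma{\sigma-1}$, and let $\Omega\subset\mathbb R^n$ be open. Let $Q(x)$, $x\in\Omega$, be a measurable symmetric nonnegative semidefinite matrix function with $|Q|\in L^{p/2}_{\rm loc}(\Omega)$. Let $\rho$ be a symmetric quasimetric on $\Omega$ (finite, $\rho\ge0$, $\rho(x,y)=0$ iff $x=y$, $\rho(x,y)\le\kappa[\rho(x,z)+\rho(y,z)]$ for some constant $\kappa\ge1$) whose balls $B(y,r)=\{x\in\Omega:\rho(y,x)<r\}$ are Lebesgue measurable, and such that for every $x\in\Omega$, $|x-y|\to0$ if $\rho(x,y)\to0$. Let $r_1:\Omega\to(0,\infty)$ be such that all balls $B(y,r)$ with $0<r<r_1(y)$ have closure in $\Omega$ and finite measure. $\mathrm{Lip}_0(D)$ denotes the Lipschitz functions with compact support in $D$; $W^{1,p}_Q(\Omega)$ (resp. $(W^{1,p}_Q)_0(D)$) is the set of pairs $(w,\nabla w)$ that are limits of $(w_k,\nabla w_k)$ in the norm $\big(\int|w|^p+\int|\sqrt Q\nabla w|^p\big)^{1/p}$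 over $\Omega$ (resp. $D$), $w_k$ being locally Lipschitz on $\Omega$ (resp. in $\mathrm{Lip}_0(D)$) with finite norm. Write $\|f\|_{q,B}^{\rm av}=\big(\frac1{|B|}\int_B|f|^q\big)^{1/q}$ (the essential supremum if $q=\infty$). Assume the following. 1. (Sobolev) There is $C>0$ with $\|w\|^{\rm av}_{p\sigma,B}\le C\big[r\|\sqrt Q\nabla w\|^{\rm av}_{p,B}+\|w\|^{\rm av}_{p,B}\big]$ for all $B=B(y,r)$, $y\in\Omega$, $0<r<r_1(y)$, and all $(w,\nabla w)\in(W^{1,p}_Q)_0(B)$. 2. (Cutoffs) For some $\tau\in(0,1)$, $s^*\in(p\sigma',\infty]$ and $N,C_{s^*}>0$, for each $y\in\Omega$ and $0<r<r_1(y)$ there are $\eta_j\in\mathrm{Lip}_0(B(y,r))$, $j\ge1$, with $0\le\eta_j\le1$, $\eta_j=1$ on $B(y,\tau r)$, $\operatorname{supp}\eta_{j+1}\subset\{x\in B(y,r):\eta_j(x)=1\}$ and $\|\sqrt Q\nabla\eta_j\|^{\rm av}_{s^*,B(y,r)}\le C_{s^*}N^j/r$. 3. For some $t\in[1,\infty]$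 with dual exponent $t'$: $\sqrt Q\nabla\eta_j\in L^{tp}(B(y,r))$ for all these $\eta_j$; and for all $y\in\Omega$, $0<r<r_1(y)$ there is $c_2=c_2(B(y,r))$ with $\|f\|_{L^{pt'}(B(y,r))}\le c_2\|f\|_{W^{1,p}_Q(\Omega)}$ for all locally Lipschitz $f$ on $\Omega$. Let $s$ be the dual exponent of $s'$, where $s^*=s'p$ (so $1\le s<\sigma$, and $s=1$ if $s^*=\infty$), and $\Psi_0=\frac s{\sigma-s}$. **Equation.** Let $a>1$, and let $b,c,d,e,f,g,h$ be nonnegative bounded measurable functions on $\Omega$. Let $A,\tilde A$ ($\mathbb R^n$-valued) and $B$ (real-valued) be functions of $(x,z,\xi)\in\Omega\times\mathbb R\times\mathbb R^n$ such that for a.e. $x\in\Omega$ and all $(z,\xi)$, $$A=\sqrt{Q}\,\tilde A,\qquad \xi\cdot A\ge a^{-1}|\sqrt Q\,\xi|^p-h|z|^\gamma-g,$$ $$|\tilde A|\le a|\sqrt Q\,\xi|^{p-1}+b|z|^{\gamma-1}+e,\qquad |B|\le c|\sqrt Q\,\xi|^{\psi-1}+d|z|^{\delta-1}+f,$$ where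 $p<\gamma<\sigma(p-1)+1$, $p<\psi<p+1-\sigma^{-1}$, $p<\delta<p\sigma$. Let $(u,\nabla u)\in W^{1,p}_Q(\Omega)$ be a weak solution of $\operatorname{div}A(x,u,\nabla u)=B(x,u,\nabla u)$: for all $\varphi\in\mathrm{Lip}_0(\Omega)$ the function $\nabla\varphi\cdot A(x,u,\nabla u)+\varphi B(x,u,\nabla u)$ is integrable on $\Omega$ with integral $0$. **Claim.** There are nonnegative functions $$C_1=C_1(\epsilon,p,\psi,\|c\|,\|e\|,\|f\|,\|g\|),\qquad C_2=C_2(\epsilon,p,\psi,\|b\|,\|c\|,\|d\|,\|h\|)$$ and a positive function $L=L(\epsilon,p,\gamma,\psi,\delta)$ of the displayed arguments only, with $C_1=0$ if $\|c\|=0$ or $\|e\|=\|f\|=\|g\|=0$, and $C_2=0$ if $\|b\|=\|c\|=\|d\|=\|h\|=0$, such that the following holds. For all sufficiently small $\epsilon>0$, depending on $p,\sigma,\gamma,\psi,\delta$, $$\theta:=\max\Big\{(\gamma-p)p'\sigma',\ \frac{(\psi-p)p\sigma'(1+\epsilon)}{p+1-\psi},\ (\delta-p)\sigma'(1+\epsilon)\Big\}<p\sigma,$$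 and there is a constant $C>0$, independent of $u$, $y$, $r$, $A$, $B$, $b,c,d,e,f,g,h$, such that for all $y\in\Omega$ and all $r$ with $0<r<\tau r_1(y)$ and $r\le1$, the norms $\|u\|^{\rm av}_{\theta,B(y,r)}$ and $\|u\|^{\rm av}_{sp,B(y,r)}$ are finite and $$\|u\|_{L^\infty(B(y,\tau r))}\le C\Big\{1+C_1+C_2\big[1+\|u\|^{\rm av}_{\theta,B(y,r)}\big]^L\Big\}^{\Psi_0}\Big\{\|u\|^{\rm av}_{sp,B(y,r)}+K(y,r)\Big\},$$ where $$K(y,r)=r\|e\|_{L^\infty(B(y,r))}^{\frac1{p-1}}+r^{p'}\|f\|_{L^\infty(B(y,r))}^{\frac1{p-1}}+r\|g\|_{L^\infty(B(y,r))}^{\frac1p}$$ and $C_1,C_2$ are evaluated at the $L^\infty(B(y,r))$ norms of the coefficients. In particular $s=1$ is admissible if the cutoff condition holds with $s^*=\infty$. No lower bound on $|B(y,r)|$ of the form $c_0r^{q^*}$ is assumed. -/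

import Mathlib

open MeasureTheory Filter Topology Set
open scoped ENNReal NNReal MatrixOrder

noncomputable section

namespace DegenerateQuasilinear

/-- Euclidean space `ℝⁿ`. -/
abbrev E (n : ℕ) : Type := EuclideanSpace ℝ (Fin n)

variable {n : ℕ}

/-! ### The matrix weight -/

/-- The vector `√(Q x) ξ`, where `√(Q x)` is the nonnegative square root of the symmetric
nonnegative semidefinite matrix `Q x`. -/
def sqrtQ (Q : E n → Matrix (Fin n) (Fin n) ℝ) (x ξ : E n) : E n :=
  WithLp.toLp 2 ((CFC.sqrt (Q x)).mulVec ξ.ofLp)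

/-- `Q` is a measurable symmetric nonnegative semidefinite matrix function on `Ω` whose operator
norm satisfies `|Q| ∈ L^{p/2}_loc(Ω)`. -/
structure IsWeight (Ω : Set (E n)) (p : ℝ) (Q : E n → Matrix (Fin n) (Fin n) ℝ) : Prop where
  aemeasurable : ∀ i j, AEMeasurable (fun x => Q x i j) (volume.restrict Ω)
  posSemidef : ∀ x ∈ Ω, (Q x).PosSemidef
  locallyIntegrable : LocallyIntegrableOn
    (fun x => ‖Matrix.toEuclideanCLM (n := Fin n) (𝕜 := ℝ) (Q x)‖ ^ (p / 2)) Ω volume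

/-! ### Quasimetric balls -/

/-- The quasimetric ball `B(y, r) = {x ∈ Ω : ρ(y, x) < r}`. -/
def qball (Ω : Set (E n)) (ρ : E n → E n → ℝ) (y : E n) (r : ℝ) : Set (E n) :=
  {x ∈ Ω | ρ y x < r}

/-- `ρ` is a symmetric quasimetric on `Ω` with Lebesgue measurable balls. -/
structure IsQuasimetric (Ω : Set (E n)) (ρ : E n → E n → ℝ) : Prop where
  nonneg : ∀ x ∈ Ω, ∀ y ∈ Ω, 0 ≤ ρ x y
  symm : ∀ x ∈ Ω, ∀ y ∈ Ω, ρ x y = ρ y x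
  eq_zero_iff : ∀ x ∈ Ω, ∀ y ∈ Ω, (ρ x y = 0 ↔ x = y)
  quasi_triangle : ∃ κ : ℝ, 1 ≤ κ ∧
    ∀ x ∈ Ω, ∀ y ∈ Ω, ∀ z ∈ Ω, ρ x y ≤ κ * (ρ x z + ρ y z)
  measurable_ball : ∀ x ∈ Ω, ∀ r > 0, NullMeasurableSet (qball Ω ρ x r) volume

/-- For every `x ∈ Ω`: `|x - y| → 0` if `ρ(x, y) → 0`. -/
def EuclideanControlled (Ω : Set (E n)) (ρ : E n → E n → ℝ) : Prop :=
  ∀ x ∈ Ω, ∀ ε > 0, ∃ δ > 0, ∀ y ∈ Ω, ρ x y < δ → dist x y < ε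

/-- `r₁` is a positive radius function on `Ω` such that the balls `B(y, r)`, `0 < r < r₁(y)`,
have closure in `Ω` and finite Lebesgue measure. -/
structure IsRadiusFunction (Ω : Set (E n)) (ρ : E n → E n → ℝ) (r₁ : E n → ℝ) : Prop where
  pos : ∀ y ∈ Ω, 0 < r₁ y
  closure_subset : ∀ y ∈ Ω, ∀ r, 0 < r → r < r₁ y → closure (qball Ω ρ y r) ⊆ Ω
  volume_lt_top : ∀ y ∈ Ω, ∀ r, 0 < r → r < r₁ y → volume (qball Ω ρ y r) < ∞

/-! ### Norms, Lipschitz classes and degenerate Sobolev spaces -/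

/-- The normalized norm `(|D|⁻¹ ∫_D |f|^q dx)^{1/q}` (the essential supremum if `q = ∞`). -/
def avgNorm {F : Type*} [NormedAddCommGroup F] (f : E n → F) (q : ℝ≥0∞) (D : Set (E n)) : ℝ≥0∞ :=
  eLpNorm f q ((volume D)⁻¹ • volume.restrict D)

/-- The norm `‖f‖_{L^∞(D)}` as a real number; it is used for essentially bounded `f` only. -/
def supNorm (f : E n → ℝ) (D : Set (E n)) : ℝ :=
  (eLpNorm f ∞ (volume.restrict D)).toReal

/-- Lipschitz functions with compact support contained in `D`. -/
def LipZero (D : Set (E n)) : Set (E n → ℝ) :=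
  {f | (∃ K : ℝ≥0, LipschitzWith K f) ∧ HasCompactSupport f ∧ tsupport f ⊆ D}

/-- Locally Lipschitz functions on `D`. -/
def LipLoc (D : Set (E n)) : Set (E n → ℝ) :=
  {f | LocallyLipschitzOn D f}

/-- The degenerate Sobolev norm `(∫_D |w|^p + ∫_D |√Q v|^p)^{1/p}` of a pair `(w, v)`. -/
def wNorm (p : ℝ) (Q : E n → Matrix (Fin n) (Fin n) ℝ) (D : Set (E n))
    (w : E n → ℝ) (v : E n → E n) : ℝ≥0∞ :=
  ((∫⁻ x in D, ‖w x‖ₑ ^ p) + ∫⁻ x in D, ‖sqrtQ Q x (v x)‖ₑ ^ p) ^ (1 / p)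

/-- `(w, v)` is the limit, in the degenerate Sobolev norm over `D`, of functions of the class `𝓛`
with finite norm, together with their gradients. The gradients of locally Lipschitz functions on
open sets exist almost everywhere. -/
def IsSobolevLimit (𝓛 : Set (E n → ℝ)) (p : ℝ) (Q : E n → Matrix (Fin n) (Fin n) ℝ)
    (D : Set (E n)) (w : E n → ℝ) (v : E n → E n) : Prop :=
  AEStronglyMeasurable w (volume.restrict D) ∧ AEStronglyMeasurable v (volume.restrict D) ∧
    ∃ φ : ℕ → E n → ℝ,
      (∀ k, φ k ∈ 𝓛 ∧ wNorm p Q D (φ k) (gradient (φ k)) < ∞) ∧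
      Tendsto (fun k => wNorm p Q D (fun x => φ k x - w x) (fun x => gradient (φ k) x - v x))
        atTop (𝓝 0)

/-- `(w, v) ∈ W^{1,p}_Q(Ω)`; `v` plays the role of `∇w`. -/
def MemW (p : ℝ) (Q : E n → Matrix (Fin n) (Fin n) ℝ) (Ω : Set (E n))
    (w : E n → ℝ) (v : E n → E n) : Prop :=
  IsSobolevLimit (LipLoc Ω) p Q Ω w v

/-- `(w, v) ∈ (W^{1,p}_Q)_0(D)`; `v` plays the role of `∇w`. -/
def MemWZero (p : ℝ) (Q : E n → Matrix (Fin n) (Fin n) ℝ) (D : Set (E n))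
    (w : E n → ℝ) (v : E n → E n) : Prop :=
  IsSobolevLimit (LipZero D) p Q D w v

/-! ### The axiomatic framework -/

/-- The Sobolev estimate with gain `σ` on all balls `B(y, r)`, `0 < r < r₁(y)`. -/
def SobolevEstimate (Ω : Set (E n)) (ρ : E n → E n → ℝ) (r₁ : E n → ℝ) (p σ : ℝ)
    (Q : E n → Matrix (Fin n) (Fin n) ℝ) : Prop :=
  ∃ C : ℝ, 0 < C ∧ ∀ y ∈ Ω, ∀ r, 0 < r → r < r₁ y →
    ∀ (w : E n → ℝ) (v : E n → E n), MemWZero p Q (qball Ω ρ y r) w v →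
      avgNorm w (ENNReal.ofReal (p * σ)) (qball Ω ρ y r) ≤
        ENNReal.ofReal C *
          (ENNReal.ofReal r *
              avgNorm (fun x => sqrtQ Q x (v x)) (ENNReal.ofReal p) (qball Ω ρ y r) +
            avgNorm w (ENNReal.ofReal p) (qball Ω ρ y r))

/-- `η 1, η 2, …` is an accumulating sequence of Lipschitz cutoff functions for the ball
`B(y, r)`. -/
structure IsCutoffSequence (Ω : Set (E n)) (ρ : E n → E n → ℝ)
    (Q : E n → Matrix (Fin n) (Fin n) ℝ) (τ N Cs : ℝ) (sStar : ℝ≥0∞) (y : E n) (r : ℝ)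
    (η : ℕ → E n → ℝ) : Prop where
  lipZero : ∀ j ≥ 1, η j ∈ LipZero (qball Ω ρ y r)
  mem_Icc : ∀ j ≥ 1, ∀ x, η j x ∈ Icc (0 : ℝ) 1
  eq_one : ∀ j ≥ 1, qball Ω ρ y (τ * r) ⊆ {x ∈ qball Ω ρ y r | η j x = 1}
  tsupport_succ : ∀ j ≥ 1, tsupport (η (j + 1)) ⊆ {x ∈ qball Ω ρ y r | η j x = 1}
  gradient_bound : ∀ j ≥ 1,
    avgNorm (fun x => sqrtQ Q x (gradient (η j) x)) sStar (qball Ω ρ y r) ≤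
      ENNReal.ofReal (Cs * N ^ j / r)

/-- Every ball `B(y, r)`, `0 < r < r₁(y)`, has an accumulating sequence of Lipschitz cutoff
functions with uniform constants `τ, N, C_{s*}`, each of which moreover satisfies
`√Q ∇η ∈ L^{tp}(B(y, r))`. -/
def CutoffCondition (Ω : Set (E n)) (ρ : E n → E n → ℝ) (r₁ : E n → ℝ) (p : ℝ)
    (Q : E n → Matrix (Fin n) (Fin n) ℝ) (τ : ℝ) (sStar t : ℝ≥0∞) : Prop :=
  ∃ N Cs : ℝ, 0 < N ∧ 0 < Cs ∧ ∀ y ∈ Ω, ∀ r, 0 < r → r < r₁ y →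
    ∃ η : ℕ → E n → ℝ, IsCutoffSequence Ω ρ Q τ N Cs sStar y r η ∧
      ∀ j ≥ 1, eLpNorm (fun x => sqrtQ Q x (gradient (η j) x)) (t * ENNReal.ofReal p)
        (volume.restrict (qball Ω ρ y r)) < ∞

/-- Local integrability of order `pt'`: for every ball `B(y, r)`, `0 < r < r₁(y)`, there is a
constant `c₂` with `‖f‖_{L^{pt'}(B(y, r))} ≤ c₂ ‖f‖_{W^{1,p}_Q(Ω)}` for all locally Lipschitz
functions `f` on `Ω`. -/
def LocalIntegrabilityGain (Ω : Set (E n)) (ρ : E n → E n → ℝ) (r₁ : E n → ℝ) (p : ℝ)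
    (Q : E n → Matrix (Fin n) (Fin n) ℝ) (t' : ℝ≥0∞) : Prop :=
  ∀ y ∈ Ω, ∀ r, 0 < r → r < r₁ y → ∃ c₂ : ℝ, 0 < c₂ ∧ ∀ f ∈ LipLoc Ω,
    eLpNorm f (ENNReal.ofReal p * t') (volume.restrict (qball Ω ρ y r)) ≤
      ENNReal.ofReal c₂ * wNorm p Q Ω f (gradient f)

/-! ### The equation -/

/-- The structural coefficients other than the constant `a`. -/
structure Coefficients (n : ℕ) where
  b : E n → ℝ
  c : E n → ℝ
  d : E n → ℝ
  e : E n → ℝ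
  f : E n → ℝ
  g : E n → ℝ
  h : E n → ℝ

/-- `m` is a nonnegative (essentially) bounded measurable function on `Ω`. -/
def IsNonnegBounded (Ω : Set (E n)) (m : E n → ℝ) : Prop :=
  (∀ᵐ x ∂(volume.restrict Ω), 0 ≤ m x) ∧ MemLp m ∞ (volume.restrict Ω)

/-- All the coefficients are nonnegative and bounded on `Ω`. -/
structure Coefficients.Bounded (κ : Coefficients n) (Ω : Set (E n)) : Prop where
  b : IsNonnegBounded Ω κ.b
  c : IsNonnegBounded Ω κ.c
  d : IsNonnegBounded Ω κ.d
  e : IsNonnegBounded Ω κ.e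
  f : IsNonnegBounded Ω κ.f
  g : IsNonnegBounded Ω κ.g
  h : IsNonnegBounded Ω κ.h

/-- The structural conditions on `A` and `B` relative to `Q`. -/
def StructuralConditions (Ω : Set (E n)) (Q : E n → Matrix (Fin n) (Fin n) ℝ)
    (p γ ψ δ a : ℝ) (κ : Coefficients n)
    (A : E n → ℝ → E n → E n) (B : E n → ℝ → E n → ℝ) : Prop :=
  ∃ A' : E n → ℝ → E n → E n, ∀ᵐ x ∂(volume.restrict Ω), ∀ (z : ℝ) (ξ : E n),
    A x z ξ = sqrtQ Q x (A' x z ξ) ∧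
    a⁻¹ * ‖sqrtQ Q x ξ‖ ^ p - κ.h x * |z| ^ γ - κ.g x ≤ inner ℝ ξ (A x z ξ) ∧
    ‖A' x z ξ‖ ≤ a * ‖sqrtQ Q x ξ‖ ^ (p - 1) + κ.b x * |z| ^ (γ - 1) + κ.e x ∧
    |B x z ξ| ≤ κ.c x * ‖sqrtQ Q x ξ‖ ^ (ψ - 1) + κ.d x * |z| ^ (δ - 1) + κ.f x

/-- The pair `(u, v)`, `v` in the role of `∇u`, is a weak solution of
`div A(x, u, ∇u) = B(x, u, ∇u)` in `Ω`. That the integral exists is part of the notion. -/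
def IsWeakSolution (Ω : Set (E n)) (p : ℝ) (Q : E n → Matrix (Fin n) (Fin n) ℝ)
    (A : E n → ℝ → E n → E n) (B : E n → ℝ → E n → ℝ) (u : E n → ℝ) (v : E n → E n) : Prop :=
  MemW p Q Ω u v ∧ ∀ φ ∈ LipZero Ω,
    IntegrableOn
      (fun x => inner ℝ (gradient φ x) (A x (u x) (v x)) + φ x * B x (u x) (v x)) Ω volume ∧
    ∫ x in Ω, (inner ℝ (gradient φ x) (A x (u x) (v x)) + φ x * B x (u x) (v x)) = 0

/-! ### Quantities in the estimate -/

/-- `θ = max {(γ-p)p'σ', (ψ-p)pσ'(1+ε)/(p+1-ψ), (δ-p)σ'(1+ε)}`, where `p'` and `σ'` are the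
conjugate exponents. -/
def theta (p σ γ ψ δ ε : ℝ) : ℝ :=
  max (max ((γ - p) * p.conjExponent * σ.conjExponent)
      ((ψ - p) * p * σ.conjExponent * (1 + ε) / (p + 1 - ψ)))
    ((δ - p) * σ.conjExponent * (1 + ε))

/-- `K = r ‖e‖_∞^{1/(p-1)} + r^{p'} ‖f‖_∞^{1/(p-1)} + r ‖g‖_∞^{1/p}`, with norms over `D`. -/
def kTerm (p r : ℝ) (κ : Coefficients n) (D : Set (E n)) : ℝ :=
  r * supNorm κ.e D ^ (1 / (p - 1)) + r ^ p.conjExponent * supNorm κ.f D ^ (1 / (p - 1)) +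
    r * supNorm κ.g D ^ (1 / p)

end DegenerateQuasilinear

end

noncomputable section

namespace DegenerateQuasilinear

variable {n : ℕ}

/-! ### The square root of the weight -/

section Weight

variable (Q : E n → Matrix (Fin n) (Fin n) ℝ)

/-! The proof is a Moser iteration on a fixed ball D = B(y,r) with the normalized measure. Put ū =
√(u² + K²) with K > K(y,r). Since ū ≥ K, the inhomogeneous coefficients satisfy e ≤ (ū/r)^{p-1}, f ≤
ū^{p-1} r^{-p}, g ≤ (ū/r)^p, so they are no worse than homogeneous terms. Testing the equation with
η^p u T^{p(q-1)}, where T is a smooth bounded truncation of ū, and absorbing the gradient of u gives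
a Caccioppoli inequality (`energy_pointwise`, `IsWeakSolution.energy_le`). Besides the usual terms,
its right side contains a term with b|u|^{γ-p} that is linear in ∇η, and a potential V built from
h|u|^{γ-p}, d|u|^{δ-p} and a power of cū^{ψ-p}.

These coefficients enter only through the averaged norm U of u of order θ. Let X be the averaged
L^{pσ} norm of η ū T^{q-1}. Hölder's inequality with exponent p'σ' bounds the b-term by a multiple
of X^{p-1}. With exponent σ'(1+ε) it interpolates the V-term between L^p and L^{pσ}, which leaves
X^{p/(1+ε)}. Both powers are below p, and X is finite because of the truncation, so Sobolev's
inequality lets X be solved for (`moser_step`, `le_of_absorption`). The cost is a factor Z = 1 +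
bU^{γ-p} + V^{(1+ε)/(pε)}, with V now denoting its bound in terms of U and K. All norms are averages
and only r ≤ 1 is used of the radius, so no lower bound on |B| enters.

The cutoff costs an L^{s'p} norm, hence the gain per step is χ = σ/s > 1. Iterating over q = χ^j
(`eLpNorm_top_le_of_moser`) yields the power Z^{Σ χ^{-j}} = Z^{(σ/s)Ψ₀}. Since C₁, C₂ and L may not
depend on σ, ε is taken so small that σ ≤ 1/ε, and Z^{σ/s} is replaced by Z^{1/ε}, which
`factor_rpow_le` splits into the announced form.

Three facts justify the computation: truncated test functions lie in the space with zero boundary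
values (`memWZero_mul_comp`), the weak formulation extends to that space
(`IsWeakSolution.integral_memWZero_eq_zero`), and u is in L^{pσ} of the ball (`MemW.memLp_qball`).
-/

lemma sqrtQ_add (x ξ ζ : E n) : sqrtQ Q x (ξ + ζ) = sqrtQ Q x ξ + sqrtQ Q x ζ := by
  simp [sqrtQ, Matrix.mulVec_add]

lemma sqrtQ_smul (x : E n) (c : ℝ) (ξ : E n) : sqrtQ Q x (c • ξ) = c • sqrtQ Q x ξ := by
  simp [sqrtQ, Matrix.mulVec_smul]

lemma sqrtQ_sub (x ξ ζ : E n) : sqrtQ Q x (ξ - ζ) = sqrtQ Q x ξ - sqrtQ Q x ζ := by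
  simp [sqrtQ, Matrix.mulVec_sub]

@[simp]
lemma sqrtQ_zero (x : E n) : sqrtQ Q x 0 = 0 := by
  simp [sqrtQ]

lemma sqrt_transpose (M : Matrix (Fin n) (Fin n) ℝ) : (CFC.sqrt M).transpose = CFC.sqrt M := by
  have h : IsSelfAdjoint (CFC.sqrt M) := (CFC.sqrt_nonneg M).isSelfAdjoint
  simpa [Matrix.star_eq_conjTranspose] using h.star_eq

lemma inner_sqrtQ (x ξ ζ : E n) : inner ℝ ξ (sqrtQ Q x ζ) = inner ℝ (sqrtQ Q x ξ) ζ := by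
  simp only [sqrtQ, EuclideanSpace.inner_eq_star_dotProduct, star_trivial]
  rw [dotProduct_comm, Matrix.dotProduct_mulVec, ← Matrix.mulVec_transpose, sqrt_transpose,
    dotProduct_comm]

variable {Q}

lemma norm_sqrtQ_sq {x : E n} (h : (Q x).PosSemidef) (ξ : E n) :
    ‖sqrtQ Q x ξ‖ ^ 2 = ξ.ofLp ⬝ᵥ (Q x).mulVec ξ.ofLp := by
  rw [← real_inner_self_eq_norm_sq, ← inner_sqrtQ]
  simp only [sqrtQ, EuclideanSpace.inner_eq_star_dotProduct, star_trivial, Matrix.mulVec_mulVec]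
  rw [CFC.sqrt_mul_sqrt_self (Q x) h.nonneg, dotProduct_comm]

/-- The square |√Q v|² = v·Qv is polynomial in the entries of Q and v. Working with the norm only
therefore bypasses measurability of the matrix square root. -/
lemma IsWeight.aestronglyMeasurable_norm_sqrtQ {Ω D : Set (E n)} {p : ℝ} (hQ : IsWeight Ω p Q)
    (hD : NullMeasurableSet D volume) (hDΩ : D ⊆ Ω) {v : E n → E n}
    (hv : AEStronglyMeasurable v (volume.restrict D)) :
    AEStronglyMeasurable (fun x => ‖sqrtQ Q x (v x)‖) (volume.restrict D) := by
  have h : AEMeasurable (fun x => √(∑ i, v x i * ∑ j, Q x i j * v x j)) (volume.restrict D) := by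
    have hi : ∀ i, AEMeasurable (fun x => v x i) (volume.restrict D) := fun i =>
      (by fun_prop : Continuous fun z : E n => z i).measurable.comp_aemeasurable hv.aemeasurable
    refine Real.continuous_sqrt.measurable.comp_aemeasurable ?_
    refine Finset.aemeasurable_fun_sum _ fun i _ => (hi i).mul ?_
    refine Finset.aemeasurable_fun_sum _ fun j _ => ?_
    exact ((hQ.aemeasurable i j).mono_measure (Measure.restrict_mono hDΩ le_rfl)).mul (hi j)
  refine h.aestronglyMeasurable.congr ?_
  filter_upwards [ae_restrict_mem₀ hD] with x hx
  rw [← Real.sqrt_sq (norm_nonneg (sqrtQ Q x (v x))), norm_sqrtQ_sq (hQ.posSemidef x (hDΩ hx))]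
  simp [dotProduct, Matrix.mulVec]

end Weight

/-! ### Lipschitz functions and their gradients -/

section Lipschitz

/-- Rademacher's theorem applies near each point, and a set that is null near each of its points is
null. -/
lemma ae_differentiableAt_of_mem_lipLoc {Ω : Set (E n)} (hΩ : IsOpen Ω) {f : E n → ℝ}
    (hf : f ∈ LipLoc Ω) : ∀ᵐ x ∂(volume.restrict Ω), DifferentiableAt ℝ f x := by
  rw [ae_restrict_iff' hΩ.measurableSet, ae_iff]
  refine measure_null_of_locally_null _ fun x hx => ?_
  have hxΩ : x ∈ Ω := by
    by_contra h
    exact hx fun h' => absurd h' h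
  obtain ⟨K, t, ht, hK⟩ := hf hxΩ
  rw [hΩ.nhdsWithin_eq hxΩ] at ht
  refine ⟨_, inter_mem self_mem_nhdsWithin (mem_nhdsWithin_of_mem_nhds (interior_mem_nhds.2 ht)),
    ?_⟩
  have h := hK.ae_differentiableWithinAt_of_mem (μ := volume)
  rw [ae_iff] at h
  refine measure_mono_null (t := {a | ¬(a ∈ t → DifferentiableWithinAt ℝ f t a)}) ?_ h
  intro z hz hzd
  refine hz.1 fun _ => ?_
  replace hzd := hzd (interior_subset hz.2)
  exact hzd.differentiableAt (mem_interior_iff_mem_nhds.1 hz.2)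

lemma measurable_gradient (f : E n → ℝ) : Measurable (gradient f) :=
  (InnerProductSpace.toDual ℝ (E n)).symm.continuous.measurable.comp (measurable_fderiv ℝ f)

lemma gradient_sub_eq {f g : E n → ℝ} {x : E n} (hf : DifferentiableAt ℝ f x)
    (hg : DifferentiableAt ℝ g x) :
    gradient (fun y => f y - g y) x = gradient f x - gradient g x := by
  refine HasGradientAt.gradient ?_
  rw [hasGradientAt_iff_hasFDerivAt, map_sub]
  exact hf.hasGradientAt.hasFDerivAt.sub hg.hasGradientAt.hasFDerivAt

lemma gradient_comp_eq {f : E n → ℝ} {F : ℝ → ℝ} {F' : ℝ} {x : E n}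
    (hf : DifferentiableAt ℝ f x) (hF : HasDerivAt F F' (f x)) :
    gradient (fun y => F (f y)) x = F' • gradient f x := by
  refine HasGradientAt.gradient ?_
  rw [hasGradientAt_iff_hasFDerivAt, map_smul]
  exact hF.comp_hasFDerivAt x hf.hasGradientAt.hasFDerivAt

lemma gradient_mul_comp_eq {ζ f : E n → ℝ} {F : ℝ → ℝ} {F' : ℝ} {x : E n}
    (hζ : DifferentiableAt ℝ ζ x) (hf : DifferentiableAt ℝ f x) (hF : HasDerivAt F F' (f x)) :
    gradient (fun y => ζ y * F (f y)) x = F (f x) • gradient ζ x + (ζ x * F') • gradient f x := by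
  refine HasGradientAt.gradient ?_
  rw [hasGradientAt_iff_hasFDerivAt, map_add, map_smul, map_smul, add_comm, mul_smul]
  exact hζ.hasGradientAt.hasFDerivAt.mul (hF.comp_hasFDerivAt x hf.hasGradientAt.hasFDerivAt)

lemma gradient_eq_zero_of_notMem_tsupport {f : E n → ℝ} {x : E n} (hx : x ∉ tsupport f) :
    gradient f x = 0 := by
  simp [gradient, fderiv_of_notMem_tsupport ℝ hx]

/-- The support is enclosed in a ball with a unit collar. Inside the enlarged ball compactness gives
a Lipschitz constant; a point of the smaller ball and a point beyond the collar are at distance at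
least 1, so there the sup bound serves as a Lipschitz constant. -/
lemma lipschitzWith_of_locallyLipschitz_of_hasCompactSupport {f : E n → ℝ}
    (hf : LocallyLipschitz f) (hc : HasCompactSupport f) : ∃ K : ℝ≥0, LipschitzWith K f := by
  obtain ⟨R, hR⟩ := hc.isCompact.isBounded.subset_closedBall (0 : E n)
  obtain ⟨K, hK⟩ := LocallyLipschitzOn.exists_lipschitzOnWith_of_compact
    (isCompact_closedBall (0 : E n) (R + 1)) (fun x _ => let ⟨K, t, ht, h⟩ := hf x; ⟨K, t, mem_nhdsWithin_of_mem_nhds ht, h⟩)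
  obtain ⟨M, hM⟩ := hc.exists_bound_of_continuous hf.continuous
  have key : ∀ x y, ‖x‖ ≤ R + 1 → dist (f x) (f y) ≤ max K M.toNNReal * dist x y := by
    intro x y hx
    by_cases hy : ‖y‖ ≤ R + 1
    · refine (hK.dist_le_mul x (by simpa using hx) y (by simpa using hy)).trans ?_
      gcongr
      exact le_max_left _ _
    have hfy : f y = 0 := image_eq_zero_of_notMem_tsupport fun h => by
      have := hR h
      simp at this
      linarith
    by_cases hx' : ‖x‖ ≤ R
    · have h1 : 1 ≤ dist x y := by
        have := norm_sub_norm_le y x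
        rw [dist_comm, dist_eq_norm]
        linarith [not_le.1 hy]
      rw [hfy, dist_zero_right]
      have h2 : ‖f x‖ ≤ (max K M.toNNReal : ℝ≥0) :=
        (hM x).trans ((Real.le_coe_toNNReal M).trans (by exact_mod_cast le_max_right _ _))
      nlinarith [norm_nonneg (f x)]
    · have hfx : f x = 0 := image_eq_zero_of_notMem_tsupport fun h => by
        have := hR h
        simp at this
        linarith
      rw [hfx, hfy, dist_self]
      positivity
  refine ⟨max K M.toNNReal, LipschitzWith.of_dist_le_mul fun x y => ?_⟩
  by_cases hx : ‖x‖ ≤ R + 1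
  · exact key x y hx
  by_cases hy : ‖y‖ ≤ R + 1
  · rw [dist_comm (f x), dist_comm x]
    exact key y x hy
  have h0 : ∀ z : E n, ¬‖z‖ ≤ R + 1 → f z = 0 := fun z hz =>
    image_eq_zero_of_notMem_tsupport fun h => by
      have := hR h
      simp at this
      linarith
  rw [h0 x hx, h0 y hy, dist_self]
  positivity

lemma LipZero.mono {D D' : Set (E n)} (h : D ⊆ D') {f : E n → ℝ} (hf : f ∈ LipZero D) :
    f ∈ LipZero D' :=
  ⟨hf.1, hf.2.1, hf.2.2.trans h⟩

lemma mem_lipLoc_of_mem_lipZero {D Ω : Set (E n)} {f : E n → ℝ} (hf : f ∈ LipZero D) :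
    f ∈ LipLoc Ω := by
  obtain ⟨⟨K, hK⟩, -⟩ := hf
  exact fun x _ => ⟨K, univ, univ_mem, hK.lipschitzOnWith⟩

lemma LipLoc.sub {Ω : Set (E n)} {f g : E n → ℝ} (hf : f ∈ LipLoc Ω) (hg : g ∈ LipLoc Ω) :
    (fun x => f x - g x) ∈ LipLoc Ω :=
  LocallyLipschitzOn.sub hf hg

lemma LipZero.sub {D : Set (E n)} {f g : E n → ℝ} (hf : f ∈ LipZero D) (hg : g ∈ LipZero D) :
    (fun x => f x - g x) ∈ LipZero D := by
  obtain ⟨⟨K, hK⟩, hfc, hfD⟩ := hf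
  obtain ⟨⟨K', hK'⟩, hgc, hgD⟩ := hg
  refine ⟨⟨K + K', hK.sub hK'⟩, hfc.sub hgc, ?_⟩
  exact (tsupport_sub f g).trans (union_subset hfD hgD)

/-- Nothing is known about f outside Ω, but the product vanishes off the compact set `tsupport ζ`,
which lies in Ω. Local Lipschitz bounds near that set suffice. -/
lemma LipZero.mul_comp {D Ω : Set (E n)} (hΩ : IsOpen Ω) (hD : D ⊆ Ω) {ζ f : E n → ℝ} {F : ℝ → ℝ}
    {M : ℝ≥0} (hζ : ζ ∈ LipZero D) (hf : f ∈ LipLoc Ω) (hF : LipschitzWith M F) :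
    (fun x => ζ x * F (f x)) ∈ LipZero D := by
  obtain ⟨⟨K, hK⟩, hc, hs⟩ := hζ
  have hsub : tsupport (fun x => ζ x * F (f x)) ⊆ tsupport ζ := tsupport_mul_subset_left
  have hc' : HasCompactSupport fun x => ζ x * F (f x) := hc.mul_right
  refine ⟨lipschitzWith_of_locallyLipschitz_of_hasCompactSupport ?_ hc', hc', hsub.trans hs⟩
  intro x
  by_cases hx : x ∈ tsupport ζ
  · obtain ⟨C, hC⟩ := hc.exists_bound_of_continuous hK.continuous
    have hxΩ : x ∈ Ω := hD (hs hx)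
    obtain ⟨K', t, ht, hf'⟩ := hf hxΩ
    rw [hΩ.nhdsWithin_eq hxΩ] at ht
    have hg := hF.comp_lipschitzOnWith hf'
    set g : E n → ℝ := F ∘ f with hgdef
    have hxt : x ∈ t := mem_of_mem_nhds ht
    refine ⟨C.toNNReal * (M * K') + (‖g x‖₊ + M * K') * K, t ∩ Metric.ball x 1,
      inter_mem ht (Metric.ball_mem_nhds x one_pos), LipschitzOnWith.of_dist_le_mul ?_⟩
    intro a ha b hb
    have h1 := hg.dist_le_mul a ha.1 b hb.1
    have h2 := hK.dist_le_mul a b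
    have h3 := hg.dist_le_mul b hb.1 x hxt
    have h4 : ‖g b‖ ≤ ‖g x‖ + M * K' := by
      have h5 : dist b x ≤ 1 := (Metric.mem_ball.1 hb.2).le
      have h6 : ‖g b‖ - ‖g x‖ ≤ dist (g b) (g x) := by
        rw [dist_eq_norm]; exact norm_sub_norm_le _ _
      have h7 : ((M * K' : ℝ≥0) : ℝ) * dist b x ≤ M * K' * 1 := by
        push_cast
        gcongr
      linarith
    have hCn : ‖ζ a‖ ≤ C.toNNReal := (hC a).trans (Real.le_coe_toNNReal C)
    change dist (ζ a * g a) (ζ b * g b) ≤ _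
    calc dist (ζ a * g a) (ζ b * g b) = ‖ζ a * (g a - g b) + g b * (ζ a - ζ b)‖ := by
          rw [dist_eq_norm]; ring_nf
      _ ≤ ‖ζ a‖ * ‖g a - g b‖ + ‖g b‖ * ‖ζ a - ζ b‖ := by
          refine (norm_add_le _ _).trans (by rw [norm_mul, norm_mul])
      _ ≤ C.toNNReal * ((M * K' : ℝ≥0) * dist a b) + (‖g x‖ + M * K') * (K * dist a b) := by
          rw [← dist_eq_norm, ← dist_eq_norm]
          gcongr
      _ = _ := by push_cast; ring
  · refine ⟨0, (tsupport ζ)ᶜ, (isClosed_tsupport ζ).isOpen_compl.mem_nhds hx, ?_⟩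
    intro a ha b hb
    simp [image_eq_zero_of_notMem_tsupport ha, image_eq_zero_of_notMem_tsupport hb]

end Lipschitz

/-! ### Elementary facts on `L^q` seminorms -/

section Seminorms

variable {α F : Type*} [MeasurableSpace α] {μ : Measure α} [NormedAddCommGroup F]

lemma eLpNorm_le_add_of_ae_le {q : ℝ≥0∞} (hq : 1 ≤ q) {f : α → F} {g h : α → ℝ}
    (hg : AEStronglyMeasurable g μ) (hh : AEStronglyMeasurable h μ)
    (hle : ∀ᵐ x ∂μ, ‖f x‖ ≤ g x + h x) :
    eLpNorm f q μ ≤ eLpNorm g q μ + eLpNorm h q μ :=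
  (eLpNorm_mono_ae (hle.mono fun _ hx => hx.trans (Real.le_norm_self _))).trans
    (eLpNorm_add_le hg hh hq)

lemma eLpNorm_eq_rpow_lintegral {p : ℝ} (hp : 0 < p) (f : α → F) :
    eLpNorm f (ENNReal.ofReal p) μ = (∫⁻ x, ‖f x‖ₑ ^ p ∂μ) ^ (1 / p) := by
  rw [eLpNorm_eq_lintegral_rpow_enorm_toReal (by simpa using hp) ENNReal.ofReal_ne_top,
    ENNReal.toReal_ofReal hp.le]

/-- Dominated convergence. It handles the term (f'(φₖ) - f'(u)) √Q∇u of the chain rule, where f' is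
merely bounded and continuous. -/
lemma tendsto_eLpNorm_mul_of_bounded {p : ℝ} (hp : 0 < p) {g : α → ℝ} {a : ℕ → α → ℝ} {M : ℝ}
    (hg : eLpNorm g (ENNReal.ofReal p) μ < ∞) (hgm : AEStronglyMeasurable g μ)
    (ham : ∀ k, AEStronglyMeasurable (a k) μ) (haM : ∀ k, ∀ᵐ x ∂μ, |a k x| ≤ M)
    (ha : ∀ᵐ x ∂μ, Tendsto (fun k => a k x) atTop (𝓝 0)) :
    Tendsto (fun k => eLpNorm (fun x => a k x * g x) (ENNReal.ofReal p) μ) atTop (𝓝 0) := by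
  have hfin : ∫⁻ x, ‖M * g x‖ₑ ^ p ∂μ ≠ ∞ := by
    have h : eLpNorm (fun x => M * g x) (ENNReal.ofReal p) μ < ∞ :=
      (MemLp.const_mul ⟨hgm, hg⟩ M).2
    rw [eLpNorm_eq_rpow_lintegral hp] at h
    intro h'
    rw [h', ENNReal.top_rpow_of_pos (by positivity)] at h
    exact lt_irrefl _ h
  have h := tendsto_lintegral_of_dominated_convergence' (μ := μ)
    (F := fun k x => ‖a k x * g x‖ₑ ^ p) (f := fun _ => 0) (fun x => ‖M * g x‖ₑ ^ p)
    (fun k => ((ham k).mul hgm).enorm.pow_const _)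
    (fun k => by
      filter_upwards [haM k] with x hx
      gcongr
      rw [enorm_mul, enorm_mul]
      gcongr
      exact enorm_le_iff_norm_le.2 (by simpa using hx.trans (le_abs_self M))) hfin
    (by
      filter_upwards [ha] with x hx
      have h1 : Tendsto (fun k => a k x * g x) atTop (𝓝 0) := by simpa using hx.mul_const (g x)
      have h2 := (h1.enorm.ennrpow_const p)
      simpa [ENNReal.zero_rpow_of_pos hp] using h2)
  have h3 := h.ennrpow_const (1 / p)
  simp only [lintegral_const, zero_mul] at h3
  rw [ENNReal.zero_rpow_of_pos (by positivity)] at h3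
  exact h3.congr fun k => (eLpNorm_eq_rpow_lintegral hp _).symm

end Seminorms

/-! ### Degenerate Sobolev spaces -/

section Sobolev

variable {p : ℝ} {Q : E n → Matrix (Fin n) (Fin n) ℝ} {Ω D : Set (E n)}

lemma eLpNorm_le_wNorm (hp : 0 < p) (w : E n → ℝ) (v : E n → E n) :
    eLpNorm w (ENNReal.ofReal p) (volume.restrict D) ≤ wNorm p Q D w v := by
  rw [eLpNorm_eq_rpow_lintegral hp, wNorm]
  gcongr
  exact le_self_add

lemma eLpNorm_sqrtQ_le_wNorm (hp : 0 < p) (w : E n → ℝ) (v : E n → E n) :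
    eLpNorm (fun x => sqrtQ Q x (v x)) (ENNReal.ofReal p) (volume.restrict D) ≤
      wNorm p Q D w v := by
  rw [eLpNorm_eq_rpow_lintegral hp, wNorm]
  gcongr
  exact le_add_self

lemma wNorm_le_add (hp : 1 ≤ p) (w : E n → ℝ) (v : E n → E n) :
    wNorm p Q D w v ≤ eLpNorm w (ENNReal.ofReal p) (volume.restrict D) +
      eLpNorm (fun x => sqrtQ Q x (v x)) (ENNReal.ofReal p) (volume.restrict D) := by
  rw [eLpNorm_eq_rpow_lintegral (by linarith), eLpNorm_eq_rpow_lintegral (by linarith), wNorm]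
  exact ENNReal.rpow_add_le_add_rpow _ _ (by positivity) (by rw [div_le_one] <;> linarith)

lemma aestronglyMeasurable_of_mem_lipLoc (hΩ : IsOpen Ω) (hD : D ⊆ Ω) {f : E n → ℝ}
    (hf : f ∈ LipLoc Ω) : AEStronglyMeasurable f (volume.restrict D) :=
  ((LocallyLipschitzOn.continuousOn hf).aestronglyMeasurable hΩ.measurableSet).mono_measure
    (Measure.restrict_mono hD le_rfl)

/-- The distance of two functions in the degenerate Sobolev norm is controlled through a third
pair. -/
lemma wNorm_sub_le (hp : 1 ≤ p) (hQ : IsWeight Ω p Q) (hΩ : IsOpen Ω)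
    (hDm : NullMeasurableSet D volume) (hD : D ⊆ Ω) {f g w : E n → ℝ} {v : E n → E n}
    (hf : f ∈ LipLoc Ω) (hg : g ∈ LipLoc Ω) (hw : AEStronglyMeasurable w (volume.restrict D))
    (hv : AEStronglyMeasurable v (volume.restrict D)) :
    wNorm p Q D (fun x => f x - g x) (gradient fun x => f x - g x) ≤
      2 * wNorm p Q D (fun x => f x - w x) (fun x => gradient f x - v x) +
        2 * wNorm p Q D (fun x => g x - w x) (fun x => gradient g x - v x) := by
  have hp0 : 0 < p := by linarith
  have hq : 1 ≤ ENNReal.ofReal p := by simpa using hp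
  have hfm := aestronglyMeasurable_of_mem_lipLoc hΩ hD hf
  have hgm := aestronglyMeasurable_of_mem_lipLoc hΩ hD hg
  have h1 : eLpNorm (fun x => f x - g x) (ENNReal.ofReal p) (volume.restrict D) ≤
      eLpNorm (fun x => f x - w x) (ENNReal.ofReal p) (volume.restrict D) +
        eLpNorm (fun x => g x - w x) (ENNReal.ofReal p) (volume.restrict D) := by
    have := eLpNorm_sub_le (hfm.sub hw) (hgm.sub hw) hq
    refine le_of_eq_of_le (eLpNorm_congr_ae (.of_forall fun x => ?_)) this
    simp
  have h2 : eLpNorm (fun x => sqrtQ Q x (gradient (fun x => f x - g x) x)) (ENNReal.ofReal p)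
      (volume.restrict D) ≤
      eLpNorm (fun x => sqrtQ Q x (gradient f x - v x)) (ENNReal.ofReal p) (volume.restrict D) +
      eLpNorm (fun x => sqrtQ Q x (gradient g x - v x)) (ENNReal.ofReal p)
        (volume.restrict D) := by
    rw [← eLpNorm_norm (fun x => sqrtQ Q x (gradient f x - v x)),
      ← eLpNorm_norm (fun x => sqrtQ Q x (gradient g x - v x))]
    refine eLpNorm_le_add_of_ae_le hq
      (hQ.aestronglyMeasurable_norm_sqrtQ hDm hD
        ((measurable_gradient f).aestronglyMeasurable.sub hv))
      (hQ.aestronglyMeasurable_norm_sqrtQ hDm hD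
        ((measurable_gradient g).aestronglyMeasurable.sub hv)) ?_
    have hD' := Measure.restrict_mono (μ := (volume : Measure (E n))) hD le_rfl
    filter_upwards [ae_mono hD' (ae_differentiableAt_of_mem_lipLoc hΩ hf),
      ae_mono hD' (ae_differentiableAt_of_mem_lipLoc hΩ hg)] with x hfx hgx
    rw [gradient_sub_eq hfx hgx]
    have : gradient f x - gradient g x = (gradient f x - v x) - (gradient g x - v x) := by abel
    rw [this, sqrtQ_sub]
    exact norm_sub_le _ _
  refine (wNorm_le_add hp _ _).trans ((add_le_add h1 h2).trans ?_)
  rw [two_mul, two_mul, add_add_add_comm]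
  exact add_le_add
    (add_le_add (eLpNorm_le_wNorm hp0 _ fun x => gradient f x - v x)
      (eLpNorm_sqrtQ_le_wNorm hp0 (fun x => f x - w x) _))
    (add_le_add (eLpNorm_le_wNorm hp0 _ fun x => gradient g x - v x)
      (eLpNorm_sqrtQ_le_wNorm hp0 (fun x => g x - w x) _))

/-- A pair of the degenerate Sobolev space is approximated also almost everywhere, and in
`L^q(D)` if `L^q(D)` is controlled by the Sobolev norm. -/
lemma MemW.exists_seq (hp : 1 ≤ p) (hQ : IsWeight Ω p Q) (hΩ : IsOpen Ω) (hD : D ⊆ Ω)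
    {q : ℝ≥0∞} {u : E n → ℝ} {v : E n → E n} (hu : MemW p Q Ω u v)
    {c : ℝ} (hgain : ∀ f ∈ LipLoc Ω, eLpNorm f q (volume.restrict D) ≤
      ENNReal.ofReal c * wNorm p Q Ω f (gradient f)) :
    ∃ φ : ℕ → E n → ℝ, (∀ k, φ k ∈ LipLoc Ω) ∧ (∀ k, wNorm p Q Ω (φ k) (gradient (φ k)) < ∞) ∧
      Tendsto (fun k => wNorm p Q Ω (fun x => φ k x - u x) (fun x => gradient (φ k) x - v x))
        atTop (𝓝 0) ∧
      (∀ᵐ x ∂(volume.restrict Ω), Tendsto (fun k => φ k x) atTop (𝓝 (u x))) ∧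
      Tendsto (fun k => eLpNorm (fun x => φ k x - u x) q (volume.restrict D)) atTop (𝓝 0) := by
  obtain ⟨hum, hvm, φ, hφ, hlim⟩ := hu
  have hp0 : 0 < p := by linarith
  have hφm : ∀ k, AEStronglyMeasurable (φ k) (volume.restrict Ω) := fun k =>
    aestronglyMeasurable_of_mem_lipLoc hΩ le_rfl (hφ k).1
  have h1 : Tendsto (fun k => eLpNorm (φ k - u) (ENNReal.ofReal p) (volume.restrict Ω)) atTop
      (𝓝 0) := tendsto_of_tendsto_of_tendsto_of_le_of_le tendsto_const_nhds hlim
        (fun _ => zero_le) fun k => eLpNorm_le_wNorm hp0 _ _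
  obtain ⟨ns, hns, hae⟩ := (tendstoInMeasure_of_tendsto_eLpNorm (by simpa using hp0) hφm hum
    h1).exists_seq_tendsto_ae
  have hlim' := hlim.comp hns.tendsto_atTop
  refine ⟨fun k => φ (ns k), fun k => (hφ _).1, fun k => (hφ _).2, hlim', hae, ?_⟩
  set N : ℕ → ℝ≥0∞ := fun k =>
    wNorm p Q Ω (fun x => φ (ns k) x - u x) (fun x => gradient (φ (ns k)) x - v x) with hN
  have hle : ∀ k, eLpNorm (fun x => φ (ns k) x - u x) q (volume.restrict D) ≤
      ENNReal.ofReal c * (2 * N k) := by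
    intro k
    have hD' := Measure.restrict_mono (μ := (volume : Measure (E n))) hD le_rfl
    -- The gain is available only for locally Lipschitz functions, hence for φₖ - φₘ. Fatou's lemma
    -- in m, along the a.e. convergent subsequence, transfers it to φₖ - u.
    have h2 := Lp.eLpNorm_lim_le_liminf_eLpNorm (p := q) (μ := volume.restrict D)
      (f := fun m x => φ (ns k) x - φ (ns m) x)
      (fun m => ((hφm _).mono_measure hD').sub ((hφm _).mono_measure hD'))
      (fun x => φ (ns k) x - u x)
      (Filter.Eventually.mono (ae_mono hD' hae) fun x hx => tendsto_const_nhds.sub hx)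
    refine h2.trans ?_
    have h3 : ∀ m, eLpNorm (fun x => φ (ns k) x - φ (ns m) x) q (volume.restrict D) ≤
        ENNReal.ofReal c * (2 * N k + 2 * N m) := fun m =>
      (hgain _ (LipLoc.sub (hφ _).1 (hφ _).1)).trans (by
        gcongr
        exact wNorm_sub_le hp hQ hΩ hΩ.measurableSet.nullMeasurableSet le_rfl (hφ _).1 (hφ _).1
          hum hvm)
    have h4 : Tendsto (fun m => ENNReal.ofReal c * (2 * N k + 2 * N m)) atTop
        (𝓝 (ENNReal.ofReal c * (2 * N k + 2 * 0))) :=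
      ENNReal.Tendsto.const_mul (tendsto_const_nhds.add
        (ENNReal.Tendsto.const_mul hlim' (Or.inr (by simp)))) (Or.inr (by simp))
    calc _ ≤ liminf (fun m => ENNReal.ofReal c * (2 * N k + 2 * N m)) atTop :=
          liminf_le_liminf (Eventually.of_forall h3)
      _ = _ := by rw [h4.liminf_eq]; simp
  have h5 : Tendsto (fun k => ENNReal.ofReal c * (2 * N k)) atTop (𝓝 0) := by
    have := ENNReal.Tendsto.const_mul (a := ENNReal.ofReal c)
      (ENNReal.Tendsto.const_mul (a := 2) hlim' (Or.inr (by simp))) (Or.inr (by simp))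
    simpa using this
  exact tendsto_of_tendsto_of_tendsto_of_le_of_le tendsto_const_nhds h5 (fun _ => zero_le) hle

end Sobolev

/-! ### Products and compositions in the degenerate Sobolev space -/

section Products

variable {p : ℝ} {Q : E n → Matrix (Fin n) (Fin n) ℝ} {Ω D : Set (E n)}

lemma eLpNorm_mul_le_of_holder {α : Type*} [MeasurableSpace α] {μ : Measure α} {q r s : ℝ≥0∞}
    (h : s⁻¹ + r⁻¹ = q⁻¹) {f g : α → ℝ} (hf : AEStronglyMeasurable f μ)
    (hg : AEStronglyMeasurable g μ) :
    eLpNorm (fun x => f x * g x) q μ ≤ eLpNorm f s μ * eLpNorm g r μ := by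
  have : ENNReal.HolderTriple s r q := ⟨h⟩
  have := eLpNorm_smul_le_mul_eLpNorm (p := s) (q := r) (r := q) hg hf
  simpa only [Pi.smul_def, Pi.mul_def, smul_eq_mul] using this

lemma inv_mul_add_inv_mul_of_holderConjugate {t t' : ℝ≥0∞} (h : ENNReal.HolderConjugate t t')
    (hp : 0 < p) :
    (t * ENNReal.ofReal p)⁻¹ + (ENNReal.ofReal p * t')⁻¹ = (ENNReal.ofReal p)⁻¹ := by
  have h0 : ENNReal.ofReal p ≠ 0 := by simpa using hp
  rw [ENNReal.mul_inv (Or.inr ENNReal.ofReal_ne_top) (Or.inr h0),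
    ENNReal.mul_inv (Or.inl h0) (Or.inl ENNReal.ofReal_ne_top),
    mul_comm (ENNReal.ofReal p)⁻¹, ← add_mul, h.inv_add_inv_eq_inv, inv_one, one_mul]

/-- For approximants φₖ of u, the gradient error of ζ f(φₖ) splits into three parts. The part (f(φₖ)
- f(u))∇ζ is controlled by Hölder's inequality with exponents tp and pt', which is where the
integrability of √Q∇ζ and the gain in L^{pt'} meet. The part ζ f'(φₖ)(∇φₖ - ∇u) is controlled by the
Sobolev norm, and the part ζ (f'(φₖ) - f'(u))∇u by dominated convergence. -/
theorem memWZero_mul_comp (hp : 1 < p) (hΩ : IsOpen Ω) (hQ : IsWeight Ω p Q)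
    (hDm : NullMeasurableSet D volume) (hD : D ⊆ Ω) (hDfin : volume D < ∞)
    {ζ : E n → ℝ} (hζ : ζ ∈ LipZero D) (hζ1 : ∀ x, |ζ x| ≤ 1) {t t' : ℝ≥0∞}
    (htt : ENNReal.HolderConjugate t t')
    (hG : eLpNorm (fun x => sqrtQ Q x (gradient ζ x)) (t * ENNReal.ofReal p)
      (volume.restrict D) < ∞) {c : ℝ}
    (hgain : ∀ f ∈ LipLoc Ω, eLpNorm f (ENNReal.ofReal p * t') (volume.restrict D) ≤
      ENNReal.ofReal c * wNorm p Q Ω f (gradient f))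
    {u : E n → ℝ} {v : E n → E n} (hu : MemW p Q Ω u v) {f f' : ℝ → ℝ}
    (hf : ∀ z, HasDerivAt f (f' z) z) (hf' : Continuous f') {M : ℝ} (hM : ∀ z, |f' z| ≤ M) :
    MemWZero p Q D (fun x => ζ x * f (u x))
      (fun x => f (u x) • gradient ζ x + (ζ x * f' (u x)) • v x) := by
  have hp0 : 0 < p := by linarith
  have hq1 : 1 ≤ ENNReal.ofReal p := by simpa using hp.le
  have hM0 : 0 ≤ M := (abs_nonneg _).trans (hM 0)
  have hfc : Continuous f := continuous_iff_continuousAt.2 fun z => (hf z).continuousAt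
  have hLip : LipschitzWith M.toNNReal f := by
    refine lipschitzWith_of_nnnorm_deriv_le (fun z => (hf z).differentiableAt) fun z => ?_
    rw [(hf z).deriv, ← NNReal.coe_le_coe, coe_nnnorm, Real.coe_toNNReal _ hM0]
    exact hM z
  have hLip' : ∀ y z, |f y - f z| ≤ M * |y - z| := fun y z => by
    simpa [Real.dist_eq, Real.coe_toNNReal _ hM0] using hLip.dist_le_mul y z
  obtain ⟨φ, hφ, hφfin, hlim, hae, hgl⟩ := hu.exists_seq hp.le hQ hΩ hD hgain
  have hD' := Measure.restrict_mono (μ := (volume : Measure (E n))) hD le_rfl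
  have hum : AEStronglyMeasurable u (volume.restrict D) := hu.1.mono_measure hD'
  have hvm : AEStronglyMeasurable v (volume.restrict D) := hu.2.1.mono_measure hD'
  have hζm : AEStronglyMeasurable ζ (volume.restrict D) := by
    obtain ⟨⟨K, hK⟩, -⟩ := hζ
    exact hK.continuous.aestronglyMeasurable
  have hφm : ∀ k, AEStronglyMeasurable (φ k) (volume.restrict D) := fun k =>
    aestronglyMeasurable_of_mem_lipLoc hΩ hD (hφ k)
  have hGm : AEStronglyMeasurable (fun x => ‖sqrtQ Q x (gradient ζ x)‖) (volume.restrict D) :=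
    hQ.aestronglyMeasurable_norm_sqrtQ hDm hD (measurable_gradient ζ).aestronglyMeasurable
  have hXm : AEStronglyMeasurable (fun x => ‖sqrtQ Q x (v x)‖) (volume.restrict D) :=
    hQ.aestronglyMeasurable_norm_sqrtQ hDm hD hvm
  have hdm : ∀ k, AEStronglyMeasurable (fun x => ‖sqrtQ Q x (gradient (φ k) x - v x)‖)
      (volume.restrict D) := fun k => hQ.aestronglyMeasurable_norm_sqrtQ hDm hD
        ((measurable_gradient (φ k)).aestronglyMeasurable.sub hvm)
  have hholder := inv_mul_add_inv_mul_of_holderConjugate htt hp0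
  have hgrad : ∀ k, ∀ᵐ x ∂(volume.restrict D), gradient (fun y => ζ y * f (φ k y)) x =
      f (φ k x) • gradient ζ x + (ζ x * f' (φ k x)) • gradient (φ k) x := by
    intro k
    filter_upwards [ae_mono hD' (ae_differentiableAt_of_mem_lipLoc hΩ (hφ k)),
      ae_mono hD' (ae_differentiableAt_of_mem_lipLoc hΩ (mem_lipLoc_of_mem_lipZero hζ))]
      with x h1 h2
    exact gradient_mul_comp_eq h2 h1 (hf _)
  refine ⟨hζm.mul (hfc.comp_aestronglyMeasurable hum), ?_, fun k x => ζ x * f (φ k x),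
    fun k => ⟨LipZero.mul_comp hΩ hD hζ (hφ k) hLip, ?_⟩, ?_⟩
  · exact ((hfc.comp_aestronglyMeasurable hum).smul
      (measurable_gradient ζ).aestronglyMeasurable).add
      ((hζm.mul (hf'.comp_aestronglyMeasurable hum)).smul hvm)
  · refine (wNorm_le_add hp.le _ _).trans_lt (ENNReal.add_lt_top.2 ⟨?_, ?_⟩)
    · have h1 : eLpNorm (fun x => ζ x * f (φ k x)) (ENNReal.ofReal p) (volume.restrict D) ≤
          eLpNorm (fun _ : E n => |f 0|) (ENNReal.ofReal p) (volume.restrict D) +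
          eLpNorm (fun x => M * ‖φ k x‖) (ENNReal.ofReal p) (volume.restrict D) := by
        refine eLpNorm_le_add_of_ae_le hq1 aestronglyMeasurable_const
          ((hφm k).norm.const_mul M) (.of_forall fun x => ?_)
        have h2 := hLip' (φ k x) 0
        have h3 : |f (φ k x)| ≤ |f 0| + M * |φ k x| := by
          have := abs_sub_abs_le_abs_sub (f (φ k x)) (f 0)
          rw [sub_zero] at h2
          linarith
        rw [norm_mul, Real.norm_eq_abs, Real.norm_eq_abs, Real.norm_eq_abs]
        nlinarith [hζ1 x, abs_nonneg (f (φ k x)), abs_nonneg (ζ x)]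
      have : IsFiniteMeasure (volume.restrict D) := ⟨by simpa using hDfin⟩
      refine h1.trans_lt (ENNReal.add_lt_top.2 ⟨(memLp_const _).2, ?_⟩)
      refine MemLp.eLpNorm_lt_top (MemLp.const_mul ⟨(hφm k).norm, ?_⟩ M)
      rw [eLpNorm_norm]
      exact ((eLpNorm_mono_measure _ hD').trans (eLpNorm_le_wNorm hp0 _ _)).trans_lt (hφfin k)
    · have h1 : eLpNorm (fun x => sqrtQ Q x (gradient (fun y => ζ y * f (φ k y)) x))
          (ENNReal.ofReal p) (volume.restrict D) ≤
          eLpNorm (fun x => ‖sqrtQ Q x (gradient ζ x)‖ * |f (φ k x)|) (ENNReal.ofReal p)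
            (volume.restrict D) +
          eLpNorm (fun x => M * ‖sqrtQ Q x (gradient (φ k) x)‖) (ENNReal.ofReal p)
            (volume.restrict D) := by
        have hfm : AEStronglyMeasurable (fun x => |f (φ k x)|) (volume.restrict D) :=
          (hfc.comp_aestronglyMeasurable (hφm k)).norm
        refine eLpNorm_le_add_of_ae_le hq1 (hGm.mul hfm)
          ((hQ.aestronglyMeasurable_norm_sqrtQ hDm hD
            (measurable_gradient (φ k)).aestronglyMeasurable).const_mul M) ?_
        filter_upwards [hgrad k] with x hx
        rw [hx, sqrtQ_add, sqrtQ_smul, sqrtQ_smul]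
        refine (norm_add_le _ _).trans (add_le_add ?_ ?_)
        · rw [norm_smul, mul_comm, Real.norm_eq_abs]
        · rw [norm_smul, norm_mul, Real.norm_eq_abs, Real.norm_eq_abs]
          refine mul_le_mul_of_nonneg_right ?_ (norm_nonneg _)
          nlinarith [hζ1 x, hM (φ k x), abs_nonneg (ζ x), abs_nonneg (f' (φ k x))]
      refine h1.trans_lt (ENNReal.add_lt_top.2 ⟨?_, ?_⟩)
      · have hfm : AEStronglyMeasurable (fun x => |f (φ k x)|) (volume.restrict D) :=
          (hfc.comp_aestronglyMeasurable (hφm k)).norm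
        refine (eLpNorm_mul_le_of_holder hholder hGm hfm).trans_lt ?_
        rw [eLpNorm_norm]
        refine ENNReal.mul_lt_top hG ?_
        have hpt : 1 ≤ ENNReal.ofReal p * t' := by
          have := htt.symm.one_le
          calc (1 : ℝ≥0∞) = 1 * 1 := by simp
            _ ≤ _ := by gcongr
        have h2 : eLpNorm (fun x => |f (φ k x)|) (ENNReal.ofReal p * t') (volume.restrict D) ≤
            eLpNorm (fun _ : E n => |f 0|) (ENNReal.ofReal p * t') (volume.restrict D) +
            eLpNorm (fun x => M * ‖φ k x‖) (ENNReal.ofReal p * t') (volume.restrict D) := by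
          refine eLpNorm_le_add_of_ae_le hpt aestronglyMeasurable_const
            ((hφm k).norm.const_mul M) (.of_forall fun x => ?_)
          have h2 := hLip' (φ k x) 0
          have := abs_sub_abs_le_abs_sub (f (φ k x)) (f 0)
          rw [sub_zero] at h2
          rw [Real.norm_eq_abs, Real.norm_eq_abs, abs_abs]
          linarith
        have : IsFiniteMeasure (volume.restrict D) := ⟨by simpa using hDfin⟩
        refine h2.trans_lt (ENNReal.add_lt_top.2 ⟨(memLp_const _).2, ?_⟩)
        refine MemLp.eLpNorm_lt_top (MemLp.const_mul ⟨(hφm k).norm, ?_⟩ M)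
        rw [eLpNorm_norm]
        exact (hgain _ (hφ k)).trans_lt (ENNReal.mul_lt_top ENNReal.ofReal_lt_top (hφfin k))
      · refine MemLp.eLpNorm_lt_top (MemLp.const_mul
          ⟨hQ.aestronglyMeasurable_norm_sqrtQ hDm hD
            (measurable_gradient (φ k)).aestronglyMeasurable, ?_⟩ M)
        rw [eLpNorm_norm]
        exact ((eLpNorm_mono_measure _ hD').trans
          (eLpNorm_sqrtQ_le_wNorm hp0 _ _)).trans_lt (hφfin k)
  · set N : ℕ → ℝ≥0∞ := fun k =>
      wNorm p Q Ω (fun x => φ k x - u x) (fun x => gradient (φ k) x - v x) with hN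
    set R : ℕ → ℝ≥0∞ := fun k => eLpNorm (fun x => φ k x - u x) (ENNReal.ofReal p * t')
      (volume.restrict D) with hR
    set S : ℕ → ℝ≥0∞ := fun k => eLpNorm (fun x => |f' (φ k x) - f' (u x)| *
      ‖sqrtQ Q x (v x)‖) (ENNReal.ofReal p) (volume.restrict D) with hS
    have hSlim : Tendsto S atTop (𝓝 0) := by
      refine tendsto_eLpNorm_mul_of_bounded (M := 2 * M) hp0 ?_ hXm ?_ ?_ ?_
      · rw [eLpNorm_norm]
        obtain ⟨k, hk⟩ := ((tendsto_order.1 hlim).2 1 one_pos).exists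
        have h1 : eLpNorm (fun x => sqrtQ Q x (v x)) (ENNReal.ofReal p) (volume.restrict D) ≤
            eLpNorm (fun x => ‖sqrtQ Q x (gradient (φ k) x)‖) (ENNReal.ofReal p)
              (volume.restrict D) +
            eLpNorm (fun x => ‖sqrtQ Q x (gradient (φ k) x - v x)‖) (ENNReal.ofReal p)
              (volume.restrict D) := by
          refine eLpNorm_le_add_of_ae_le hq1 (hQ.aestronglyMeasurable_norm_sqrtQ hDm hD
            (measurable_gradient (φ k)).aestronglyMeasurable) (hdm k) (.of_forall fun x => ?_)
          have : v x = gradient (φ k) x - (gradient (φ k) x - v x) := by abel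
          conv_lhs => rw [this, sqrtQ_sub]
          exact norm_sub_le _ _
        refine h1.trans_lt (ENNReal.add_lt_top.2 ⟨?_, ?_⟩) <;> rw [eLpNorm_norm]
        · exact ((eLpNorm_mono_measure _ hD').trans
            (eLpNorm_sqrtQ_le_wNorm hp0 _ _)).trans_lt (hφfin k)
        · exact ((eLpNorm_mono_measure _ hD').trans (eLpNorm_sqrtQ_le_wNorm hp0
            (fun x => φ k x - u x) _)).trans_lt (hk.trans ENNReal.one_lt_top)
      · exact fun k => ((hf'.comp_aestronglyMeasurable (hφm k)).sub
          (hf'.comp_aestronglyMeasurable hum)).norm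
      · refine fun k => .of_forall fun x => ?_
        rw [abs_abs]
        have := abs_sub (f' (φ k x)) (f' (u x))
        linarith [hM (φ k x), hM (u x)]
      · filter_upwards [ae_mono hD' hae] with x hx
        have h1 := ((hf'.tendsto (u x)).comp hx).sub_const (f' (u x))
        rw [sub_self] at h1
        simpa using h1.abs
    have hbound : ∀ k, wNorm p Q D (fun x => ζ x * f (φ k x) - ζ x * f (u x))
        (fun x => gradient (fun y => ζ y * f (φ k y)) x -
          (f (u x) • gradient ζ x + (ζ x * f' (u x)) • v x)) ≤
        ENNReal.ofReal M * N k + (eLpNorm (fun x => sqrtQ Q x (gradient ζ x))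
          (t * ENNReal.ofReal p) (volume.restrict D) * (ENNReal.ofReal M * R k) +
          (ENNReal.ofReal M * N k + S k)) := by
      intro k
      have hMe : ENNReal.ofReal M = ‖M‖ₑ := (Real.enorm_of_nonneg hM0).symm
      have hdu : AEStronglyMeasurable (fun x => M * |φ k x - u x|) (volume.restrict D) :=
        ((hφm k).sub hum).norm.const_mul M
      have hRle : ∀ q, eLpNorm (fun x => M * |φ k x - u x|) q (volume.restrict D) =
          ENNReal.ofReal M * eLpNorm (fun x => φ k x - u x) q (volume.restrict D) := by
        intro q
        rw [← eLpNorm_norm (fun x => φ k x - u x), hMe]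
        exact eLpNorm_const_smul M (fun x => ‖φ k x - u x‖) q _
      refine (wNorm_le_add hp.le _ _).trans (add_le_add ?_ ?_)
      · refine (eLpNorm_mono_real (g := fun x => M * |φ k x - u x|) fun x => ?_).trans ?_
        · rw [← mul_sub, norm_mul, Real.norm_eq_abs, Real.norm_eq_abs]
          nlinarith [hζ1 x, hLip' (φ k x) (u x), abs_nonneg (f (φ k x) - f (u x))]
        · rw [hRle]
          gcongr
          exact (eLpNorm_mono_measure _ hD').trans
            (eLpNorm_le_wNorm hp0 _ fun x => gradient (φ k) x - v x)
      · have h1 : eLpNorm (fun x => sqrtQ Q x (gradient (fun y => ζ y * f (φ k y)) x -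
            (f (u x) • gradient ζ x + (ζ x * f' (u x)) • v x))) (ENNReal.ofReal p)
              (volume.restrict D) ≤
            eLpNorm (fun x => ‖sqrtQ Q x (gradient ζ x)‖ * (M * |φ k x - u x|))
              (ENNReal.ofReal p) (volume.restrict D) +
            eLpNorm (fun x => M * ‖sqrtQ Q x (gradient (φ k) x - v x)‖ +
              |f' (φ k x) - f' (u x)| * ‖sqrtQ Q x (v x)‖)
              (ENNReal.ofReal p) (volume.restrict D) := by
          have hf'm : AEStronglyMeasurable (fun x => |f' (φ k x) - f' (u x)|)
              (volume.restrict D) := ((hf'.comp_aestronglyMeasurable (hφm k)).sub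
                (hf'.comp_aestronglyMeasurable hum)).norm
          refine eLpNorm_le_add_of_ae_le hq1 (hGm.mul hdu)
            (((hdm k).const_mul M).add (hf'm.mul hXm)) ?_
          filter_upwards [hgrad k] with x hx
          have hdec : gradient (fun y => ζ y * f (φ k y)) x -
              (f (u x) • gradient ζ x + (ζ x * f' (u x)) • v x) =
              (f (φ k x) - f (u x)) • gradient ζ x +
                ((ζ x * f' (φ k x)) • (gradient (φ k) x - v x) +
                  (ζ x * (f' (φ k x) - f' (u x))) • v x) := by
            rw [hx]; module
          rw [hdec, sqrtQ_add, sqrtQ_add, sqrtQ_smul, sqrtQ_smul, sqrtQ_smul]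
          refine (norm_add_le _ _).trans (add_le_add ?_ ((norm_add_le _ _).trans
            (add_le_add ?_ ?_)))
          · rw [norm_smul, mul_comm, Real.norm_eq_abs]
            exact mul_le_mul_of_nonneg_left (hLip' _ _) (norm_nonneg _)
          · rw [norm_smul, norm_mul, Real.norm_eq_abs, Real.norm_eq_abs]
            refine mul_le_mul_of_nonneg_right ?_ (norm_nonneg _)
            nlinarith [hζ1 x, hM (φ k x), abs_nonneg (ζ x), abs_nonneg (f' (φ k x))]
          · rw [norm_smul, norm_mul, Real.norm_eq_abs, Real.norm_eq_abs]
            refine mul_le_mul_of_nonneg_right ?_ (norm_nonneg _)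
            exact mul_le_of_le_one_left (abs_nonneg _) (hζ1 x)
        refine h1.trans (add_le_add ?_ ?_)
        · refine (eLpNorm_mul_le_of_holder hholder hGm hdu).trans ?_
          rw [eLpNorm_norm, hRle]
        · have hf'm : AEStronglyMeasurable (fun x => |f' (φ k x) - f' (u x)|)
              (volume.restrict D) := ((hf'.comp_aestronglyMeasurable (hφm k)).sub
                (hf'.comp_aestronglyMeasurable hum)).norm
          refine (eLpNorm_add_le ((hdm k).const_mul M) (hf'm.mul hXm) hq1).trans
            (add_le_add ?_ le_rfl)
          have h2 := eLpNorm_const_smul M (fun x => ‖sqrtQ Q x (gradient (φ k) x - v x)‖)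
            (ENNReal.ofReal p) (volume.restrict D)
          refine h2.le.trans ?_
          rw [eLpNorm_norm, hMe]
          gcongr
          exact (eLpNorm_mono_measure _ hD').trans
            (eLpNorm_sqrtQ_le_wNorm hp0 (fun x => φ k x - u x) _)
    have hMN : Tendsto (fun k => ENNReal.ofReal M * N k) atTop (𝓝 0) := by
      simpa using ENNReal.Tendsto.const_mul (a := ENNReal.ofReal M) hlim (Or.inr (by simp))
    have hMR : Tendsto (fun k => eLpNorm (fun x => sqrtQ Q x (gradient ζ x))
        (t * ENNReal.ofReal p) (volume.restrict D) * (ENNReal.ofReal M * R k)) atTop (𝓝 0) := by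
      have h1 : Tendsto (fun k => ENNReal.ofReal M * R k) atTop (𝓝 0) := by
        simpa using ENNReal.Tendsto.const_mul (a := ENNReal.ofReal M) hgl (Or.inr (by simp))
      simpa using ENNReal.Tendsto.const_mul h1 (Or.inr hG.ne)
    have hall := hMN.add (hMR.add (hMN.add hSlim))
    simp only [add_zero] at hall
    exact tendsto_of_tendsto_of_tendsto_of_le_of_le tendsto_const_nhds hall
      (fun _ => zero_le) hbound

end Products

/-! ### Test functions of the degenerate Sobolev space -/

section TestFunctions

variable {p : ℝ} {Q : E n → Matrix (Fin n) (Fin n) ℝ} {Ω D : Set (E n)}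

lemma wNorm_congr_ae {w w' : E n → ℝ} {v v' : E n → E n}
    (hw : ∀ᵐ x ∂(volume.restrict D), ‖w x‖ = ‖w' x‖)
    (hv : ∀ᵐ x ∂(volume.restrict D), ‖sqrtQ Q x (v x)‖ = ‖sqrtQ Q x (v' x)‖) :
    wNorm p Q D w v = wNorm p Q D w' v' := by
  unfold wNorm
  congr 2
  · refine lintegral_congr_ae (hw.mono fun x hx => ?_)
    simp only [← ofReal_norm, hx]
  · refine lintegral_congr_ae (hv.mono fun x hx => ?_)
    simp only [← ofReal_norm, hx]

lemma MemWZero.wNorm_lt_top (hp : 1 ≤ p) (hQ : IsWeight Ω p Q) (hΩ : IsOpen Ω)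
    (hDm : NullMeasurableSet D volume) (hD : D ⊆ Ω) {w : E n → ℝ} {v : E n → E n}
    (hw : MemWZero p Q D w v) : wNorm p Q D w v < ∞ := by
  obtain ⟨hwm, hvm, φ, hφ, hlim⟩ := hw
  have hp0 : 0 < p := by linarith
  have hq : 1 ≤ ENNReal.ofReal p := by simpa using hp
  obtain ⟨k, hk⟩ := ((tendsto_order.1 hlim).2 1 one_pos).exists
  replace hk := hk.trans ENNReal.one_lt_top
  have hφm : AEStronglyMeasurable (φ k) (volume.restrict D) :=
    aestronglyMeasurable_of_mem_lipLoc hΩ hD (mem_lipLoc_of_mem_lipZero (hφ k).1)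
  refine (wNorm_le_add hp _ _).trans_lt (ENNReal.add_lt_top.2 ⟨?_, ?_⟩)
  · have h : eLpNorm w (ENNReal.ofReal p) (volume.restrict D) ≤
        eLpNorm (fun x => ‖φ k x‖) (ENNReal.ofReal p) (volume.restrict D) +
        eLpNorm (fun x => ‖φ k x - w x‖) (ENNReal.ofReal p) (volume.restrict D) := by
      refine eLpNorm_le_add_of_ae_le hq hφm.norm (hφm.sub hwm).norm (.of_forall fun x => ?_)
      have := norm_sub_le (φ k x) (φ k x - w x)
      rwa [sub_sub_cancel] at this
    rw [eLpNorm_norm, eLpNorm_norm] at h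
    exact h.trans_lt (ENNReal.add_lt_top.2 ⟨(eLpNorm_le_wNorm hp0 _ _).trans_lt (hφ k).2,
      (eLpNorm_le_wNorm hp0 _ fun x => gradient (φ k) x - v x).trans_lt hk⟩)
  · have h : eLpNorm (fun x => sqrtQ Q x (v x)) (ENNReal.ofReal p) (volume.restrict D) ≤
        eLpNorm (fun x => ‖sqrtQ Q x (gradient (φ k) x)‖) (ENNReal.ofReal p)
          (volume.restrict D) +
        eLpNorm (fun x => ‖sqrtQ Q x (gradient (φ k) x - v x)‖) (ENNReal.ofReal p)
          (volume.restrict D) := by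
      refine eLpNorm_le_add_of_ae_le hq (hQ.aestronglyMeasurable_norm_sqrtQ hDm hD
        (measurable_gradient (φ k)).aestronglyMeasurable) (hQ.aestronglyMeasurable_norm_sqrtQ
          hDm hD ((measurable_gradient (φ k)).aestronglyMeasurable.sub hvm))
        (.of_forall fun x => ?_)
      have := norm_sub_le (sqrtQ Q x (gradient (φ k) x)) (sqrtQ Q x (gradient (φ k) x - v x))
      rwa [← sqrtQ_sub, sub_sub_cancel] at this
    rw [eLpNorm_norm, eLpNorm_norm] at h
    exact h.trans_lt (ENNReal.add_lt_top.2 ⟨(eLpNorm_sqrtQ_le_wNorm hp0 _ _).trans_lt (hφ k).2,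
      (eLpNorm_sqrtQ_le_wNorm hp0 (fun x => φ k x - w x) _).trans_lt hk⟩)

/-- Needed to apply the Sobolev inequality to the difference between an approximating Lipschitz
function and the limit pair. -/
lemma MemWZero.lipZero_sub (hp : 1 ≤ p) (hQ : IsWeight Ω p Q) (hΩ : IsOpen Ω)
    (hDm : NullMeasurableSet D volume) (hD : D ⊆ Ω) {w : E n → ℝ} {v : E n → E n}
    (hw : MemWZero p Q D w v) {f : E n → ℝ} (hf : f ∈ LipZero D)
    (hffin : wNorm p Q D f (gradient f) < ∞) :
    MemWZero p Q D (fun x => f x - w x) (fun x => gradient f x - v x) := by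
  obtain ⟨hwm, hvm, φ, hφ, hlim⟩ := hw
  have hfm : AEStronglyMeasurable f (volume.restrict D) :=
    aestronglyMeasurable_of_mem_lipLoc hΩ hD (mem_lipLoc_of_mem_lipZero hf)
  refine ⟨hfm.sub hwm, (measurable_gradient f).aestronglyMeasurable.sub hvm,
    fun k x => f x - φ k x, fun k => ⟨LipZero.sub hf (hφ k).1, ?_⟩, ?_⟩
  · have h := wNorm_sub_le (D := D) (w := 0) (v := 0) hp hQ hΩ hDm hD
      (mem_lipLoc_of_mem_lipZero hf) (mem_lipLoc_of_mem_lipZero (hφ k).1)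
      aestronglyMeasurable_const aestronglyMeasurable_const
    simp only [Pi.zero_apply, sub_zero] at h
    exact h.trans_lt (ENNReal.add_lt_top.2 ⟨ENNReal.mul_lt_top (by simp) hffin,
      ENNReal.mul_lt_top (by simp) (hφ k).2⟩)
  · refine hlim.congr fun k => wNorm_congr_ae (.of_forall fun x => ?_) ?_
    · rw [← norm_neg]
      congr 1
      ring
    · have hD' := Measure.restrict_mono (μ := (volume : Measure (E n))) hD le_rfl
      filter_upwards [ae_mono hD' (ae_differentiableAt_of_mem_lipLoc hΩ
        (mem_lipLoc_of_mem_lipZero hf)), ae_mono hD' (ae_differentiableAt_of_mem_lipLoc hΩ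
        (mem_lipLoc_of_mem_lipZero (hφ k).1))] with x h1 h2
      rw [gradient_sub_eq h1 h2, ← norm_neg, ← neg_one_smul ℝ, ← sqrtQ_smul]
      congr 2
      module

/-- Unnormalized form of the Sobolev estimate on a ball of positive measure. -/
lemma SobolevEstimate.exists_eLpNorm_le {ρ : E n → E n → ℝ} {r₁ : E n → ℝ} {σ : ℝ}
    (hp : 1 ≤ p) (h : SobolevEstimate Ω ρ r₁ p σ Q) {y : E n} (hy : y ∈ Ω) {r : ℝ} (hr : 0 < r)
    (hr₁ : r < r₁ y) (h0 : volume (qball Ω ρ y r) ≠ 0) (hfin : volume (qball Ω ρ y r) ≠ ∞) :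
    ∃ C : ℝ≥0∞, C ≠ ∞ ∧ ∀ (w : E n → ℝ) (v : E n → E n), MemWZero p Q (qball Ω ρ y r) w v →
      eLpNorm w (ENNReal.ofReal (p * σ)) (volume.restrict (qball Ω ρ y r)) ≤
        C * wNorm p Q (qball Ω ρ y r) w v := by
  obtain ⟨C, -, hC⟩ := h
  set m := (volume (qball Ω ρ y r))⁻¹ with hm
  have hm0 : m ≠ 0 := ENNReal.inv_ne_zero.2 hfin
  have hmt : m ≠ ∞ := ENNReal.inv_ne_top.2 h0
  have hp0 : 0 < p := by linarith
  set a := m ^ (1 / ENNReal.ofReal (p * σ)).toReal with ha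
  set b := m ^ (1 / ENNReal.ofReal p).toReal with hb
  have ha0 : a ≠ 0 := (ENNReal.rpow_pos (pos_iff_ne_zero.2 hm0) hmt).ne'
  have hat : a ≠ ∞ := ENNReal.rpow_ne_top_of_nonneg ENNReal.toReal_nonneg hmt
  have hbt : b ≠ ∞ := ENNReal.rpow_ne_top_of_nonneg ENNReal.toReal_nonneg hmt
  refine ⟨a⁻¹ * (ENNReal.ofReal C * (ENNReal.ofReal r * b + b)), by finiteness, ?_⟩
  intro w v hw
  have h1 := hC y hy r hr hr₁ w v hw
  unfold avgNorm at h1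
  rw [eLpNorm_smul_measure_of_ne_top ENNReal.ofReal_ne_top,
    eLpNorm_smul_measure_of_ne_top ENNReal.ofReal_ne_top,
    eLpNorm_smul_measure_of_ne_top ENNReal.ofReal_ne_top] at h1
  simp only [smul_eq_mul, ← hm, ← ha, ← hb] at h1
  rw [mul_assoc]
  rw [← ENNReal.div_eq_inv_mul, ENNReal.le_div_iff_mul_le (Or.inl ha0) (Or.inl hat), mul_comm]
  refine h1.trans ?_
  rw [mul_assoc, add_mul, mul_assoc]
  gcongr
  · exact eLpNorm_sqrtQ_le_wNorm hp0 _ _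
  · exact eLpNorm_le_wNorm hp0 _ _

/-- The weak formulation of the equation extends from Lipschitz test functions to the degenerate
Sobolev space of a set on which the Sobolev inequality holds. -/
theorem IsWeakSolution.integral_memWZero_eq_zero {A : E n → ℝ → E n → E n}
    {B : E n → ℝ → E n → ℝ} {u : E n → ℝ} {v : E n → E n}
    (hsol : IsWeakSolution Ω p Q A B u v) (hp : 1 ≤ p) (hQ : IsWeight Ω p Q) (hΩ : IsOpen Ω)
    (hDm : NullMeasurableSet D volume) (hD : D ⊆ Ω) {p' q q' : ℝ≥0∞}
    (hpp : ENNReal.HolderConjugate (ENNReal.ofReal p) p') (hqq : ENNReal.HolderConjugate q q')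
    {C : ℝ≥0∞} (hCt : C ≠ ∞)
    (hS : ∀ (w : E n → ℝ) (g : E n → E n), MemWZero p Q D w g →
      eLpNorm w q (volume.restrict D) ≤ C * wNorm p Q D w g)
    {a₁ a₂ : E n → ℝ} (ha₁ : MemLp a₁ p' (volume.restrict D))
    (ha₂ : MemLp a₂ q' (volume.restrict D))
    (hA : ∀ᵐ x ∂(volume.restrict D), ∀ ξ : E n,
      |inner ℝ ξ (A x (u x) (v x))| ≤ ‖sqrtQ Q x ξ‖ * a₁ x)
    (hB : ∀ᵐ x ∂(volume.restrict D), |B x (u x) (v x)| ≤ a₂ x)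
    {w : E n → ℝ} {g : E n → E n} (hw : MemWZero p Q D w g) :
    IntegrableOn (fun x => inner ℝ (g x) (A x (u x) (v x)) + w x * B x (u x) (v x)) D volume ∧
    ∫ x in D, (inner ℝ (g x) (A x (u x) (v x)) + w x * B x (u x) (v x)) = 0 := by
  have hp0 : 0 < p := by linarith
  obtain ⟨hwm, hgm, φ, hφ, hlim⟩ := id hw
  set I : E n → ℝ := fun x => inner ℝ (g x) (A x (u x) (v x)) + w x * B x (u x) (v x) with hI
  set J : ℕ → E n → ℝ := fun k x =>
    inner ℝ (gradient (φ k) x) (A x (u x) (v x)) + φ k x * B x (u x) (v x) with hJ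
  have hD' := Measure.restrict_mono (μ := (volume : Measure (E n))) hD le_rfl
  have hJi : ∀ k, Integrable (J k) (volume.restrict D) := fun k =>
    (hsol.2 _ (LipZero.mono hD (hφ k).1)).1.mono_set hD
  -- Both φₖ and its gradient vanish off a subset of D, so the identity over Ω is an identity over
  -- D.
  have hJ0 : ∀ k, ∫ x in D, J k x = 0 := by
    intro k
    rw [← (hsol.2 _ (LipZero.mono hD (hφ k).1)).2]
    symm
    refine setIntegral_eq_of_subset_of_ae_sdiff_eq_zero hΩ.measurableSet.nullMeasurableSet hD
      (.of_forall fun x hx => ?_)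
    have hx' : x ∉ tsupport (φ k) := fun h => hx.2 ((hφ k).1.2.2 h)
    simp [gradient_eq_zero_of_notMem_tsupport hx', image_eq_zero_of_notMem_tsupport hx']
  set N : ℕ → ℝ≥0∞ := fun k =>
    wNorm p Q D (fun x => φ k x - w x) (fun x => gradient (φ k) x - g x) with hN
  set H : ℕ → E n → ℝ := fun k x => ‖sqrtQ Q x (gradient (φ k) x - g x)‖ * a₁ x +
    ‖φ k x - w x‖ * a₂ x with hH
  have hm1 : ∀ k, AEStronglyMeasurable (fun x => ‖sqrtQ Q x (gradient (φ k) x - g x)‖)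
      (volume.restrict D) := fun k => hQ.aestronglyMeasurable_norm_sqrtQ hDm hD
        ((measurable_gradient (φ k)).aestronglyMeasurable.sub hgm)
  have hm2 : ∀ k, AEStronglyMeasurable (fun x => ‖φ k x - w x‖) (volume.restrict D) := fun k =>
    ((aestronglyMeasurable_of_mem_lipLoc hΩ hD (mem_lipLoc_of_mem_lipZero (hφ k).1)).sub
      hwm).norm
  have hHm : ∀ k, AEStronglyMeasurable (H k) (volume.restrict D) := fun k =>
    ((hm1 k).mul ha₁.1).add ((hm2 k).mul ha₂.1)
  have hHle : ∀ k, eLpNorm (H k) 1 (volume.restrict D) ≤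
      N k * eLpNorm a₁ p' (volume.restrict D) +
        (C * N k) * eLpNorm a₂ q' (volume.restrict D) := by
    intro k
    refine (eLpNorm_add_le ((hm1 k).mul ha₁.1) ((hm2 k).mul ha₂.1) le_rfl).trans
      (add_le_add ?_ ?_)
    · refine (eLpNorm_mul_le_of_holder hpp.inv_add_inv_eq_inv (hm1 k) ha₁.1).trans ?_
      rw [eLpNorm_norm]
      gcongr
      exact eLpNorm_sqrtQ_le_wNorm hp0 (fun x => φ k x - w x) _
    · refine (eLpNorm_mul_le_of_holder hqq.inv_add_inv_eq_inv (hm2 k) ha₂.1).trans ?_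
      rw [eLpNorm_norm]
      gcongr
      exact hS _ _ (hw.lipZero_sub hp hQ hΩ hDm hD (hφ k).1 (hφ k).2)
  have hHlim : Tendsto (fun k => eLpNorm (H k) 1 (volume.restrict D)) atTop (𝓝 0) := by
    have h1 : Tendsto (fun k => N k * eLpNorm a₁ p' (volume.restrict D) +
        (C * N k) * eLpNorm a₂ q' (volume.restrict D)) atTop (𝓝 0) := by
      have h2 := ENNReal.Tendsto.mul_const (b := eLpNorm a₁ p' (volume.restrict D)) hlim
        (Or.inr ha₁.2.ne)
      have h3 := ENNReal.Tendsto.mul_const (b := eLpNorm a₂ q' (volume.restrict D))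
        (ENNReal.Tendsto.const_mul (a := C) hlim (Or.inr hCt)) (Or.inr ha₂.2.ne)
      simpa using h2.add h3
    exact tendsto_of_tendsto_of_tendsto_of_le_of_le tendsto_const_nhds h1
      (fun _ => zero_le) hHle
  have hIJ : ∀ᵐ x ∂(volume.restrict D), ∀ k, ‖J k x - I x‖ ≤ H k x := by
    filter_upwards [hA, hB] with x hAx hBx k
    have h1 : J k x - I x = inner ℝ (gradient (φ k) x - g x) (A x (u x) (v x)) +
        (φ k x - w x) * B x (u x) (v x) := by
      simp only [hI, hJ, inner_sub_left]
      ring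
    rw [h1]
    refine (norm_add_le _ _).trans (add_le_add (hAx _) ?_)
    rw [norm_mul]
    exact mul_le_mul_of_nonneg_left hBx (norm_nonneg _)
  obtain ⟨ns, hns, hns'⟩ := (tendstoInMeasure_of_tendsto_eLpNorm (p := 1) (g := 0) one_ne_zero hHm
    aestronglyMeasurable_const (by simpa using hHlim)).exists_seq_tendsto_ae
  -- No measurability of A or B is assumed. It is inherited from the integrands J k, which are
  -- integrable by the notion of weak solution and converge to I a.e. along a subsequence.
  have hIm : AEStronglyMeasurable I (volume.restrict D) := by
    refine aestronglyMeasurable_of_tendsto_ae atTop (fun k => (hJi (ns k)).1) ?_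
    filter_upwards [hns', hIJ] with x hx hx'
    rw [tendsto_iff_norm_sub_tendsto_zero]
    exact squeeze_zero (fun _ => norm_nonneg _) (fun k => hx' (ns k)) hx
  have hL1 : ∀ k, ∫⁻ x in D, ‖J k x - I x‖ₑ ≤ eLpNorm (H k) 1 (volume.restrict D) := by
    intro k
    rw [eLpNorm_one_eq_lintegral_enorm]
    refine lintegral_mono_ae (hIJ.mono fun x hx => ?_)
    exact enorm_le_iff_norm_le.2 ((hx k).trans (Real.le_norm_self _))
  have hIi : Integrable I (volume.restrict D) := by
    obtain ⟨k, hk⟩ := ((tendsto_order.1 hHlim).2 1 one_pos).exists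
    have h1 : Integrable (fun x => J k x - I x) (volume.restrict D) :=
      ⟨(hJi k).1.sub hIm, (hL1 k).trans_lt (hk.trans ENNReal.one_lt_top)⟩
    have h2 := (hJi k).sub h1
    refine h2.congr (.of_forall fun x => ?_)
    simp
  refine ⟨hIi, ?_⟩
  have h1 := tendsto_integral_of_L1 I hIi.1 (.of_forall hJi)
    (tendsto_of_tendsto_of_tendsto_of_le_of_le tendsto_const_nhds hHlim (fun _ => zero_le) hL1)
  simp only [hJ0] at h1
  exact (tendsto_nhds_unique h1 tendsto_const_nhds)

end TestFunctions

/-! ### Local integrability -/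

section LocalIntegrability

variable {p : ℝ} {Q : E n → Matrix (Fin n) (Fin n) ℝ} {Ω : Set (E n)} {ρ : E n → E n → ℝ}
  {r₁ : E n → ℝ}

lemma qball_subset (y : E n) (r : ℝ) : qball Ω ρ y r ⊆ Ω := fun _ hx => hx.1

lemma qball_mono (y : E n) {r r' : ℝ} (h : r ≤ r') : qball Ω ρ y r ⊆ qball Ω ρ y r' :=
  fun _ hx => ⟨hx.1, hx.2.trans_le h⟩

lemma MemW.memLp_sqrtQ (hp : 1 ≤ p) (hQ : IsWeight Ω p Q) (hΩ : IsOpen Ω)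
    {u : E n → ℝ} {v : E n → E n} (hu : MemW p Q Ω u v) :
    MemLp (fun x => ‖sqrtQ Q x (v x)‖) (ENNReal.ofReal p) (volume.restrict Ω) := by
  obtain ⟨hum, hvm, φ, hφ, hlim⟩ := hu
  have hp0 : 0 < p := by linarith
  have hq : 1 ≤ ENNReal.ofReal p := by simpa using hp
  have hΩm := hΩ.measurableSet.nullMeasurableSet (μ := (volume : Measure (E n)))
  obtain ⟨k, hk⟩ := ((tendsto_order.1 hlim).2 1 one_pos).exists
  replace hk := hk.trans ENNReal.one_lt_top
  refine ⟨hQ.aestronglyMeasurable_norm_sqrtQ hΩm le_rfl hvm, ?_⟩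
  have h : eLpNorm (fun x => ‖sqrtQ Q x (v x)‖) (ENNReal.ofReal p) (volume.restrict Ω) ≤
      eLpNorm (fun x => ‖sqrtQ Q x (gradient (φ k) x)‖) (ENNReal.ofReal p)
        (volume.restrict Ω) +
      eLpNorm (fun x => ‖sqrtQ Q x (gradient (φ k) x - v x)‖) (ENNReal.ofReal p)
        (volume.restrict Ω) := by
    refine eLpNorm_le_add_of_ae_le hq (hQ.aestronglyMeasurable_norm_sqrtQ hΩm le_rfl
      (measurable_gradient (φ k)).aestronglyMeasurable) (hQ.aestronglyMeasurable_norm_sqrtQ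
        hΩm le_rfl ((measurable_gradient (φ k)).aestronglyMeasurable.sub hvm))
      (.of_forall fun x => ?_)
    have := norm_sub_le (sqrtQ Q x (gradient (φ k) x)) (sqrtQ Q x (gradient (φ k) x - v x))
    rw [← sqrtQ_sub, sub_sub_cancel] at this
    rwa [norm_norm]
  refine h.trans_lt ?_
  rw [eLpNorm_norm, eLpNorm_norm]
  exact ENNReal.add_lt_top.2 ⟨(eLpNorm_sqrtQ_le_wNorm hp0 _ _).trans_lt (hφ k).2,
      (eLpNorm_sqrtQ_le_wNorm hp0 (fun x => φ k x - u x) _).trans_lt hk⟩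

/-- The Sobolev inequality needs zero boundary values, so it is applied to η₁u on a larger ball on
which η₁ is a cutoff equal to 1 on the given one. The larger radius r/τ must stay below r₁(y), which
accounts for the restriction r < τ r₁(y). -/
theorem MemW.memLp_qball (hp : 1 < p) {σ : ℝ} (hΩ : IsOpen Ω) (hQ : IsWeight Ω p Q)
    (hρ : IsQuasimetric Ω ρ) (hr₁ : IsRadiusFunction Ω ρ r₁)
    (hS : SobolevEstimate Ω ρ r₁ p σ Q) {τ : ℝ} (hτ : 0 < τ) {sStar t t' : ℝ≥0∞}
    (htt : ENNReal.HolderConjugate t t') (hcut : CutoffCondition Ω ρ r₁ p Q τ sStar t)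
    (hgain : LocalIntegrabilityGain Ω ρ r₁ p Q t') {u : E n → ℝ} {v : E n → E n}
    (hu : MemW p Q Ω u v) {y : E n} (hy : y ∈ Ω) {r : ℝ} (hr : 0 < r) (hrτ : r < τ * r₁ y) :
    MemLp u (ENNReal.ofReal (p * σ)) (volume.restrict (qball Ω ρ y r)) := by
  set R := r / τ with hR
  have hR0 : 0 < R := by positivity
  have hRr : τ * R = r := by rw [hR]; field_simp
  have hRr₁ : R < r₁ y := by rw [hR, div_lt_iff₀ hτ]; linarith
  obtain ⟨N, Cs, -, -, hcut⟩ := hcut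
  obtain ⟨η, hη, hηt⟩ := hcut y hy R hR0 hRr₁
  have hsub : qball Ω ρ y r ⊆ {x ∈ qball Ω ρ y R | η 1 x = 1} := by
    have := hη.eq_one 1 le_rfl
    rwa [hRr] at this
  set D := qball Ω ρ y R with hDdef
  have hsub' : qball Ω ρ y r ⊆ D := fun x hx => (hsub hx).1
  have hDm : NullMeasurableSet D volume := hρ.measurable_ball y hy R hR0
  have hDΩ : D ⊆ Ω := qball_subset y R
  have hDfin : volume D < ∞ := hr₁.volume_lt_top y hy R hR0 hRr₁
  have hum : AEStronglyMeasurable u (volume.restrict (qball Ω ρ y r)) :=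
    hu.1.mono_measure (Measure.restrict_mono (qball_subset y r) le_rfl)
  refine ⟨hum, ?_⟩
  by_cases h0 : volume D = 0
  · rw [Measure.restrict_eq_zero.2 (measure_mono_null hsub' h0)]
    simp
  obtain ⟨C, hCt, hC⟩ := hS.exists_eLpNorm_le hp.le hy hR0 hRr₁ h0 hDfin.ne
  obtain ⟨c, -, hc⟩ := hgain y hy R hR0 hRr₁
  have hw := memWZero_mul_comp hp hΩ hQ hDm hDΩ hDfin (hη.lipZero 1 le_rfl)
    (fun x => abs_le.2 ⟨by linarith [(hη.mem_Icc 1 le_rfl x).1], (hη.mem_Icc 1 le_rfl x).2⟩)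
    htt (hηt 1 le_rfl) hc hu (f := id) (f' := fun _ => 1) (fun z => hasDerivAt_id z)
    continuous_const (M := 1) (by simp)
  have h1 := (hC _ _ hw).trans_lt
    (ENNReal.mul_lt_top hCt.lt_top (hw.wNorm_lt_top hp.le hQ hΩ hDm hDΩ))
  refine lt_of_le_of_lt ?_ ((eLpNorm_mono_measure _
    (Measure.restrict_mono hsub' le_rfl)).trans_lt h1)
  refine eLpNorm_mono_ae ?_
  filter_upwards [ae_restrict_mem₀ (hρ.measurable_ball y hy r hr)] with x hx
  simp [(hsub hx).2]

end LocalIntegrability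

/-! ### Truncated powers -/

section TruncatedPowers

/-- The smooth majorant `√(z² + K²)` of `|z|`. -/
def ubar (K z : ℝ) : ℝ := √(z ^ 2 + K ^ 2)

/-- The smooth truncation `ū l / (ū + l)` of `ū = √(z² + K²)` at height `l`. -/
def trunc (K l z : ℝ) : ℝ := ubar K z * l / (ubar K z + l)

/-- The truncated power `ū T^{q-1}`. -/
def truncPow (K l q z : ℝ) : ℝ := ubar K z * trunc K l z ^ (q - 1)

/-- The derivative of `truncPow`. -/
def truncPowDeriv (K l q z : ℝ) : ℝ :=
  z / ubar K z * (trunc K l z ^ (q - 1) * (1 + (q - 1) * (trunc K l z / ubar K z)))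

/-- The odd function `z T^{p(q-1)}` of the test function. -/
def truncTest (K l p q z : ℝ) : ℝ := z * trunc K l z ^ (p * (q - 1))

/-- The derivative of `truncTest`. -/
def truncTestDeriv (K l p q z : ℝ) : ℝ :=
  trunc K l z ^ (p * (q - 1)) *
    (1 + p * (q - 1) * (trunc K l z / ubar K z * (z / ubar K z) ^ 2))

variable {K l p q : ℝ}

lemma ubar_pos (hK : 0 < K) (z : ℝ) : 0 < ubar K z := Real.sqrt_pos.2 (by positivity)

lemma abs_le_ubar (z : ℝ) : |z| ≤ ubar K z := Real.abs_le_sqrt (by nlinarith [sq_nonneg K])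

lemma le_ubar (z : ℝ) : K ≤ ubar K z := Real.le_sqrt_of_sq_le (by nlinarith [sq_nonneg z])

lemma ubar_le (hK : 0 < K) (z : ℝ) : ubar K z ≤ |z| + K := by
  refine Real.sqrt_le_iff.2 ⟨by positivity, ?_⟩
  nlinarith [sq_abs z, mul_nonneg (abs_nonneg z) hK.le]

lemma trunc_pos (hK : 0 < K) (hl : 0 < l) (z : ℝ) : 0 < trunc K l z := by
  have := ubar_pos hK z
  unfold trunc
  positivity

lemma trunc_le_ubar (hK : 0 < K) (hl : 0 < l) (z : ℝ) : trunc K l z ≤ ubar K z := by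
  have := ubar_pos hK z
  unfold trunc
  rw [div_le_iff₀ (by positivity)]
  nlinarith

lemma trunc_le (hK : 0 < K) (hl : 0 < l) (z : ℝ) : trunc K l z ≤ l := by
  have := ubar_pos hK z
  unfold trunc
  rw [div_le_iff₀ (by positivity)]
  nlinarith

lemma hasDerivAt_ubar (hK : 0 < K) (z : ℝ) : HasDerivAt (ubar K) (z / ubar K z) z := by
  have h := ((hasDerivAt_pow 2 z).add_const (K ^ 2)).sqrt (by positivity)
  refine h.congr_deriv ?_
  have := ubar_pos hK z
  unfold ubar at this ⊢
  field_simp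
  norm_num

/-- As a function of ū, the truncation has derivative (l/(ū+l))² = (T/ū)², which lies in (0,1). -/
lemma hasDerivAt_trunc (hK : 0 < K) (hl : 0 < l) (z : ℝ) :
    HasDerivAt (trunc K l) ((trunc K l z / ubar K z) ^ 2 * (z / ubar K z)) z := by
  have hu := ubar_pos hK z
  have h := ((hasDerivAt_ubar hK z).mul_const l).div ((hasDerivAt_ubar hK z).add_const l)
    (by positivity)
  refine h.congr_deriv ?_
  unfold trunc
  field_simp
  ring

lemma continuous_ubar : Continuous (ubar K) := by unfold ubar; fun_prop

lemma continuous_trunc (hK : 0 < K) (hl : 0 < l) : Continuous (trunc K l) :=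
  continuous_iff_continuousAt.2 fun z => (hasDerivAt_trunc hK hl z).continuousAt

lemma hasDerivAt_truncPow (hK : 0 < K) (hl : 0 < l) (q z : ℝ) :
    HasDerivAt (truncPow K l q) (truncPowDeriv K l q z) z := by
  have hu := ubar_pos hK z
  have hT := trunc_pos hK hl z
  have h := (hasDerivAt_ubar hK z).mul
    ((hasDerivAt_trunc hK hl z).rpow_const (p := q - 1) (Or.inl hT.ne'))
  refine h.congr_deriv ?_
  unfold truncPowDeriv
  rw [Real.rpow_sub_one hT.ne' (q - 1)]
  field_simp

lemma hasDerivAt_truncTest (hK : 0 < K) (hl : 0 < l) (p q z : ℝ) :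
    HasDerivAt (truncTest K l p q) (truncTestDeriv K l p q z) z := by
  have hu := ubar_pos hK z
  have hT := trunc_pos hK hl z
  have h := (hasDerivAt_id z).mul
    ((hasDerivAt_trunc hK hl z).rpow_const (p := p * (q - 1)) (Or.inl hT.ne'))
  refine h.congr_deriv ?_
  unfold truncTestDeriv
  rw [Real.rpow_sub_one hT.ne' (p * (q - 1))]
  simp only [id]
  field_simp

lemma continuous_trunc_rpow (hK : 0 < K) (hl : 0 < l) (s : ℝ) :
    Continuous fun z => trunc K l z ^ s :=
  (continuous_trunc hK hl).rpow_const fun z => Or.inl (trunc_pos hK hl z).ne'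

lemma continuous_truncPow (hK : 0 < K) (hl : 0 < l) (q : ℝ) : Continuous (truncPow K l q) :=
  continuous_ubar.mul (continuous_trunc_rpow hK hl _)

/-- `memWZero_mul_comp` requires a continuous derivative. This is the reason for truncating by
ūl/(ū+l) and not by min(ū,l). -/
lemma continuous_truncPowDeriv (hK : 0 < K) (hl : 0 < l) (q : ℝ) :
    Continuous (truncPowDeriv K l q) := by
  have h0 : ∀ z, ubar K z ≠ 0 := fun z => (ubar_pos hK z).ne'
  have h1 := continuous_trunc_rpow hK hl (q - 1)
  have h2 := continuous_trunc hK hl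
  have h3 := continuous_ubar (K := K)
  unfold truncPowDeriv
  fun_prop (disch := assumption)

lemma continuous_truncTestDeriv (hK : 0 < K) (hl : 0 < l) (p q : ℝ) :
    Continuous (truncTestDeriv K l p q) := by
  have h0 : ∀ z, ubar K z ≠ 0 := fun z => (ubar_pos hK z).ne'
  have h1 := continuous_trunc_rpow hK hl (p * (q - 1))
  have h2 := continuous_trunc hK hl
  have h3 := continuous_ubar (K := K)
  unfold truncTestDeriv
  fun_prop (disch := assumption)

lemma abs_div_ubar_le_one (hK : 0 < K) (z : ℝ) : |z / ubar K z| ≤ 1 := by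
  rw [abs_div, abs_of_pos (ubar_pos hK z), div_le_one (ubar_pos hK z)]
  exact abs_le_ubar z

/-- Together with T ≤ l this bounds the derivative for fixed l, so that truncated powers of u are
admissible. The growth in q is only linear. -/
lemma abs_truncPowDeriv_le (hK : 0 < K) (hl : 0 < l) (hq : 1 ≤ q) (z : ℝ) :
    |truncPowDeriv K l q z| ≤ q * trunc K l z ^ (q - 1) := by
  have hu := ubar_pos hK z
  have hT := trunc_pos hK hl z
  have h1 : trunc K l z / ubar K z ≤ 1 := (div_le_one hu).2 (trunc_le_ubar hK hl z)
  have h2 : 0 < trunc K l z / ubar K z := by positivity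
  have h3 := Real.rpow_pos_of_pos hT (q - 1)
  have h4 : 0 ≤ 1 + (q - 1) * (trunc K l z / ubar K z) := by nlinarith
  unfold truncPowDeriv
  rw [abs_mul, abs_of_nonneg (mul_nonneg h3.le h4)]
  calc _ ≤ 1 * (trunc K l z ^ (q - 1) * (1 + (q - 1) * (trunc K l z / ubar K z))) :=
        mul_le_mul_of_nonneg_right (abs_div_ubar_le_one hK z) (mul_nonneg h3.le h4)
    _ ≤ 1 * (trunc K l z ^ (q - 1) * (1 + (q - 1) * 1)) := by gcongr
    _ = _ := by ring

lemma trunc_rpow_le (hK : 0 < K) (hl : 0 < l) {s : ℝ} (hs : 0 ≤ s) (z : ℝ) :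
    trunc K l z ^ s ≤ l ^ s :=
  Real.rpow_le_rpow (trunc_pos hK hl z).le (trunc_le hK hl z) hs

/-- Differentiating z T^{p(q-1)} produces T^{p(q-1)} times a factor between 1 and pq. The lower
bound preserves coercivity and does not depend on l. -/
lemma le_truncTestDeriv (hK : 0 < K) (hl : 0 < l) (hp : 0 ≤ p) (hq : 1 ≤ q) (z : ℝ) :
    (trunc K l z ^ (q - 1)) ^ p ≤ truncTestDeriv K l p q z := by
  have hu := ubar_pos hK z
  have hT := trunc_pos hK hl z
  have h3 := Real.rpow_pos_of_pos hT (p * (q - 1))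
  rw [← Real.rpow_mul hT.le, mul_comm (q - 1)]
  have h4 : 0 ≤ p * (q - 1) * (trunc K l z / ubar K z * (z / ubar K z) ^ 2) :=
    mul_nonneg (mul_nonneg hp (by linarith)) (by positivity)
  unfold truncTestDeriv
  nlinarith

lemma truncTestDeriv_le (hK : 0 < K) (hl : 0 < l) (hp : 1 ≤ p) (hq : 1 ≤ q) (z : ℝ) :
    truncTestDeriv K l p q z ≤ p * q * (trunc K l z ^ (q - 1)) ^ p := by
  have hu := ubar_pos hK z
  have hT := trunc_pos hK hl z
  have h3 := Real.rpow_pos_of_pos hT (p * (q - 1))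
  rw [← Real.rpow_mul hT.le, mul_comm (q - 1)]
  have h1 : trunc K l z / ubar K z ≤ 1 := (div_le_one hu).2 (trunc_le_ubar hK hl z)
  have h2 : (z / ubar K z) ^ 2 ≤ 1 := (sq_le_one_iff_abs_le_one _).2 (abs_div_ubar_le_one hK z)
  have h5 : trunc K l z / ubar K z * (z / ubar K z) ^ 2 ≤ 1 := mul_le_one₀ h1 (sq_nonneg _) h2
  have h4 : p * (q - 1) * (trunc K l z / ubar K z * (z / ubar K z) ^ 2) ≤ p * (q - 1) * 1 :=
    mul_le_mul_of_nonneg_left h5 (mul_nonneg (by linarith) (by linarith))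
  unfold truncTestDeriv
  rw [mul_comm (p * q)]
  refine mul_le_mul_of_nonneg_left ?_ h3.le
  linarith

lemma abs_truncTest (hK : 0 < K) (hl : 0 < l) (p q z : ℝ) :
    |truncTest K l p q z| = |z| * (trunc K l z ^ (q - 1)) ^ p := by
  have hT := trunc_pos hK hl z
  rw [truncTest, abs_mul, ← Real.rpow_mul hT.le, mul_comm (q - 1),
    abs_of_pos (Real.rpow_pos_of_pos hT _)]

lemma truncPow_pos (hK : 0 < K) (hl : 0 < l) (q z : ℝ) : 0 < truncPow K l q z :=
  mul_pos (ubar_pos hK z) (Real.rpow_pos_of_pos (trunc_pos hK hl z) _)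

lemma truncPow_le (hK : 0 < K) (hl : 0 < l) (hq : 1 ≤ q) (z : ℝ) :
    truncPow K l q z ≤ ubar K z ^ q := by
  have hu := ubar_pos hK z
  have h : ubar K z ^ q = ubar K z * ubar K z ^ (q - 1) := by
    rw [Real.rpow_sub_one hu.ne']
    field_simp
  rw [h, truncPow]
  exact mul_le_mul_of_nonneg_left (Real.rpow_le_rpow (trunc_pos hK hl z).le
    (trunc_le_ubar hK hl z) (by linarith)) hu.le

lemma tendsto_trunc (hK : 0 < K) (z : ℝ) :
    Tendsto (fun k : ℕ => trunc K (k + 1) z) atTop (𝓝 (ubar K z)) := by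
  have hu := ubar_pos hK z
  have h1 : Tendsto (fun k : ℕ => ubar K z / (ubar K z / ((k : ℝ) + 1) + 1)) atTop
      (𝓝 (ubar K z / (0 + 1))) := by
    refine tendsto_const_nhds.div (Tendsto.add_const 1 ?_) (by norm_num)
    have := (tendsto_one_div_add_atTop_nhds_zero_nat (𝕜 := ℝ)).const_mul (ubar K z)
    simpa [mul_one_div, div_eq_mul_inv] using this
  rw [zero_add, div_one] at h1
  refine h1.congr fun k => ?_
  unfold trunc
  field_simp

lemma tendsto_truncPow (hK : 0 < K) (q z : ℝ) :
    Tendsto (fun k : ℕ => truncPow K (k + 1) q z) atTop (𝓝 (ubar K z ^ q)) := by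
  have hu := ubar_pos hK z
  have h : ubar K z ^ q = ubar K z * ubar K z ^ (q - 1) := by
    rw [Real.rpow_sub_one hu.ne']
    field_simp
  rw [h]
  exact ((tendsto_trunc hK z).rpow_const (Or.inl hu.ne')).const_mul _

end TruncatedPowers

/-! ### The pointwise energy inequality -/

section Pointwise

/-- Weighted Young inequality by comparison of B^{p-θ} with ε m^{p-θ}: if it is the smaller, the
first term on the right dominates; otherwise m is bounded by a multiple of B and the second does. -/
lemma rpow_mul_rpow_sub_le {p θ ε m B : ℝ} (hθ : 0 < θ) (hθp : θ < p) (hε : 0 < ε) (hm : 0 ≤ m)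
    (hB : 0 ≤ B) :
    m ^ θ * B ^ (p - θ) ≤ ε * m ^ p + ε ^ (-(θ / (p - θ))) * B ^ p := by
  have hs : 0 < p - θ := by linarith
  have hmp : m ^ p = m ^ θ * m ^ (p - θ) := by
    rw [← Real.rpow_add_of_nonneg hm hθ.le hs.le]
    ring_nf
  have hBp : B ^ p = B ^ θ * B ^ (p - θ) := by
    rw [← Real.rpow_add_of_nonneg hB hθ.le hs.le]
    ring_nf
  have hm1 := Real.rpow_nonneg hm p
  have hB1 := Real.rpow_nonneg hB p
  by_cases h : B ^ (p - θ) ≤ ε * m ^ (p - θ)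
  · have h1 : m ^ θ * B ^ (p - θ) ≤ ε * m ^ p := by
      rw [hmp]
      calc _ ≤ m ^ θ * (ε * m ^ (p - θ)) := by gcongr
        _ = _ := by ring
    have h2 : 0 ≤ ε ^ (-(θ / (p - θ))) * B ^ p := by positivity
    linarith
  · push Not at h
    have h1 : m ^ θ ≤ ε ^ (-(θ / (p - θ))) * B ^ θ := by
      have h2 : m ^ (p - θ) ≤ ε⁻¹ * B ^ (p - θ) := by
        rw [← div_eq_inv_mul, le_div_iff₀ hε]
        linarith
      have h3 := Real.rpow_le_rpow (by positivity) h2 (div_nonneg hθ.le hs.le)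
      rw [Real.mul_rpow (by positivity) (by positivity), ← Real.rpow_mul hm, ← Real.rpow_mul hB,
        mul_div_cancel₀ _ hs.ne', Real.inv_rpow hε.le, ← Real.rpow_neg hε.le] at h3
      exact h3
    have h2 : m ^ θ * B ^ (p - θ) ≤ ε ^ (-(θ / (p - θ))) * B ^ p := by
      rw [hBp]
      calc _ ≤ (ε ^ (-(θ / (p - θ))) * B ^ θ) * B ^ (p - θ) := by gcongr
        _ = _ := by ring
    have h3 : 0 ≤ ε * m ^ p := by positivity
    linarith

lemma rpow_sub_one_mul_le {p x y : ℝ} (hp : 1 < p) (hx : 0 ≤ x) (hy : 0 ≤ y) :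
    x ^ (p - 1) * y ≤ x ^ p + y ^ p := by
  have h := rpow_mul_rpow_sub_le (p := p) (θ := p - 1) (by linarith) (by linarith) one_pos hx hy
  simpa using h

/-- The constant of the energy inequality. -/
def energyConst (p ψ a : ℝ) : ℝ :=
  p * a * (4 * (p * a) * a) ^ (p - 1) + (4 * a) ^ ((ψ - 1) / (p + 1 - ψ)) + 2 * p + 1

lemma energyConst_pos {p ψ a : ℝ} (hp : 1 < p) (ha : 1 < a) : 0 < energyConst p ψ a := by
  unfold energyConst
  positivity

/-- Here X = |√Q∇u|, G = |√Q∇η|, U = ū, h = T^{q-1}; F and F' are the odd test function of u and its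
derivative, and iA, iG, Bv stand for ∇u·A, ∇η·A, B. The first bracket on the right is the integrand
of the weak formulation, which integrates to zero. Coercivity supplies a⁻¹(ηhX)^p; the ∇η term and
the c-term each give back a quarter of it by Young's inequality, and half remains. -/
theorem energy_pointwise {p γ ψ δ a : ℝ} (hp : 1 < p) (hγ : p < γ) (hψ : p < ψ) (hψ' : ψ < p + 1)
    (hδ : p < δ) (ha : 1 < a) {q r η X G U z h F F' iA iG Bv b c d e f g hc : ℝ} (hq : 1 ≤ q)
    (hr : 0 < r) (hη : 0 ≤ η) (hX : 0 ≤ X) (hG : 0 ≤ G) (hU : 0 < U) (hz : |z| ≤ U)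
    (hh : 0 < h) (hF : |F| ≤ |z| * h ^ p) (hF1 : h ^ p ≤ F') (hF2 : F' ≤ p * q * h ^ p)
    (hb : 0 ≤ b) (hc0 : 0 ≤ c) (hd : 0 ≤ d) (hhc : 0 ≤ hc)
    (hg0 : 0 ≤ g) (he : e ≤ (U / r) ^ (p - 1)) (hf : f ≤ U ^ (p - 1) * r ^ (-p))
    (hg : g ≤ (U / r) ^ p)
    (hiA : a⁻¹ * X ^ p - hc * |z| ^ γ - g ≤ iA)
    (hiG : |iG| ≤ G * (a * X ^ (p - 1) + b * |z| ^ (γ - 1) + e))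
    (hBv : |Bv| ≤ c * X ^ (ψ - 1) + d * |z| ^ (δ - 1) + f) :
    (2 * a)⁻¹ * (η * h * X) ^ p ≤
      (F * (p * η ^ (p - 1)) * iG + η ^ p * F' * iA + η ^ p * F * Bv) +
      energyConst p ψ a * q * ((G * (U * h)) ^ p + r ^ (-p) * (η * (U * h)) ^ p +
        b * |z| ^ (γ - p) * (η * (U * h)) ^ (p - 1) * (G * (U * h)) +
        (hc * |z| ^ (γ - p) + d * |z| ^ (δ - p) +
          c ^ (p / (p + 1 - ψ)) * U ^ (p * (ψ - p) / (p + 1 - ψ))) * (η * (U * h)) ^ p) := by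
  have hp0 : 0 < p := by linarith
  have hz0 := abs_nonneg z
  set m := η * h * X with hm
  set E₁ := η * (U * h) with hE₁
  set E₂ := G * (U * h) with hE₂
  have hm0 : 0 ≤ m := by positivity
  have hE₁0 : 0 ≤ E₁ := by positivity
  have hE₂0 : 0 ≤ E₂ := by positivity
  have hhp : 0 < h ^ p := by positivity
  have hηp : 0 ≤ η ^ p := by positivity
  have hE₁p : E₁ ^ p = η ^ p * U ^ p * h ^ p := by
    rw [hE₁, Real.mul_rpow hη (by positivity), Real.mul_rpow hU.le hh.le]; ring
  have hE₁p1 : E₁ ^ (p - 1) = η ^ (p - 1) * U ^ (p - 1) * h ^ (p - 1) := by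
    rw [hE₁, Real.mul_rpow hη (by positivity), Real.mul_rpow hU.le hh.le]; ring
  have hmp : m ^ p = η ^ p * h ^ p * X ^ p := by
    rw [hm, Real.mul_rpow (by positivity) hX, Real.mul_rpow hη hh.le]
  have hUp : U ^ p = U ^ (p - 1) * U := by
    rw [Real.rpow_sub_one hU.ne']; field_simp
  have hhp1 : h ^ p = h ^ (p - 1) * h := by
    rw [Real.rpow_sub_one hh.ne']; field_simp
  -- Of the s-1 powers of |z|, the excess s-p is kept as a coefficient and the other p-1 are raised
  -- to U, so that every term is homogeneous of degree p in the powers of U h.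
  have hzs : ∀ s, p < s → |z| ^ (s - 1) ≤ |z| ^ (s - p) * U ^ (p - 1) := fun s hs => by
    have : |z| ^ (s - 1) = |z| ^ (s - p) * |z| ^ (p - 1) := by
      rw [← Real.rpow_add_of_nonneg hz0 (by linarith) (by linarith)]
      ring_nf
    rw [this]
    gcongr
  have hzγ : |z| ^ γ ≤ |z| ^ (γ - p) * U ^ p := by
    have : |z| ^ γ = |z| ^ (γ - p) * |z| ^ p := by
      rw [← Real.rpow_add_of_nonneg hz0 (by linarith) (by linarith)]
      ring_nf
    rw [this]
    gcongr
  have hrp : (U / r) ^ p = U ^ p * r ^ (-p) := by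
    rw [Real.div_rpow hU.le hr.le, Real.rpow_neg hr.le, div_eq_mul_inv]
  set S₁ := |z| ^ (γ - p) with hS₁
  set S₂ := |z| ^ (δ - p) with hS₂
  set S₃ := c ^ (p / (p + 1 - ψ)) * U ^ (p * (ψ - p) / (p + 1 - ψ)) with hS₃
  have hS₁0 : 0 ≤ S₁ := by positivity
  have hS₂0 : 0 ≤ S₂ := by positivity
  have hS₃0 : 0 ≤ S₃ := by positivity
  set ρ := r ^ (-p) with hρ
  have hρ0 : 0 < ρ := by positivity
  -- the coercive term
  have h1 : a⁻¹ * m ^ p - p * q * (hc * S₁ + ρ) * E₁ ^ p ≤ η ^ p * F' * iA := by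
    have hF'0 : 0 ≤ F' := hhp.le.trans hF1
    have k1 : η ^ p * F' * (a⁻¹ * X ^ p - hc * |z| ^ γ - g) ≤ η ^ p * F' * iA :=
      mul_le_mul_of_nonneg_left hiA (by positivity)
    have k2 : a⁻¹ * m ^ p ≤ η ^ p * F' * (a⁻¹ * X ^ p) := by
      rw [hmp]
      calc _ = η ^ p * h ^ p * (a⁻¹ * X ^ p) := by ring
        _ ≤ _ := by gcongr
    have k3 : η ^ p * F' * (hc * |z| ^ γ + g) ≤ p * q * (hc * S₁ + ρ) * E₁ ^ p := by
      calc _ ≤ η ^ p * (p * q * h ^ p) * (hc * (S₁ * U ^ p) + U ^ p * ρ) := by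
            rw [hrp] at hg
            gcongr
        _ = _ := by rw [hE₁p]; ring
    linarith
  -- the term with the gradient of the cutoff function
  have h2 : |F * (p * η ^ (p - 1)) * iG| ≤ p * a * (m ^ (p - 1) * E₂) +
      p * (b * S₁ * E₁ ^ (p - 1) * E₂) + p * (ρ * E₁ ^ p + E₂ ^ p) := by
    have k0 : (E₁ / r) ^ (p - 1) * E₂ ≤ ρ * E₁ ^ p + E₂ ^ p := by
      have := rpow_sub_one_mul_le hp (div_nonneg hE₁0 hr.le) hE₂0
      rwa [Real.div_rpow hE₁0 hr.le p, div_eq_mul_inv (E₁ ^ p), ← Real.rpow_neg hr.le, ← hρ,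
        mul_comm (E₁ ^ p)] at this
    have k1 : |F| ≤ U * h ^ p := hF.trans (by gcongr)
    have k2 : m ^ (p - 1) * E₂ = η ^ (p - 1) * (U * h ^ p) * (G * X ^ (p - 1)) := by
      rw [hm, hE₂, Real.mul_rpow (by positivity) hX, Real.mul_rpow hη hh.le, hhp1]; ring
    have k3 : b * S₁ * E₁ ^ (p - 1) * E₂ =
        η ^ (p - 1) * (U * h ^ p) * (G * (b * (S₁ * U ^ (p - 1)))) := by
      rw [hE₁p1, hE₂, hhp1]; ring
    have k4 : (E₁ / r) ^ (p - 1) * E₂ =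
        η ^ (p - 1) * (U * h ^ p) * (G * (U / r) ^ (p - 1)) := by
      rw [Real.div_rpow hE₁0 hr.le, Real.div_rpow hU.le hr.le, hE₁p1, hE₂, hhp1]; ring
    rw [abs_mul, abs_mul, abs_of_nonneg (by positivity : 0 ≤ p * η ^ (p - 1))]
    calc _ ≤ U * h ^ p * (p * η ^ (p - 1)) *
          (G * (a * X ^ (p - 1) + b * (S₁ * U ^ (p - 1)) + (U / r) ^ (p - 1))) := by
          refine mul_le_mul (by gcongr) (hiG.trans ?_) (abs_nonneg _) (by positivity)
          gcongr
          exact hzs γ hγ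
      _ = p * a * (m ^ (p - 1) * E₂) + p * (b * S₁ * E₁ ^ (p - 1) * E₂) +
          p * ((E₁ / r) ^ (p - 1) * E₂) := by rw [k2, k3, k4]; ring
      _ ≤ _ := by gcongr
  -- the lower order term
  have h3 : |η ^ p * F * Bv| ≤ m ^ (ψ - 1) * ((c * U ^ (ψ - p)) ^ (1 / (p + 1 - ψ)) * E₁) ^
      (p - (ψ - 1)) + d * S₂ * E₁ ^ p + ρ * E₁ ^ p := by
    have k1 : |F| ≤ U * h ^ p := hF.trans (by gcongr)
    have hψ1 : p - (ψ - 1) = p + 1 - ψ := by ring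
    -- The c-term is brought to the form needed for Young's inequality with exponents ψ-1 and p+1-ψ.
    -- The powers of U add up to (ψ-p) + (p+1-ψ) = 1.
    have k2 : m ^ (ψ - 1) * ((c * U ^ (ψ - p)) ^ (1 / (p + 1 - ψ)) * E₁) ^ (p - (ψ - 1)) =
        η ^ p * (U * h ^ p) * (c * X ^ (ψ - 1)) := by
      rw [hψ1, Real.mul_rpow (by positivity) hE₁0, ← Real.rpow_mul (by positivity),
        one_div_mul_cancel (by linarith), Real.rpow_one, hm, hE₁,
        Real.mul_rpow (by positivity) hX, Real.mul_rpow hη hh.le,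
        Real.mul_rpow hη (by positivity), Real.mul_rpow hU.le hh.le]
      have e1 : η ^ p = η ^ (ψ - 1) * η ^ (p + 1 - ψ) := by
        rw [← Real.rpow_add_of_nonneg hη (by linarith) (by linarith)]
        ring_nf
      have e2 : h ^ p = h ^ (ψ - 1) * h ^ (p + 1 - ψ) := by
        rw [← Real.rpow_add hh]
        ring_nf
      have e3 : U = U ^ (ψ - p) * U ^ (p + 1 - ψ) := by
        rw [← Real.rpow_add hU]
        ring_nf
        simp
      rw [e1, e2]
      nth_rewrite 3 [e3]
      ring
    rw [k2, abs_mul, abs_mul, abs_of_nonneg hηp]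
    calc _ ≤ η ^ p * (U * h ^ p) *
          (c * X ^ (ψ - 1) + d * (S₂ * U ^ (p - 1)) + U ^ (p - 1) * ρ) := by
          refine mul_le_mul (by gcongr) (hBv.trans ?_) (abs_nonneg _) (by positivity)
          gcongr
          exact hzs δ hδ
      _ = _ := by rw [hE₁p, hUp]; ring
  -- absorption
  have hy1 : p * a * (m ^ (p - 1) * E₂) ≤ (4 * a)⁻¹ * m ^ p +
      p * a * (4 * (p * a) * a) ^ (p - 1) * E₂ ^ p := by
    -- The product carries a factor pa, so this weight leaves exactly (4a)⁻¹ m^p.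
    have k := rpow_mul_rpow_sub_le (p := p) (θ := p - 1) (ε := (4 * (p * a) * a)⁻¹) (by linarith)
      (by linarith) (by positivity) hm0 hE₂0
    rw [sub_sub_cancel, Real.rpow_one, div_one, Real.rpow_neg (by positivity),
      Real.inv_rpow (by positivity), inv_inv] at k
    calc _ ≤ p * a * ((4 * (p * a) * a)⁻¹ * m ^ p + (4 * (p * a) * a) ^ (p - 1) * E₂ ^ p) := by
          gcongr
      _ = _ := by field_simp
  have hy2 : m ^ (ψ - 1) * ((c * U ^ (ψ - p)) ^ (1 / (p + 1 - ψ)) * E₁) ^ (p - (ψ - 1)) ≤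
      (4 * a)⁻¹ * m ^ p + (4 * a) ^ ((ψ - 1) / (p + 1 - ψ)) * (S₃ * E₁ ^ p) := by
    have k := rpow_mul_rpow_sub_le (p := p) (θ := ψ - 1) (ε := (4 * a)⁻¹) (by linarith)
      (by linarith) (by positivity) hm0
      (by positivity : 0 ≤ (c * U ^ (ψ - p)) ^ (1 / (p + 1 - ψ)) * E₁)
    rw [Real.rpow_neg (by positivity), Real.inv_rpow (by positivity), inv_inv] at k
    refine k.trans (le_of_eq ?_)
    have e1 : p - (ψ - 1) = p + 1 - ψ := by ring
    have e2 : ((c * U ^ (ψ - p)) ^ (1 / (p + 1 - ψ)) * E₁) ^ p = S₃ * E₁ ^ p := by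
      rw [Real.mul_rpow (by positivity) hE₁0, ← Real.rpow_mul (by positivity),
        Real.mul_rpow hc0 (by positivity), ← Real.rpow_mul hU.le, hS₃]
      ring_nf
    rw [e1, e2]
  have hE2p : 0 ≤ E₂ ^ p := by positivity
  have hE1p : 0 ≤ E₁ ^ p := by positivity
  have hbE : 0 ≤ b * S₁ * E₁ ^ (p - 1) * E₂ := by positivity
  set C₁ := p * a * (4 * (p * a) * a) ^ (p - 1) with hC₁
  set C₂ := (4 * a) ^ ((ψ - 1) / (p + 1 - ψ)) with hC₂
  have hC₁0 : 0 ≤ C₁ := by positivity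
  have hC₂0 : 0 ≤ C₂ := by positivity
  have hCdef : energyConst p ψ a = C₁ + C₂ + 2 * p + 1 := rfl
  rw [hCdef]
  have ha' : (2 * a)⁻¹ * m ^ p = a⁻¹ * m ^ p - (4 * a)⁻¹ * m ^ p - (4 * a)⁻¹ * m ^ p := by
    field_simp
    ring
  set W := C₁ + C₂ + 2 * p + 1 with hW
  have hW0 : 0 ≤ W := by positivity
  have hWq : W ≤ W * q := le_mul_of_one_le_right hW0 hq
  have hWq' : (2 * p + 1) * q ≤ W * q :=
    mul_le_mul_of_nonneg_right (by linarith) (by linarith)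
  have hpq : p ≤ p * q := le_mul_of_one_le_right hp0.le hq
  have w1 : (C₁ + p) * E₂ ^ p ≤ W * q * E₂ ^ p :=
    mul_le_mul_of_nonneg_right (by linarith) hE2p
  have w2 : (p + p * q + 1) * (ρ * E₁ ^ p) ≤ W * q * (ρ * E₁ ^ p) :=
    mul_le_mul_of_nonneg_right (by linarith) (mul_nonneg hρ0.le hE1p)
  have w3 : p * (b * S₁ * E₁ ^ (p - 1) * E₂) ≤ W * q * (b * S₁ * E₁ ^ (p - 1) * E₂) :=
    mul_le_mul_of_nonneg_right (by linarith) hbE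
  have w4 : p * q * (hc * S₁ * E₁ ^ p) ≤ W * q * (hc * S₁ * E₁ ^ p) :=
    mul_le_mul_of_nonneg_right (by linarith) (by positivity)
  have w5 : 1 * (d * S₂ * E₁ ^ p) ≤ W * q * (d * S₂ * E₁ ^ p) :=
    mul_le_mul_of_nonneg_right (by linarith) (by positivity)
  have w6 : C₂ * (S₃ * E₁ ^ p) ≤ W * q * (S₃ * E₁ ^ p) :=
    mul_le_mul_of_nonneg_right (by linarith) (by positivity)
  have l2 := neg_abs_le (F * (p * η ^ (p - 1)) * iG)
  have l3 := neg_abs_le (η ^ p * F * Bv)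
  have hexp : W * q * (E₂ ^ p + ρ * E₁ ^ p + b * S₁ * E₁ ^ (p - 1) * E₂ +
      (hc * S₁ + d * S₂ + S₃) * E₁ ^ p) = W * q * E₂ ^ p + W * q * (ρ * E₁ ^ p) +
      W * q * (b * S₁ * E₁ ^ (p - 1) * E₂) + W * q * (hc * S₁ * E₁ ^ p) +
      W * q * (d * S₂ * E₁ ^ p) + W * q * (S₃ * E₁ ^ p) := by ring
  rw [hexp]
  linarith

end Pointwise

/-! ### One step of the Moser iteration -/

section MoserStep

lemma lintegral_mul_mul_rpow_le {α : Type*} [MeasurableSpace α] {μ : Measure α}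
    {f g k : α → ℝ≥0∞} (hf : AEMeasurable f μ) (hg : AEMeasurable g μ) (hk : AEMeasurable k μ)
    {a b c : ℝ} (ha : 0 ≤ a) (hb : 0 ≤ b) (hc : 0 ≤ c) (h : a + b + c = 1) :
    ∫⁻ x, f x ^ a * g x ^ b * k x ^ c ∂μ ≤
      (∫⁻ x, f x ∂μ) ^ a * (∫⁻ x, g x ∂μ) ^ b * (∫⁻ x, k x ∂μ) ^ c := by
  have := ENNReal.lintegral_prod_norm_pow_le (μ := μ) (Finset.univ : Finset (Fin 3))
    (f := ![f, g, k]) (p := ![a, b, c])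
    (by intro i _; fin_cases i <;> simpa) (by simpa [Fin.sum_univ_three] using h)
    (by intro i _; fin_cases i <;> simpa)
  simpa [Fin.prod_univ_three] using this

/-- The scalar inequality behind the absorption argument. -/
lemma le_of_absorption {p lam CS q A c₀ β ν x y M : ℝ} (hp : 1 < p)
    (hlam1 : lam < 1) (hCS : 1 ≤ CS) (hq : 1 ≤ q) (hA : 1 ≤ A) (hc₀ : 1 ≤ c₀) (hβ : 0 ≤ β)
    (hν : 0 ≤ ν) (hx : 0 ≤ x) (hy : 0 ≤ y) (hM : 0 ≤ M)
    (h1 : x ≤ CS * ((A + 1) * y + q * M))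
    (h2 : M ^ p ≤ c₀ * A ^ p * (2 * y ^ p + β * x ^ (p - 1) * y +
      ν * y ^ (p * (1 - lam)) * x ^ (p * lam))) :
    x ≤ (6 * ((2 * CS * q * A) ^ p * c₀)) ^ (1 + 1 / (p * (1 - lam))) *
      (1 + β + ν ^ (1 / (p * (1 - lam)))) * y := by
  have hp0 : 0 < p := by linarith
  have hs : 0 < p * (1 - lam) := mul_pos hp0 (by linarith)
  set ω := 1 / (p * (1 - lam)) with hω
  have hω0 : 0 < ω := by positivity
  set Γ := (2 * CS * q * A) ^ p * c₀ with hΓ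
  have hbase : 1 ≤ CS * q * A := one_le_mul_of_one_le_of_one_le
    (one_le_mul_of_one_le_of_one_le hCS hq) hA
  have hbase2 : 2 * CS * q * A ≤ (2 * CS * q * A) ^ p := by
    calc 2 * CS * q * A = (2 * CS * q * A) ^ (1 : ℝ) := (Real.rpow_one _).symm
      _ ≤ _ := Real.rpow_le_rpow_of_exponent_le (by linarith) hp.le
  have hΓ2 : 2 * CS * q * A ≤ Γ := hbase2.trans (le_mul_of_one_le_right (by positivity) hc₀)
  have hΓ1 : 1 ≤ Γ := by linarith
  have h6 : 1 ≤ 6 * Γ := by linarith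
  set Z := 1 + β + ν ^ ω with hZ
  have hνω : 0 ≤ ν ^ ω := by positivity
  have hZ1 : 1 ≤ Z := by linarith
  have hG1 : 6 * Γ ≤ (6 * Γ) ^ (1 + ω) := by
    calc 6 * Γ = (6 * Γ) ^ (1 : ℝ) := (Real.rpow_one _).symm
      _ ≤ _ := Real.rpow_le_rpow_of_exponent_le h6 (by linarith)
  have hG2 : (6 * Γ) ^ ω ≤ (6 * Γ) ^ (1 + ω) :=
    Real.rpow_le_rpow_of_exponent_le h6 (by linarith)
  -- If the gradient part M of the Sobolev bound does not dominate, x is linear in y at once.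
  -- Otherwise x is at most a multiple of M and the energy bound turns into an inequality for x
  -- alone.
  by_cases hc : q * M ≤ (A + 1) * y
  · have hCA : CS * A ≤ CS * q * A := by nlinarith [mul_nonneg (sub_nonneg.2 hq) (by positivity : 0 ≤ CS * A)]
    have e1 : x ≤ 6 * Γ * y := by
      have : x ≤ CS * (2 * ((A + 1) * y)) := h1.trans (by gcongr; linarith)
      have h3 : CS * (A + 1) ≤ 2 * (CS * A) := by nlinarith
      have h4 : CS * (2 * ((A + 1) * y)) = 2 * (CS * (A + 1)) * y := by ring
      rw [h4] at this
      refine this.trans (mul_le_mul_of_nonneg_right ?_ hy)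
      linarith
    refine e1.trans (mul_le_mul_of_nonneg_right ?_ hy)
    exact hG1.trans (le_mul_of_one_le_right (by positivity) hZ1)
  push Not at hc
  have hxM : x ≤ 2 * CS * q * M := by
    have : CS * ((A + 1) * y + q * M) ≤ CS * (2 * (q * M)) := by gcongr; linarith
    linarith
  have hxp : x ^ p ≤ Γ * (2 * y ^ p + β * x ^ (p - 1) * y +
      ν * y ^ (p * (1 - lam)) * x ^ (p * lam)) := by
    calc x ^ p ≤ (2 * CS * q * M) ^ p := by gcongr
      _ = (2 * CS * q) ^ p * M ^ p := Real.mul_rpow (by positivity) hM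
      _ ≤ (2 * CS * q) ^ p * (c₀ * A ^ p * (2 * y ^ p + β * x ^ (p - 1) * y +
          ν * y ^ (p * (1 - lam)) * x ^ (p * lam))) := by gcongr
      _ = _ := by
          rw [hΓ, Real.mul_rpow (by positivity : 0 ≤ 2 * CS * q) (by linarith : 0 ≤ A)]; ring
  have hgoal : ∀ c, x ≤ c * y → c ≤ (6 * Γ) ^ (1 + ω) * Z →
      x ≤ (6 * Γ) ^ (1 + ω) * Z * y := fun c h h' =>
    h.trans (mul_le_mul_of_nonneg_right h' hy)
  rcases hx.eq_or_lt with hx0 | hx0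
  · rw [← hx0]; positivity
  -- One of the three terms is at least a third of the sum. Each alternative is then solved for x;
  -- the last two carry x to a power below p, and the third leaves the exponent 1/(p(1-lam)) on ν.
  have h3 : x ^ p ≤ 6 * Γ * y ^ p ∨ x ^ p ≤ 3 * Γ * (β * x ^ (p - 1) * y) ∨
      x ^ p ≤ 3 * Γ * (ν * y ^ (p * (1 - lam)) * x ^ (p * lam)) := by
    by_contra! h
    obtain ⟨ha, hb, hc'⟩ := h
    nlinarith
  rcases h3 with h3 | h3 | h3
  · have h4 : x ^ p ≤ (6 * Γ * y) ^ p := by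
      rw [Real.mul_rpow (by positivity) hy]
      refine h3.trans (mul_le_mul_of_nonneg_right ?_ (by positivity))
      calc 6 * Γ = (6 * Γ) ^ (1 : ℝ) := (Real.rpow_one _).symm
        _ ≤ _ := Real.rpow_le_rpow_of_exponent_le h6 hp.le
    refine hgoal (6 * Γ) ((Real.rpow_le_rpow_iff hx (by positivity) hp0).1 h4) ?_
    exact hG1.trans (le_mul_of_one_le_right (by positivity) hZ1)
  · refine hgoal (6 * Γ * β) ?_ ?_
    · have h4 : x ^ p = x ^ (p - 1) * x := by rw [Real.rpow_sub_one hx0.ne']; field_simp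
      have h5 : 0 < x ^ (p - 1) := by positivity
      rw [h4] at h3
      have h6' : x ≤ 3 * Γ * (β * y) := by
        refine le_of_mul_le_mul_left (h3.trans (le_of_eq ?_)) h5
        ring
      have : 0 ≤ Γ * β * y := by positivity
      linarith
    · refine mul_le_mul hG1 ?_ hβ (by positivity)
      linarith
  · refine hgoal ((6 * Γ) ^ ω * ν ^ ω) ?_ ?_
    · have h4 : x ^ p = x ^ (p * (1 - lam)) * x ^ (p * lam) := by
        rw [← Real.rpow_add hx0]; ring_nf
      have h5 : 0 < x ^ (p * lam) := by positivity
      rw [h4] at h3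
      have h6' : x ^ (p * (1 - lam)) ≤ 6 * Γ * ν * y ^ (p * (1 - lam)) := by
        have : x ^ (p * (1 - lam)) ≤ 3 * Γ * (ν * y ^ (p * (1 - lam))) := by
          refine le_of_mul_le_mul_right (h3.trans (le_of_eq ?_)) h5
          ring
        have h7 : 0 ≤ Γ * ν * y ^ (p * (1 - lam)) := by positivity
        linarith
      have h7 := Real.rpow_le_rpow (by positivity) h6' hω0.le
      rw [Real.mul_rpow (by positivity) (by positivity), ← Real.rpow_mul hx, ← Real.rpow_mul hy,
        hω, mul_one_div_cancel hs.ne', Real.rpow_one, Real.rpow_one, ← hω,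
        Real.mul_rpow (by positivity) hν] at h7
      exact h7
    · refine mul_le_mul hG2 ?_ hνω (by positivity)
      linarith

/-- Roles: e₁ = η ū T^{q-1}, e₂ = |√Q∇η| ū T^{q-1}, m = η T^{q-1}|√Q∇u|, S = |u|^{γ-p} and V the
potential. Hölder's inequality on the two coefficient terms leaves the powers p-1 and p·lam of the
L^{pσ} norm of e₁, both below p; that norm is finite by hypothesis, so `le_of_absorption` applies.
-/
theorem moser_step {α : Type*} [MeasurableSpace α] {μ : Measure α}
    {p σ κ lam s₂ r CS q A c₀ β ν b : ℝ} (hp : 1 < p) (hσ : 1 < σ) (hlam : 0 < lam)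
    (hlam1 : lam < 1) (hκ0 : 0 < κ) (hκ : κ⁻¹ = lam * (1 - σ⁻¹)) (hs0 : 0 < s₂)
    (hs₂ : s₂⁻¹ = (1 - p⁻¹) * (1 - σ⁻¹)) (hr : 0 < r) (hr1 : r ≤ 1) (hCS : 1 ≤ CS) (hq : 1 ≤ q)
    (hA : 1 ≤ A) (hc₀ : 1 ≤ c₀) (hβ : 0 ≤ β) (hν : 0 ≤ ν)
    {e₁ e₂ m S V : α → ℝ≥0∞} (he₁ : AEMeasurable e₁ μ) (he₂ : AEMeasurable e₂ μ)
    (hm : AEMeasurable m μ) (hSm : AEMeasurable S μ) (hV : AEMeasurable V μ) {Y : ℝ≥0∞}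
    (hen : ∫⁻ x, m x ^ p ∂μ ≤ ENNReal.ofReal c₀ * ∫⁻ x, (e₂ x ^ p +
      ENNReal.ofReal (r ^ (-p)) * e₁ x ^ p +
      ENNReal.ofReal b * (S x * e₁ x ^ (p - 1) * e₂ x) + V x * e₁ x ^ p) ∂μ)
    (hsob : (∫⁻ x, e₁ x ^ (p * σ) ∂μ) ^ (1 / (p * σ)) ≤ ENNReal.ofReal CS *
      (ENNReal.ofReal r * (∫⁻ x, (e₂ x + ENNReal.ofReal q * m x) ^ p ∂μ) ^ (1 / p) +
        (∫⁻ x, e₁ x ^ p ∂μ) ^ (1 / p)))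
    (hfin : (∫⁻ x, e₁ x ^ (p * σ) ∂μ) ^ (1 / (p * σ)) ≠ ∞)
    (h₂ : ENNReal.ofReal r * (∫⁻ x, e₂ x ^ p ∂μ) ^ (1 / p) ≤ ENNReal.ofReal A * Y)
    (h₁ : (∫⁻ x, e₁ x ^ p ∂μ) ^ (1 / p) ≤ Y)
    (hS : ENNReal.ofReal b * (∫⁻ x, S x ^ s₂ ∂μ) ^ (1 / s₂) ≤ ENNReal.ofReal β)
    (hVν : (∫⁻ x, V x ^ κ ∂μ) ^ (1 / κ) ≤ ENNReal.ofReal ν) :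
    (∫⁻ x, e₁ x ^ (p * σ) ∂μ) ^ (1 / (p * σ)) ≤
      ENNReal.ofReal ((6 * ((2 * CS * q * A) ^ p * c₀)) ^ (1 + 1 / (p * (1 - lam))) *
        (1 + β + ν ^ (1 / (p * (1 - lam))))) * Y := by
  have hp0 : 0 < p := by linarith
  have hσ0 : 0 < σ := by linarith
  have hpσ : 0 < p * σ := by positivity
  have hp1 : 0 < 1 - p⁻¹ := by have := inv_lt_one_of_one_lt₀ hp; linarith
  have hσ1 : 0 < 1 - σ⁻¹ := by have := inv_lt_one_of_one_lt₀ hσ; linarith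
  have hDpos : 0 < (6 * ((2 * CS * q * A) ^ p * c₀)) ^ (1 + 1 / (p * (1 - lam))) *
        (1 + β + ν ^ (1 / (p * (1 - lam)))) := by positivity
  by_cases hYt : Y = ∞
  · rw [hYt, ENNReal.mul_top (by simpa using hDpos)]
    exact le_top
  set X := (∫⁻ x, e₁ x ^ (p * σ) ∂μ) ^ (1 / (p * σ)) with hX
  set M := ENNReal.ofReal r * (∫⁻ x, m x ^ p ∂μ) ^ (1 / p) with hM
  -- the Hölder estimates
  have hXpow : ∀ s, (∫⁻ x, e₁ x ^ (p * σ) ∂μ) ^ (s / (p * σ)) = X ^ s := fun s => by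
    rw [hX, ← ENNReal.rpow_mul]; ring_nf
  -- The exponents match because (1-1/p)(1-1/σ) + (p-1)/(pσ) + 1/p = 1, which is what determines s₂
  -- = p'σ'.
  have hh3 : ∫⁻ x, S x * e₁ x ^ (p - 1) * e₂ x ∂μ ≤
      (∫⁻ x, S x ^ s₂ ∂μ) ^ (1 / s₂) * X ^ (p - 1) * (∫⁻ x, e₂ x ^ p ∂μ) ^ (1 / p) := by
    have h := lintegral_mul_mul_rpow_le (hSm.pow_const s₂) (he₁.pow_const (p * σ))
      (he₂.pow_const p) (a := 1 / s₂) (b := (p - 1) / (p * σ)) (c := 1 / p) (by positivity)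
      (div_nonneg (by linarith) hpσ.le) (by positivity) (by
        rw [one_div, hs₂]; field_simp; ring)
    rw [hXpow] at h
    refine le_of_eq_of_le (lintegral_congr fun x => ?_) h
    rw [← ENNReal.rpow_mul, ← ENNReal.rpow_mul, ← ENNReal.rpow_mul, mul_one_div_cancel hs0.ne',
      mul_one_div_cancel hp0.ne', mul_div_cancel₀ _ hpσ.ne', ENNReal.rpow_one, ENNReal.rpow_one]
  -- Interpolation: e₁^p is split as e₁^{p(1-lam)} e₁^{p·lam} between L^p and L^{pσ}, and lam(1-1/σ)
  -- + (1-lam) + lam/σ = 1.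
  have hh4 : ∫⁻ x, V x * e₁ x ^ p ∂μ ≤
      (∫⁻ x, V x ^ κ ∂μ) ^ (1 / κ) * Y ^ (p * (1 - lam)) * X ^ (p * lam) := by
    have h := lintegral_mul_mul_rpow_le (hV.pow_const κ) (he₁.pow_const p)
      (he₁.pow_const (p * σ)) (a := 1 / κ) (b := 1 - lam) (c := p * lam / (p * σ)) (by positivity)
      (by linarith) (by positivity) (by
        rw [one_div, hκ]; field_simp; ring)
    rw [hXpow] at h
    have h5 : (∫⁻ x, e₁ x ^ p ∂μ) ^ (1 - lam) ≤ Y ^ (p * (1 - lam)) := by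
      have := ENNReal.rpow_le_rpow h₁ (by nlinarith : 0 ≤ p * (1 - lam))
      rw [← ENNReal.rpow_mul] at this
      convert this using 2
      field_simp
    refine le_trans (le_of_eq_of_le (lintegral_congr fun x => ?_) h) (by gcongr)
    rw [← ENNReal.rpow_mul, ← ENNReal.rpow_mul, ← ENNReal.rpow_mul, mul_one_div_cancel hκ0.ne',
      mul_div_cancel₀ _ hpσ.ne', ENNReal.rpow_one, mul_assoc,
      ← ENNReal.rpow_add_of_nonneg _ _ (by nlinarith) (by nlinarith)]
    congr 2
    ring
  have hrp : ENNReal.ofReal r ^ p * ENNReal.ofReal (r ^ (-p)) = 1 := by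
    rw [ENNReal.ofReal_rpow_of_pos hr, ← ENNReal.ofReal_mul (by positivity),
      ← Real.rpow_add hr, add_neg_cancel, Real.rpow_zero, ENNReal.ofReal_one]
  have hr1' : ENNReal.ofReal r ≤ 1 := by simpa using hr1
  have hpow : ∀ f : α → ℝ≥0∞, ((∫⁻ x, f x ^ p ∂μ) ^ (1 / p)) ^ p = ∫⁻ x, f x ^ p ∂μ := fun f => by
    rw [← ENNReal.rpow_mul, one_div_mul_cancel hp0.ne', ENNReal.rpow_one]
  have hA0 : 0 ≤ A := by linarith
  have hMp : M ^ p ≤ ENNReal.ofReal (c₀ * A ^ p) * (2 * Y ^ p +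
      ENNReal.ofReal β * X ^ (p - 1) * Y +
      ENNReal.ofReal ν * Y ^ (p * (1 - lam)) * X ^ (p * lam)) := by
    have hA1 : 1 ≤ ENNReal.ofReal A := by simpa using hA
    have hAp : ENNReal.ofReal A ≤ ENNReal.ofReal A ^ p := by
      conv_lhs => rw [← ENNReal.rpow_one (ENNReal.ofReal A)]
      exact ENNReal.rpow_le_rpow_of_exponent_le hA1 hp.le
    have hAp1 : 1 ≤ ENNReal.ofReal A ^ p := hA1.trans hAp
    rw [hM, ENNReal.mul_rpow_of_nonneg _ _ hp0.le, hpow]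
    have hsplit : ∫⁻ x, (e₂ x ^ p + ENNReal.ofReal (r ^ (-p)) * e₁ x ^ p +
        ENNReal.ofReal b * (S x * e₁ x ^ (p - 1) * e₂ x) + V x * e₁ x ^ p) ∂μ =
        ∫⁻ x, e₂ x ^ p ∂μ + ENNReal.ofReal (r ^ (-p)) * ∫⁻ x, e₁ x ^ p ∂μ +
        ENNReal.ofReal b * ∫⁻ x, S x * e₁ x ^ (p - 1) * e₂ x ∂μ + ∫⁻ x, V x * e₁ x ^ p ∂μ := by
      have k1 : AEMeasurable (fun x => e₂ x ^ p) μ := he₂.pow_const _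
      have k2 : AEMeasurable (fun x => ENNReal.ofReal (r ^ (-p)) * e₁ x ^ p) μ :=
        (he₁.pow_const _).const_mul _
      have k3 : AEMeasurable (fun x => ENNReal.ofReal b * (S x * e₁ x ^ (p - 1) * e₂ x)) μ :=
        ((hSm.mul (he₁.pow_const _)).mul he₂).const_mul _
      have k12 : AEMeasurable (fun x => e₂ x ^ p + ENNReal.ofReal (r ^ (-p)) * e₁ x ^ p) μ :=
        k1.add k2
      have k123 : AEMeasurable (fun x => e₂ x ^ p + ENNReal.ofReal (r ^ (-p)) * e₁ x ^ p +
          ENNReal.ofReal b * (S x * e₁ x ^ (p - 1) * e₂ x)) μ := k12.add k3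
      rw [lintegral_add_left' k123, lintegral_add_left' k12, lintegral_add_left' k1, lintegral_const_mul' _ _ ENNReal.ofReal_ne_top,
        lintegral_const_mul' _ _ ENNReal.ofReal_ne_top]
    rw [hsplit] at hen
    have t1 : ENNReal.ofReal r ^ p * ∫⁻ x, e₂ x ^ p ∂μ ≤ ENNReal.ofReal A ^ p * Y ^ p := by
      have := ENNReal.rpow_le_rpow h₂ hp0.le
      rwa [ENNReal.mul_rpow_of_nonneg _ _ hp0.le, hpow, ENNReal.mul_rpow_of_nonneg _ _ hp0.le]
        at this
    have t2 : ENNReal.ofReal r ^ p * (ENNReal.ofReal (r ^ (-p)) * ∫⁻ x, e₁ x ^ p ∂μ) ≤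
        ENNReal.ofReal A ^ p * Y ^ p := by
      rw [← mul_assoc, hrp, one_mul, ← hpow e₁]
      calc _ ≤ 1 * Y ^ p := by rw [one_mul]; gcongr
        _ ≤ _ := by gcongr
    have t3 : ENNReal.ofReal r ^ p * (ENNReal.ofReal b * ∫⁻ x, S x * e₁ x ^ (p - 1) * e₂ x ∂μ) ≤
        ENNReal.ofReal A ^ p * (ENNReal.ofReal β * X ^ (p - 1) * Y) := by
      -- Here r ≤ 1 enters: one factor r is kept to pair with the norm of e₂, the remaining r^{p-1}
      -- is discarded.
      have hrle : ENNReal.ofReal r ^ p ≤ ENNReal.ofReal r := by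
        conv_rhs => rw [← ENNReal.rpow_one (ENNReal.ofReal r)]
        exact ENNReal.rpow_le_rpow_of_exponent_ge hr1' hp.le
      calc _ ≤ ENNReal.ofReal r * (ENNReal.ofReal b * ((∫⁻ x, S x ^ s₂ ∂μ) ^ (1 / s₂) *
            X ^ (p - 1) * (∫⁻ x, e₂ x ^ p ∂μ) ^ (1 / p))) := by gcongr
        _ = (ENNReal.ofReal b * (∫⁻ x, S x ^ s₂ ∂μ) ^ (1 / s₂)) * X ^ (p - 1) *
            (ENNReal.ofReal r * (∫⁻ x, e₂ x ^ p ∂μ) ^ (1 / p)) := by ring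
        _ ≤ ENNReal.ofReal β * X ^ (p - 1) * (ENNReal.ofReal A ^ p * Y) := by
            exact mul_le_mul' (mul_le_mul' hS le_rfl) (h₂.trans (mul_le_mul' hAp le_rfl))
        _ = _ := by ring
    have t4 : ENNReal.ofReal r ^ p * ∫⁻ x, V x * e₁ x ^ p ∂μ ≤
        ENNReal.ofReal A ^ p * (ENNReal.ofReal ν * Y ^ (p * (1 - lam)) * X ^ (p * lam)) := by
      have hrle : ENNReal.ofReal r ^ p ≤ 1 := ENNReal.rpow_le_one hr1' hp0.le
      calc _ ≤ 1 * ((∫⁻ x, V x ^ κ ∂μ) ^ (1 / κ) * Y ^ (p * (1 - lam)) * X ^ (p * lam)) := by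
            gcongr
        _ ≤ _ := by gcongr
    calc _ ≤ ENNReal.ofReal r ^ p * (ENNReal.ofReal c₀ * (∫⁻ x, e₂ x ^ p ∂μ +
          ENNReal.ofReal (r ^ (-p)) * ∫⁻ x, e₁ x ^ p ∂μ +
          ENNReal.ofReal b * ∫⁻ x, S x * e₁ x ^ (p - 1) * e₂ x ∂μ +
          ∫⁻ x, V x * e₁ x ^ p ∂μ)) := by gcongr
      _ = ENNReal.ofReal c₀ * (ENNReal.ofReal r ^ p * ∫⁻ x, e₂ x ^ p ∂μ +
          ENNReal.ofReal r ^ p * (ENNReal.ofReal (r ^ (-p)) * ∫⁻ x, e₁ x ^ p ∂μ) +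
          ENNReal.ofReal r ^ p * (ENNReal.ofReal b * ∫⁻ x, S x * e₁ x ^ (p - 1) * e₂ x ∂μ) +
          ENNReal.ofReal r ^ p * ∫⁻ x, V x * e₁ x ^ p ∂μ) := by ring
      _ ≤ ENNReal.ofReal c₀ * (ENNReal.ofReal A ^ p * Y ^ p + ENNReal.ofReal A ^ p * Y ^ p +
          ENNReal.ofReal A ^ p * (ENNReal.ofReal β * X ^ (p - 1) * Y) +
          ENNReal.ofReal A ^ p * (ENNReal.ofReal ν * Y ^ (p * (1 - lam)) * X ^ (p * lam))) := by
          gcongr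
      _ = _ := by
          rw [ENNReal.ofReal_mul (by linarith), ← ENNReal.ofReal_rpow_of_nonneg hA0 hp0.le]; ring
  have hXM : X ≤ ENNReal.ofReal CS * (ENNReal.ofReal (A + 1) * Y + ENNReal.ofReal q * M) := by
    refine hsob.trans (mul_le_mul' le_rfl ?_)
    have h5 := ENNReal.lintegral_Lp_add_le he₂ (hm.const_mul (ENNReal.ofReal q)) hp.le
    have h6 : (∫⁻ x, (ENNReal.ofReal q * m x) ^ p ∂μ) ^ (1 / p) =
        ENNReal.ofReal q * (∫⁻ x, m x ^ p ∂μ) ^ (1 / p) := by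
      simp_rw [ENNReal.mul_rpow_of_nonneg _ _ hp0.le]
      rw [lintegral_const_mul' _ _ (by simp [hp0.le]), ENNReal.mul_rpow_of_nonneg _ _
        (by positivity), ← ENNReal.rpow_mul, mul_one_div_cancel hp0.ne', ENNReal.rpow_one]
    rw [h6] at h5
    calc _ ≤ ENNReal.ofReal r * ((∫⁻ x, e₂ x ^ p ∂μ) ^ (1 / p) +
          ENNReal.ofReal q * (∫⁻ x, m x ^ p ∂μ) ^ (1 / p)) + Y :=
          add_le_add (mul_le_mul' le_rfl h5) h₁
      _ = ENNReal.ofReal r * (∫⁻ x, e₂ x ^ p ∂μ) ^ (1 / p) + Y + ENNReal.ofReal q * M := by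
          rw [hM]; ring
      _ ≤ ENNReal.ofReal A * Y + Y + ENNReal.ofReal q * M := by gcongr
      _ = _ := by rw [ENNReal.ofReal_add hA0 zero_le_one, ENNReal.ofReal_one]; ring
  -- passage to real numbers
  obtain ⟨x, hx0, hx⟩ : ∃ x : ℝ, 0 ≤ x ∧ X = ENNReal.ofReal x :=
    ⟨X.toReal, ENNReal.toReal_nonneg, (ENNReal.ofReal_toReal hfin).symm⟩
  obtain ⟨y, hy0, hy⟩ : ∃ y : ℝ, 0 ≤ y ∧ Y = ENNReal.ofReal y :=
    ⟨Y.toReal, ENNReal.toReal_nonneg, (ENNReal.ofReal_toReal hYt).symm⟩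
  have hplam : 0 ≤ p * (1 - lam) := by nlinarith
  have hMp' : M ^ p ≤ ENNReal.ofReal (c₀ * A ^ p * (2 * y ^ p + β * x ^ (p - 1) * y +
      ν * y ^ (p * (1 - lam)) * x ^ (p * lam))) := by
    refine hMp.trans (le_of_eq ?_)
    rw [hx, hy, ENNReal.ofReal_rpow_of_nonneg hy0 hp0.le,
      ENNReal.ofReal_rpow_of_nonneg hx0 (by linarith : 0 ≤ p - 1),
      ENNReal.ofReal_rpow_of_nonneg hy0 hplam,
      ENNReal.ofReal_rpow_of_nonneg hx0 (by positivity : 0 ≤ p * lam),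
      ← ENNReal.ofReal_ofNat 2, ← ENNReal.ofReal_mul (by norm_num), ← ENNReal.ofReal_mul hβ,
      ← ENNReal.ofReal_mul (by positivity), ← ENNReal.ofReal_mul hν,
      ← ENNReal.ofReal_mul (by positivity), ← ENNReal.ofReal_add (by positivity) (by positivity),
      ← ENNReal.ofReal_add (by positivity) (by positivity), ← ENNReal.ofReal_mul (by positivity)]
  have hMt : M ≠ ∞ := fun h => by
    rw [h, ENNReal.top_rpow_of_pos hp0] at hMp'
    exact absurd hMp' (by simp)
  obtain ⟨M', hM'0, hM'⟩ : ∃ z : ℝ, 0 ≤ z ∧ M = ENNReal.ofReal z :=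
    ⟨M.toReal, ENNReal.toReal_nonneg, (ENNReal.ofReal_toReal hMt).symm⟩
  rw [hM', ENNReal.ofReal_rpow_of_nonneg hM'0 hp0.le,
    ENNReal.ofReal_le_ofReal_iff (by positivity)] at hMp'
  rw [hx, hy, hM', ← ENNReal.ofReal_mul (by linarith), ← ENNReal.ofReal_mul (by linarith),
    ← ENNReal.ofReal_add (by positivity) (by positivity), ← ENNReal.ofReal_mul (by linarith),
    ENNReal.ofReal_le_ofReal_iff (by positivity)] at hXM
  rw [hx, hy, ← ENNReal.ofReal_mul hDpos.le]
  exact ENNReal.ofReal_le_ofReal (le_of_absorption hp hlam1 hCS hq hA hc₀ hβ hν hx0 hy0 hM'0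
    hXM hMp')

end MoserStep

/-! ### The energy inequality for weak solutions -/

section Energy

/-- No finiteness of the energy is presupposed: if the right side is infinite the claim is empty,
and otherwise R is integrable and the vanishing integral drops out. -/
lemma lintegral_ofReal_le_of_integral_eq_zero {α : Type*} [MeasurableSpace α] {μ : Measure α}
    {I L R : α → ℝ} (hI : Integrable I μ) (hI0 : ∫ x, I x ∂μ = 0) (hR : AEMeasurable R μ)
    (hL0 : ∀ᵐ x ∂μ, 0 ≤ L x) (hR0 : ∀ᵐ x ∂μ, 0 ≤ R x) (hLR : ∀ᵐ x ∂μ, L x ≤ I x + R x) :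
    ∫⁻ x, ENNReal.ofReal (L x) ∂μ ≤ ∫⁻ x, ENNReal.ofReal (R x) ∂μ := by
  by_cases ht : ∫⁻ x, ENNReal.ofReal (R x) ∂μ = ∞
  · rw [ht]; exact le_top
  have hRi : Integrable R μ := by
    refine ⟨hR.aestronglyMeasurable, ?_⟩
    rw [hasFiniteIntegral_iff_ofReal hR0]
    exact lt_top_iff_ne_top.2 ht
  have hIR : Integrable (fun x => I x + R x) μ := hI.add hRi
  calc ∫⁻ x, ENNReal.ofReal (L x) ∂μ ≤ ∫⁻ x, ENNReal.ofReal (I x + R x) ∂μ :=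
        lintegral_mono_ae (hLR.mono fun x hx => ENNReal.ofReal_le_ofReal hx)
    _ = ENNReal.ofReal (∫ x, (I x + R x) ∂μ) :=
        (ofReal_integral_eq_lintegral_ofReal hIR (by
          filter_upwards [hL0, hLR] with x h1 h2 using h1.trans h2)).symm
    _ = ENNReal.ofReal (∫ x, R x ∂μ) := by rw [integral_add hI hRi, hI0, zero_add]
    _ = _ := ofReal_integral_eq_lintegral_ofReal hRi hR0

lemma memLp_norm_rpow {α F : Type*} [MeasurableSpace α] {μ : Measure α} [IsFiniteMeasure μ]
    [NormedAddCommGroup F] {f : α → F} {q q' s : ℝ} (hs : 0 < s) (hqs : s * q' ≤ q)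
    (hf : MemLp f (ENNReal.ofReal q) μ) :
    MemLp (fun x => ‖f x‖ ^ s) (ENNReal.ofReal q') μ := by
  have h := hf.norm_rpow_div (ENNReal.ofReal s)
  rw [ENNReal.toReal_ofReal hs.le, ← ENNReal.ofReal_div_of_pos hs] at h
  refine h.mono_exponent (ENNReal.ofReal_le_ofReal ?_)
  rw [le_div_iff₀ hs]
  linarith

/-- The structural bounds, with constant coefficients, on a set `D`. -/
def StructuralBounds (D : Set (E n)) (Q : E n → Matrix (Fin n) (Fin n) ℝ)
    (p γ ψ δ a b c d e f g h : ℝ) (A : E n → ℝ → E n → E n) (B : E n → ℝ → E n → ℝ) : Prop :=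
  ∀ᵐ x ∂(volume.restrict D), ∀ (z : ℝ) (ξ : E n),
    a⁻¹ * ‖sqrtQ Q x ξ‖ ^ p - h * |z| ^ γ - g ≤ inner ℝ ξ (A x z ξ) ∧
    (∀ ζ : E n, |inner ℝ ζ (A x z ξ)| ≤
      ‖sqrtQ Q x ζ‖ * (a * ‖sqrtQ Q x ξ‖ ^ (p - 1) + b * |z| ^ (γ - 1) + e)) ∧
    |B x z ξ| ≤ c * ‖sqrtQ Q x ξ‖ ^ (ψ - 1) + d * |z| ^ (δ - 1) + f

lemma supNorm_nonneg (f : E n → ℝ) (D : Set (E n)) : 0 ≤ supNorm f D := ENNReal.toReal_nonneg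

lemma IsNonnegBounded.ae_le_supNorm {Ω D : Set (E n)} {m : E n → ℝ} (hm : IsNonnegBounded Ω m)
    (hD : D ⊆ Ω) : ∀ᵐ x ∂(volume.restrict D), 0 ≤ m x ∧ m x ≤ supNorm m D := by
  have hD' := Measure.restrict_mono (μ := (volume : Measure (E n))) hD le_rfl
  have hfin : eLpNorm m ∞ (volume.restrict D) < ∞ :=
    (eLpNorm_mono_measure _ hD').trans_lt hm.2.2
  filter_upwards [ae_mono hD' hm.1, enorm_ae_le_eLpNormEssSup m (volume.restrict D)] with x h1 h2
  refine ⟨h1, ?_⟩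
  rw [← eLpNorm_exponent_top] at h2
  have := ENNReal.toReal_mono hfin.ne h2
  simpa [supNorm, abs_of_nonneg h1] using this

/-- Symmetry of √Q turns ζ·√QÃ into √Qζ·Ã. Later arguments use A only through such pairings, and the
coefficients only through their sup norms on D. -/
lemma StructuralConditions.structuralBounds {Ω D : Set (E n)}
    {Q : E n → Matrix (Fin n) (Fin n) ℝ} {p γ ψ δ a : ℝ} {κ : Coefficients n}
    {A : E n → ℝ → E n → E n} {B : E n → ℝ → E n → ℝ}
    (h : StructuralConditions Ω Q p γ ψ δ a κ A B) (hκ : κ.Bounded Ω) (hD : D ⊆ Ω) :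
    StructuralBounds D Q p γ ψ δ a (supNorm κ.b D) (supNorm κ.c D) (supNorm κ.d D)
      (supNorm κ.e D) (supNorm κ.f D) (supNorm κ.g D) (supNorm κ.h D) A B := by
  obtain ⟨A', hA⟩ := h
  have hD' := Measure.restrict_mono (μ := (volume : Measure (E n))) hD le_rfl
  filter_upwards [ae_mono hD' hA, hκ.b.ae_le_supNorm hD, hκ.c.ae_le_supNorm hD,
    hκ.d.ae_le_supNorm hD, hκ.e.ae_le_supNorm hD, hκ.f.ae_le_supNorm hD,
    hκ.g.ae_le_supNorm hD, hκ.h.ae_le_supNorm hD] with x hx hb hc hd he hf hg hh z ξ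
  obtain ⟨h1, h2, h3, h4⟩ := hx z ξ
  refine ⟨le_trans ?_ h2, fun ζ => ?_, h4.trans ?_⟩
  · have : κ.h x * |z| ^ γ ≤ supNorm κ.h D * |z| ^ γ :=
      mul_le_mul_of_nonneg_right hh.2 (by positivity)
    linarith [hg.2]
  · rw [h1, inner_sqrtQ]
    refine (abs_real_inner_le_norm _ _).trans (mul_le_mul_of_nonneg_left (h3.trans ?_)
      (norm_nonneg _))
    have : κ.b x * |z| ^ (γ - 1) ≤ supNorm κ.b D * |z| ^ (γ - 1) :=
      mul_le_mul_of_nonneg_right hb.2 (by positivity)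
    linarith [he.2]
  · have k1 : κ.c x * ‖sqrtQ Q x ξ‖ ^ (ψ - 1) ≤ supNorm κ.c D * ‖sqrtQ Q x ξ‖ ^ (ψ - 1) :=
      mul_le_mul_of_nonneg_right hc.2 (by positivity)
    have k2 : κ.d x * |z| ^ (δ - 1) ≤ supNorm κ.d D * |z| ^ (δ - 1) :=
      mul_le_mul_of_nonneg_right hd.2 (by positivity)
    linarith [hf.2]

variable {p σ γ ψ δ a b c d e f g h : ℝ} {Q : E n → Matrix (Fin n) (Fin n) ℝ} {Ω D : Set (E n)}
  {A : E n → ℝ → E n → E n} {B : E n → ℝ → E n → ℝ} {u : E n → ℝ} {v : E n → E n}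

theorem IsWeakSolution.integral_test_eq_zero (hsol : IsWeakSolution Ω p Q A B u v) (hp : 1 < p)
    (hσ : 1 < σ) (hpγ : p < γ) (hγ : γ < σ * (p - 1) + 1) (hpψ : p < ψ)
    (hψ : ψ < p + 1 - σ⁻¹) (hpδ : p < δ) (hδ : δ < p * σ) (hQ : IsWeight Ω p Q) (hΩ : IsOpen Ω)
    (hDm : NullMeasurableSet D volume) (hD : D ⊆ Ω) (hDfin : volume D < ∞)
    {C : ℝ≥0∞} (hCt : C ≠ ∞)
    (hS : ∀ (w : E n → ℝ) (g : E n → E n), MemWZero p Q D w g →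
      eLpNorm w (ENNReal.ofReal (p * σ)) (volume.restrict D) ≤ C * wNorm p Q D w g)
    (hu : MemLp u (ENNReal.ofReal (p * σ)) (volume.restrict D))
    (hstr : StructuralBounds D Q p γ ψ δ a b c d e f g h A B)
    {w : E n → ℝ} {g' : E n → E n} (hw : MemWZero p Q D w g') :
    IntegrableOn (fun x => inner ℝ (g' x) (A x (u x) (v x)) + w x * B x (u x) (v x)) D volume ∧
    ∫ x in D, (inner ℝ (g' x) (A x (u x) (v x)) + w x * B x (u x) (v x)) = 0 := by
  have hp0 : 0 < p := by linarith
  have hpσ : 1 < p * σ := one_lt_mul_of_lt_of_le hp hσ.le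
  have hσi : σ⁻¹ < 1 := inv_lt_one_of_one_lt₀ hσ
  have hσi0 : 0 < σ⁻¹ := by positivity
  have : IsFiniteMeasure (volume.restrict D) := ⟨by simpa using hDfin⟩
  have hX : MemLp (fun x => ‖sqrtQ Q x (v x)‖) (ENNReal.ofReal p) (volume.restrict D) :=
    (hsol.1.memLp_sqrtQ hp.le hQ hΩ).mono_measure (Measure.restrict_mono hD le_rfl)
  have hc1 : (p - 1) * p.conjExponent = p := by
    rw [Real.conjExponent]; field_simp [(by linarith : p - 1 ≠ 0)]
  have hc0 : 0 < p.conjExponent := by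
    rw [Real.conjExponent]; exact div_pos hp0 (by linarith)
  have hc2 : (p * σ - 1) * (p * σ).conjExponent = p * σ := by
    rw [Real.conjExponent]; field_simp [(by linarith : p * σ - 1 ≠ 0)]
  have hc20 : 0 < (p * σ).conjExponent := by
    rw [Real.conjExponent]; exact div_pos (by linarith) (by linarith)
  -- Given √Q∇u ∈ L^p and u ∈ L^{pσ}, the upper bounds on γ, ψ and δ ensure that the majorant of Ã
  -- is in L^{p'} and that of B in the dual of L^{pσ}.
  refine hsol.integral_memWZero_eq_zero hp.le hQ hΩ hDm hD
    (Real.HolderConjugate.conjExponent hp).ennrealOfReal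
    (Real.HolderConjugate.conjExponent hpσ).ennrealOfReal hCt hS
    (a₁ := fun x => a * ‖‖sqrtQ Q x (v x)‖‖ ^ (p - 1) + b * ‖u x‖ ^ (γ - 1) + e)
    (a₂ := fun x => c * ‖‖sqrtQ Q x (v x)‖‖ ^ (ψ - 1) + d * ‖u x‖ ^ (δ - 1) + f)
    ?_ ?_ ?_ ?_ hw
  · refine (((memLp_norm_rpow (by linarith) hc1.le hX).const_mul a).add
      ((memLp_norm_rpow (by linarith) ?_ hu).const_mul b)).add (memLp_const e)
    calc _ ≤ (σ * (p - 1)) * p.conjExponent :=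
        mul_le_mul_of_nonneg_right (by linarith) hc0.le
      _ = p * σ := by rw [mul_assoc, hc1]; ring
  · refine (((memLp_norm_rpow (by linarith) ?_ hX).const_mul c).add
      ((memLp_norm_rpow (by linarith) ?_ hu).const_mul d)).add (memLp_const f)
    · have h1 : (ψ - 1) * σ ≤ p * σ - 1 := by
        have h2 : (ψ - 1) * σ ≤ (p - σ⁻¹) * σ :=
          mul_le_mul_of_nonneg_right (by linarith) (by linarith)
        have h3 : (p - σ⁻¹) * σ = p * σ - 1 := by field_simp
        linarith
      have h2 : ((ψ - 1) * (p * σ).conjExponent) * σ ≤ p * σ := by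
        calc _ = ((ψ - 1) * σ) * (p * σ).conjExponent := by ring
          _ ≤ (p * σ - 1) * (p * σ).conjExponent := mul_le_mul_of_nonneg_right h1 hc20.le
          _ = _ := hc2
      exact le_of_mul_le_mul_right h2 (by linarith)
    · calc _ ≤ (p * σ - 1) * (p * σ).conjExponent :=
          mul_le_mul_of_nonneg_right (by linarith) hc20.le
        _ = _ := hc2
  · filter_upwards [hstr] with x hx ξ
    simpa only [norm_norm, abs_norm, Real.norm_eq_abs] using (hx (u x) (v x)).2.1 ξ
  · filter_upwards [hstr] with x hx
    simpa only [norm_norm, abs_norm, Real.norm_eq_abs] using (hx (u x) (v x)).2.2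

/-- The potential in the energy inequality. -/
def potential (K p γ ψ δ c d h z : ℝ) : ℝ :=
  h * |z| ^ (γ - p) + d * |z| ^ (δ - p) +
    c ^ (p / (p + 1 - ψ)) * ubar K z ^ (p * (ψ - p) / (p + 1 - ψ))

lemma measurable_ubar (K : ℝ) : Measurable (ubar K) := continuous_ubar.measurable

lemma measurable_potential (K p γ ψ δ c d h : ℝ) : Measurable (potential K p γ ψ δ c d h) := by
  have := measurable_ubar K
  unfold potential
  fun_prop

lemma potential_nonneg {K : ℝ} (hK : 0 < K) (hc : 0 ≤ c) (hd : 0 ≤ d) (hh : 0 ≤ h)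
    (z : ℝ) : 0 ≤ potential K p γ ψ δ c d h z := by
  have := ubar_pos hK z
  unfold potential
  positivity

/-- The power of a cutoff function is a cutoff function. -/
lemma LipZero.rpow (hp : 1 < p) {η : E n → ℝ} (hη : η ∈ LipZero D)
    (hη1 : ∀ x, η x ∈ Icc (0 : ℝ) 1) : (fun x => η x ^ p) ∈ LipZero D := by
  obtain ⟨⟨C, hC⟩, hc, hs⟩ := hη
  have h0 : (0 : ℝ) ^ p = 0 := Real.zero_rpow (by linarith)
  have hlip : LipschitzOnWith p.toNNReal (fun z : ℝ => z ^ p) (Icc 0 1) := by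
    refine Convex.lipschitzOnWith_of_nnnorm_hasDerivWithin_le (convex_Icc 0 1)
      (f' := fun z => p * z ^ (p - 1))
      (fun z _ => (Real.hasDerivAt_rpow_const (Or.inr hp.le)).hasDerivWithinAt) fun z hz => ?_
    rw [← NNReal.coe_le_coe, coe_nnnorm, Real.coe_toNNReal _ (by linarith), Real.norm_eq_abs,
      abs_of_nonneg (mul_nonneg (by linarith) (Real.rpow_nonneg hz.1 _))]
    exact mul_le_of_le_one_right (by linarith) (Real.rpow_le_one hz.1 hz.2 (by linarith))
  refine ⟨⟨p.toNNReal * C, fun x y => ?_⟩, hc.comp_left (g := fun z : ℝ => z ^ p) h0,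
    (closure_mono fun x hx => ?_).trans hs⟩
  · refine (hlip (hη1 x) (hη1 y)).trans ?_
    rw [ENNReal.coe_mul, mul_assoc]
    gcongr
    exact hC x y
  · rw [Function.mem_support] at hx ⊢
    exact fun h => hx (by rw [h, h0])

/-- The equation is tested with η^p u T^{p(q-1)}. The power η^p makes its gradient carry η^{p-1}∇η,
which matches the homogeneity of `energy_pointwise`. Integrating that inequality removes the
weak-formulation integrand. -/
theorem IsWeakSolution.energy_le (hsol : IsWeakSolution Ω p Q A B u v) (hp : 1 < p)
    (hσ : 1 < σ) (hpγ : p < γ) (hγ : γ < σ * (p - 1) + 1) (hpψ : p < ψ)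
    (hψ : ψ < p + 1 - σ⁻¹) (hpδ : p < δ) (hδ : δ < p * σ) (hQ : IsWeight Ω p Q) (hΩ : IsOpen Ω)
    (hDm : NullMeasurableSet D volume) (hD : D ⊆ Ω) (hDfin : volume D < ∞)
    {C : ℝ≥0∞} (hCt : C ≠ ∞)
    (hS : ∀ (w : E n → ℝ) (g : E n → E n), MemWZero p Q D w g →
      eLpNorm w (ENNReal.ofReal (p * σ)) (volume.restrict D) ≤ C * wNorm p Q D w g)
    (hu : MemLp u (ENNReal.ofReal (p * σ)) (volume.restrict D)) {t t' : ℝ≥0∞}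
    (htt : ENNReal.HolderConjugate t t') {c' : ℝ}
    (hgain : ∀ f ∈ LipLoc Ω, eLpNorm f (ENNReal.ofReal p * t') (volume.restrict D) ≤
      ENNReal.ofReal c' * wNorm p Q Ω f (gradient f))
    (ha : 1 < a) (hb : 0 ≤ b) (hc : 0 ≤ c) (hd : 0 ≤ d) (hg : 0 ≤ g) (hh : 0 ≤ h)
    (hstr : StructuralBounds D Q p γ ψ δ a b c d e f g h A B)
    {r K l q : ℝ} (hr : 0 < r) (hK : 0 < K) (hl : 0 < l) (hq : 1 ≤ q)
    (heK : e ≤ (K / r) ^ (p - 1)) (hfK : f ≤ K ^ (p - 1) * r ^ (-p)) (hgK : g ≤ (K / r) ^ p)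
    {η : E n → ℝ} (hη : η ∈ LipZero D) (hη1 : ∀ x, η x ∈ Icc (0 : ℝ) 1)
    (hηt : eLpNorm (fun x => sqrtQ Q x (gradient η x)) (t * ENNReal.ofReal p)
      (volume.restrict D) < ∞) :
    ∫⁻ x in D, ENNReal.ofReal
      (η x * trunc K l (u x) ^ (q - 1) * ‖sqrtQ Q x (v x)‖) ^ p ≤
    ENNReal.ofReal (2 * a * (energyConst p ψ a * q)) * ∫⁻ x in D,
      (ENNReal.ofReal (‖sqrtQ Q x (gradient η x)‖ * truncPow K l q (u x)) ^ p +
        ENNReal.ofReal (r ^ (-p)) * ENNReal.ofReal (η x * truncPow K l q (u x)) ^ p +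
        ENNReal.ofReal b * (ENNReal.ofReal (|u x| ^ (γ - p)) *
          ENNReal.ofReal (η x * truncPow K l q (u x)) ^ (p - 1) *
          ENNReal.ofReal (‖sqrtQ Q x (gradient η x)‖ * truncPow K l q (u x))) +
        ENNReal.ofReal (potential K p γ ψ δ c d h (u x)) *
          ENNReal.ofReal (η x * truncPow K l q (u x)) ^ p) := by
  have hp0 : 0 < p := by linarith
  have hσi0 : 0 < σ⁻¹ := by positivity
  have hD' := Measure.restrict_mono (μ := (volume : Measure (E n))) hD le_rfl
  set ζ : E n → ℝ := fun x => η x ^ p with hζdef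
  have hζ : ζ ∈ LipZero D := LipZero.rpow hp hη hη1
  have hgradζ : ∀ᵐ x ∂(volume.restrict D),
      gradient ζ x = (p * η x ^ (p - 1)) • gradient η x := by
    filter_upwards [ae_mono hD' (ae_differentiableAt_of_mem_lipLoc hΩ
      (mem_lipLoc_of_mem_lipZero hη))] with x hx
    exact gradient_comp_eq (F := fun z => z ^ p) hx (Real.hasDerivAt_rpow_const (Or.inr hp.le))
  have hGm : AEStronglyMeasurable (fun x => ‖sqrtQ Q x (gradient η x)‖) (volume.restrict D) :=
    hQ.aestronglyMeasurable_norm_sqrtQ hDm hD (measurable_gradient η).aestronglyMeasurable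
  have hζt : eLpNorm (fun x => sqrtQ Q x (gradient ζ x)) (t * ENNReal.ofReal p)
      (volume.restrict D) < ∞ := by
    have h1 : eLpNorm (fun x => p * ‖sqrtQ Q x (gradient η x)‖) (t * ENNReal.ofReal p)
        (volume.restrict D) < ∞ := by
      refine (MemLp.const_mul ⟨hGm, ?_⟩ p).2
      rwa [eLpNorm_norm]
    refine (eLpNorm_mono_ae ?_).trans_lt h1
    filter_upwards [hgradζ] with x hx
    have h0 := Real.rpow_nonneg (hη1 x).1 (p - 1)
    rw [hx, sqrtQ_smul, norm_smul, Real.norm_of_nonneg (mul_nonneg hp0.le h0),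
      Real.norm_of_nonneg (mul_nonneg hp0.le (norm_nonneg _))]
    refine mul_le_mul_of_nonneg_right (mul_le_of_le_one_right hp0.le ?_) (norm_nonneg _)
    exact Real.rpow_le_one (hη1 x).1 (hη1 x).2 (by linarith)
  have hqp : 0 ≤ p * (q - 1) := mul_nonneg hp0.le (by linarith)
  have hw := memWZero_mul_comp hp hΩ hQ hDm hD hDfin hζ
    (fun x => by
      have h0 := Real.rpow_nonneg (hη1 x).1 p
      rw [abs_of_nonneg h0]
      exact Real.rpow_le_one (hη1 x).1 (hη1 x).2 hp0.le)
    htt hζt hgain hsol.1 (fun z => hasDerivAt_truncTest hK hl p q z)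
    (continuous_truncTestDeriv hK hl p q) (M := p * q * (l ^ (q - 1)) ^ p) (fun z => by
      have h0 := trunc_pos hK hl z
      have h1 := le_truncTestDeriv hK hl hp0.le hq z
      have h2 : 0 ≤ (trunc K l z ^ (q - 1)) ^ p := by positivity
      rw [abs_of_nonneg (h2.trans h1)]
      refine (truncTestDeriv_le hK hl hp.le hq z).trans ?_
      exact mul_le_mul_of_nonneg_left (Real.rpow_le_rpow
        (Real.rpow_nonneg h0.le _) (trunc_rpow_le hK hl (by linarith) z) hp0.le) (by positivity))
  obtain ⟨hI, hI0⟩ := hsol.integral_test_eq_zero hp hσ hpγ hγ hpψ hψ hpδ hδ hQ hΩ hDm hD hDfin hCt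
    hS hu hstr hw
  set R : E n → ℝ := fun x => energyConst p ψ a * q *
    ((‖sqrtQ Q x (gradient η x)‖ * truncPow K l q (u x)) ^ p +
      r ^ (-p) * (η x * truncPow K l q (u x)) ^ p +
      b * |u x| ^ (γ - p) * (η x * truncPow K l q (u x)) ^ (p - 1) *
        (‖sqrtQ Q x (gradient η x)‖ * truncPow K l q (u x)) +
      potential K p γ ψ δ c d h (u x) * (η x * truncPow K l q (u x)) ^ p) with hR
  set m : E n → ℝ := fun x => η x * trunc K l (u x) ^ (q - 1) * ‖sqrtQ Q x (v x)‖ with hm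
  have hP0 : ∀ z, 0 ≤ truncPow K l q z := fun z => (truncPow_pos hK hl q z).le
  have hV0 : ∀ z, 0 ≤ potential K p γ ψ δ c d h z := potential_nonneg hK hc hd hh
  have hW := energyConst_pos (ψ := ψ) hp ha
  have hm0 : ∀ x, 0 ≤ m x := fun x => mul_nonneg (mul_nonneg (hη1 x).1
    (Real.rpow_nonneg (trunc_pos hK hl _).le _)) (norm_nonneg _)
  have hum : AEMeasurable u (volume.restrict D) := hu.1.aemeasurable
  have hηm : Measurable η := by
    obtain ⟨⟨C, hC⟩, -⟩ := hη
    exact hC.continuous.measurable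
  have hPm : AEMeasurable (fun x => truncPow K l q (u x)) (volume.restrict D) :=
    (continuous_truncPow hK hl q).measurable.comp_aemeasurable hum
  have hVm : AEMeasurable (fun x => potential K p γ ψ δ c d h (u x)) (volume.restrict D) :=
    (measurable_potential K p γ ψ δ c d h).comp_aemeasurable hum
  have hGm' := hGm.aemeasurable
  have hRm : AEMeasurable R (volume.restrict D) := by
    have h1 : AEMeasurable (fun x => |u x| ^ (γ - p)) (volume.restrict D) :=
      hum.norm.pow_const _
    have h2 : AEMeasurable (fun x => η x * truncPow K l q (u x)) (volume.restrict D) :=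
      hηm.aemeasurable.mul hPm
    have h3 : AEMeasurable (fun x => ‖sqrtQ Q x (gradient η x)‖ * truncPow K l q (u x))
      (volume.restrict D) := hGm'.mul hPm
    exact ((((h3.pow_const p).add ((h2.pow_const p).const_mul _)).add
      (((h1.const_mul b).mul (h2.pow_const (p - 1))).mul h3)).add
        (hVm.mul (h2.pow_const p))).const_mul _
  have hR0 : ∀ x, 0 ≤ R x := fun x => by
    have h1 := hP0 (u x)
    have h2 := (hη1 x).1
    have h3 := hV0 (u x)
    have h4 : 0 ≤ energyConst p ψ a * q := by positivity
    simp only [hR]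
    positivity
  have hkey := lintegral_ofReal_le_of_integral_eq_zero (L := fun x => (2 * a)⁻¹ * m x ^ p)
    (R := R) hI hI0 hRm (.of_forall fun x => by have := hm0 x; positivity) (.of_forall hR0) (by
      filter_upwards [hstr, hgradζ] with x hx hgx
      obtain ⟨h1, h2, h3⟩ := hx (u x) (v x)
      have hU := ubar_pos hK (u x)
      have hT := trunc_pos hK hl (u x)
      have := energy_pointwise hp hpγ hpψ (by linarith) hpδ ha hq hr (hη1 x).1
        (norm_nonneg (sqrtQ Q x (v x))) (norm_nonneg (sqrtQ Q x (gradient η x))) hU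
        (abs_le_ubar (K := K) (u x)) (Real.rpow_pos_of_pos hT (q - 1))
        (abs_truncTest hK hl p q (u x)).le
        (le_truncTestDeriv hK hl hp0.le hq (u x)) (truncTestDeriv_le hK hl hp.le hq (u x))
        hb hc hd hh hg
        (heK.trans (Real.rpow_le_rpow (by positivity) (by gcongr; exact le_ubar _) (by linarith)))
        (hfK.trans (mul_le_mul_of_nonneg_right (Real.rpow_le_rpow hK.le (le_ubar _)
          (by linarith)) (by positivity)))
        (hgK.trans (Real.rpow_le_rpow (by positivity) (by gcongr; exact le_ubar _) (by linarith)))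
        h1 (h2 (gradient η x)) h3
      refine this.trans (add_le_add (le_of_eq ?_) le_rfl)
      rw [hgx]
      simp only [hζdef, inner_add_left, inner_smul_left, smul_smul, conj_trivial])
  have hmeq : ∀ x, ENNReal.ofReal ((2 * a)⁻¹ * m x ^ p) =
      ENNReal.ofReal (2 * a)⁻¹ * ENNReal.ofReal (m x) ^ p := fun x => by
    rw [ENNReal.ofReal_mul (by positivity), ENNReal.ofReal_rpow_of_nonneg (hm0 x) hp0.le]
  have hReq : ∀ x, ENNReal.ofReal (R x) = ENNReal.ofReal (energyConst p ψ a * q) *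
      (ENNReal.ofReal (‖sqrtQ Q x (gradient η x)‖ * truncPow K l q (u x)) ^ p +
        ENNReal.ofReal (r ^ (-p)) * ENNReal.ofReal (η x * truncPow K l q (u x)) ^ p +
        ENNReal.ofReal b * (ENNReal.ofReal (|u x| ^ (γ - p)) *
          ENNReal.ofReal (η x * truncPow K l q (u x)) ^ (p - 1) *
          ENNReal.ofReal (‖sqrtQ Q x (gradient η x)‖ * truncPow K l q (u x))) +
        ENNReal.ofReal (potential K p γ ψ δ c d h (u x)) *
          ENNReal.ofReal (η x * truncPow K l q (u x)) ^ p) := fun x => by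
    have h1 := hP0 (u x)
    have h2 := (hη1 x).1
    have h3 := hV0 (u x)
    have h5 : 0 ≤ η x * truncPow K l q (u x) := by positivity
    have h6 : 0 ≤ ‖sqrtQ Q x (gradient η x)‖ * truncPow K l q (u x) := by positivity
    have h4 : 0 ≤ energyConst p ψ a * q := by positivity
    rw [ENNReal.ofReal_rpow_of_nonneg h6 hp0.le, ENNReal.ofReal_rpow_of_nonneg h5 hp0.le,
      ENNReal.ofReal_rpow_of_nonneg h5 (by linarith : 0 ≤ p - 1),
      ← ENNReal.ofReal_mul (by positivity), ← ENNReal.ofReal_mul (by positivity),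
      ← ENNReal.ofReal_mul (by positivity), ← ENNReal.ofReal_mul hb,
      ← ENNReal.ofReal_mul h3, ← ENNReal.ofReal_add (by positivity) (by positivity),
      ← ENNReal.ofReal_add (by positivity) (by positivity),
      ← ENNReal.ofReal_add (by positivity) (by positivity), ← ENNReal.ofReal_mul h4]
    simp only [hR, mul_assoc]
  simp only [hmeq, hReq] at hkey
  rw [lintegral_const_mul' _ _ ENNReal.ofReal_ne_top,
    lintegral_const_mul' _ _ ENNReal.ofReal_ne_top] at hkey
  have h2a : ENNReal.ofReal (2 * a) * ENNReal.ofReal (2 * a)⁻¹ = 1 := by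
    rw [← ENNReal.ofReal_mul (by positivity), mul_inv_cancel₀ (by positivity), ENNReal.ofReal_one]
  calc _ = ENNReal.ofReal (2 * a) * (ENNReal.ofReal (2 * a)⁻¹ *
        ∫⁻ x in D, ENNReal.ofReal (m x) ^ p) := by rw [← mul_assoc, h2a, one_mul]
    _ ≤ _ := mul_le_mul' le_rfl hkey
    _ = _ := by rw [← mul_assoc, ← ENNReal.ofReal_mul (by positivity)]

end Energy

/-! ### One step of the iteration on a ball -/

section Step

lemma rpow_lintegral_ofReal {α : Type*} [MeasurableSpace α] {μ : Measure α} {p : ℝ} (hp : 0 < p)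
    {f : α → ℝ} (hf : ∀ x, 0 ≤ f x) :
    (∫⁻ x, ENNReal.ofReal (f x) ^ p ∂μ) ^ (1 / p) = eLpNorm f (ENNReal.ofReal p) μ := by
  rw [eLpNorm_eq_rpow_lintegral hp]
  simp only [Real.enorm_eq_ofReal (hf _)]

/-- Monotonicity of L^q norms over a probability measure; only τk ≤ θ is needed, which is what makes
θ a maximum of exponents. -/
lemma eLpNorm_abs_rpow_le {α : Type*} [MeasurableSpace α] {μ : Measure α} [IsProbabilityMeasure μ]
    {u : α → ℝ} (hu : AEStronglyMeasurable u μ) {τ k θ U : ℝ} (hτ : 0 < τ) (hk : 0 < k)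
    (hτk : τ * k ≤ θ) (hU0 : 0 ≤ U) (hU : eLpNorm u (ENNReal.ofReal θ) μ ≤ ENNReal.ofReal U) :
    eLpNorm (fun x => |u x| ^ τ) (ENNReal.ofReal k) μ ≤ ENNReal.ofReal (U ^ τ) := by
  simp only [← Real.norm_eq_abs]
  rw [eLpNorm_norm_rpow u hτ, ← ENNReal.ofReal_mul hk.le,
    ← ENNReal.ofReal_rpow_of_nonneg hU0 hτ.le]
  refine ENNReal.rpow_le_rpow ((eLpNorm_le_eLpNorm_of_exponent_le
    (ENNReal.ofReal_le_ofReal ?_) hu).trans hU) hτ.le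
  linarith

variable {p σ γ ψ δ a b c d e f g h : ℝ} {Q : E n → Matrix (Fin n) (Fin n) ℝ} {Ω D : Set (E n)}
  {A : E n → ℝ → E n → E n} {B : E n → ℝ → E n → ℝ} {u : E n → ℝ} {v : E n → E n}

/-- The bound for the `L^{σ'(1+ε)}` norm of the potential in terms of `U = ‖u‖_θ`. -/
def potentialBound (K p γ ψ δ c d h U : ℝ) : ℝ :=
  h * U ^ (γ - p) + d * U ^ (δ - p) + c ^ (p / (p + 1 - ψ)) *
    (2 ^ (p * (ψ - p) / (p + 1 - ψ)) *
      (U ^ (p * (ψ - p) / (p + 1 - ψ)) + K ^ (p * (ψ - p) / (p + 1 - ψ))))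

/-- The three powers of u in the potential, each multiplied by k, stay below θ. The power of ū is
first split by ū ≤ |u| + K ≤ 2 max(|u|,K), and this is how K enters the final constant. -/
lemma eLpNorm_potential_le {α : Type*} [MeasurableSpace α] {μ : Measure α}
    [IsProbabilityMeasure μ] {u : α → ℝ} (hu : AEStronglyMeasurable u μ) {k θ U K : ℝ}
    (hp : 1 < p) (hpγ : p < γ) (hpψ : p < ψ) (hψ : ψ < p + 1) (hpδ : p < δ) (hk : 1 ≤ k)
    (hγk : (γ - p) * k ≤ θ) (hδk : (δ - p) * k ≤ θ)
    (hψk : p * (ψ - p) / (p + 1 - ψ) * k ≤ θ) (hK : 0 < K) (hc : 0 ≤ c) (hd : 0 ≤ d) (hh : 0 ≤ h)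
    (hU0 : 0 ≤ U) (hU : eLpNorm u (ENNReal.ofReal θ) μ ≤ ENNReal.ofReal U) :
    eLpNorm (fun x => potential K p γ ψ δ c d h (u x)) (ENNReal.ofReal k) μ ≤
      ENNReal.ofReal (potentialBound K p γ ψ δ c d h U) := by
  have hk0 : 0 < k := by linarith
  have hk1 : 1 ≤ ENNReal.ofReal k := by simpa using hk
  set α' := p * (ψ - p) / (p + 1 - ψ) with hα
  have hα0 : 0 < α' := div_pos (mul_pos (by linarith) (by linarith)) (by linarith)
  set c' := c ^ (p / (p + 1 - ψ)) with hc'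
  have hc'0 : 0 ≤ c' := Real.rpow_nonneg hc _
  have hum := hu.aemeasurable
  have hpow : ∀ τ : ℝ, AEStronglyMeasurable (fun x => |u x| ^ τ) μ := fun τ =>
    (hum.norm.pow_const τ).aestronglyMeasurable
  have hcm : ∀ {m F τ : ℝ}, 0 ≤ m → 0 ≤ F →
      eLpNorm (fun x => |u x| ^ τ) (ENNReal.ofReal k) μ ≤ ENNReal.ofReal F →
      eLpNorm (fun x => m * |u x| ^ τ) (ENNReal.ofReal k) μ ≤ ENNReal.ofReal (m * F) := by
    intro m F τ hm hF hle
    have := eLpNorm_const_smul m (fun x => |u x| ^ τ) (ENNReal.ofReal k) μ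
    rw [ENNReal.ofReal_mul hm, ← Real.enorm_eq_ofReal hm]
    refine le_trans (le_of_eq ?_) (mul_le_mul' le_rfl hle)
    rw [← this]
    rfl
  have hUp : ∀ τ : ℝ, 0 ≤ U ^ τ := fun τ => Real.rpow_nonneg hU0 τ
  have h1 := hcm hh (hUp _) (eLpNorm_abs_rpow_le hu (by linarith) hk0 hγk hU0 hU)
  have h2 := hcm hd (hUp _) (eLpNorm_abs_rpow_le hu (by linarith) hk0 hδk hU0 hU)
  have h3 := hcm (m := c' * 2 ^ α') (by positivity) (hUp _)
    (eLpNorm_abs_rpow_le hu hα0 hk0 hψk hU0 hU)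
  have h4 : eLpNorm (fun _ : α => c' * 2 ^ α' * K ^ α') (ENNReal.ofReal k) μ ≤
      ENNReal.ofReal (c' * 2 ^ α' * K ^ α') := by
    rw [eLpNorm_const _ (by simpa using hk0) (IsProbabilityMeasure.ne_zero μ),
      Real.enorm_eq_ofReal (by positivity)]
    simp
  have hsplit : ∀ x, ‖potential K p γ ψ δ c d h (u x)‖ ≤
      (h * |u x| ^ (γ - p) + d * |u x| ^ (δ - p)) +
        (c' * 2 ^ α' * |u x| ^ α' + c' * 2 ^ α' * K ^ α') := fun x => by
    rw [Real.norm_of_nonneg (potential_nonneg hK hc hd hh _)]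
    have hm : ubar K (u x) ^ α' ≤ 2 ^ α' * (|u x| ^ α' + K ^ α') := by
      have hmax : 0 ≤ max |u x| K := le_max_of_le_right hK.le
      calc ubar K (u x) ^ α' ≤ (2 * max |u x| K) ^ α' := by
            refine Real.rpow_le_rpow (ubar_pos hK _).le ((ubar_le hK _).trans ?_) hα0.le
            linarith [le_max_left |u x| K, le_max_right |u x| K]
        _ = 2 ^ α' * max |u x| K ^ α' := Real.mul_rpow (by norm_num) hmax
        _ ≤ _ := by
            refine mul_le_mul_of_nonneg_left ?_ (by positivity)
            have h5 : 0 ≤ |u x| ^ α' := by positivity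
            have h6 : 0 ≤ K ^ α' := by positivity
            rcases max_choice |u x| K with h | h <;> rw [h] <;> linarith
    have := mul_le_mul_of_nonneg_left hm hc'0
    unfold potential
    linarith
  refine (eLpNorm_le_add_of_ae_le hk1 (((hpow _).const_mul h).add ((hpow _).const_mul d))
    (((hpow _).const_mul _).add aestronglyMeasurable_const) (.of_forall hsplit)).trans ?_
  refine (add_le_add (eLpNorm_add_le ((hpow _).const_mul h) ((hpow _).const_mul d) hk1)
    (eLpNorm_add_le ((hpow _).const_mul _) aestronglyMeasurable_const hk1)).trans ?_
  refine (add_le_add (add_le_add h1 h2) (add_le_add h3 h4)).trans (le_of_eq ?_)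
  have := hUp (γ - p)
  have := hUp (δ - p)
  have := hUp α'
  rw [← ENNReal.ofReal_add (by positivity) (by positivity),
    ← ENNReal.ofReal_add (by positivity) (by positivity),
    ← ENNReal.ofReal_add (by positivity) (by positivity)]
  congr 1
  unfold potentialBound
  ring

/-- The normalized measure on `D`. -/
abbrev avgMeasure (D : Set (E n)) : Measure (E n) := (volume D)⁻¹ • volume.restrict D

lemma isProbabilityMeasure_avgMeasure (h0 : volume D ≠ 0) (hfin : volume D ≠ ∞) :
    IsProbabilityMeasure (avgMeasure D) := ⟨by
  simp [ENNReal.inv_mul_cancel h0 hfin]⟩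

lemma avgMeasure_absolutelyContinuous : avgMeasure D ≪ volume.restrict D :=
  Measure.smul_absolutelyContinuous

/-- `moser_step` over the normalized measure, with κ = σ'(1+ε), lam = 1/(1+ε) and s₂ = p'σ'. The
truncation height l appears only on the left, so it can later tend to infinity. -/
theorem IsWeakSolution.avgNorm_step_le (hsol : IsWeakSolution Ω p Q A B u v) (hp : 1 < p)
    (hσ : 1 < σ) (hpγ : p < γ) (hγ : γ < σ * (p - 1) + 1) (hpψ : p < ψ)
    (hψ : ψ < p + 1 - σ⁻¹) (hpδ : p < δ) (hδ : δ < p * σ) (hQ : IsWeight Ω p Q) (hΩ : IsOpen Ω)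
    (hDm : NullMeasurableSet D volume) (hD : D ⊆ Ω) (hD0 : volume D ≠ 0) (hDfin : volume D < ∞)
    {C : ℝ≥0∞} (hCt : C ≠ ∞)
    (hS : ∀ (w : E n → ℝ) (g : E n → E n), MemWZero p Q D w g →
      eLpNorm w (ENNReal.ofReal (p * σ)) (volume.restrict D) ≤ C * wNorm p Q D w g)
    (hu : MemLp u (ENNReal.ofReal (p * σ)) (volume.restrict D)) {t t' : ℝ≥0∞}
    (htt : ENNReal.HolderConjugate t t') {c' : ℝ}
    (hgain : ∀ f ∈ LipLoc Ω, eLpNorm f (ENNReal.ofReal p * t') (volume.restrict D) ≤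
      ENNReal.ofReal c' * wNorm p Q Ω f (gradient f))
    (ha : 1 < a) (hb : 0 ≤ b) (hc : 0 ≤ c) (hd : 0 ≤ d) (hg : 0 ≤ g) (hh : 0 ≤ h)
    (hstr : StructuralBounds D Q p γ ψ δ a b c d e f g h A B)
    {r K : ℝ} (hr : 0 < r) (hr1 : r ≤ 1) (hK : 0 < K)
    (heK : e ≤ (K / r) ^ (p - 1)) (hfK : f ≤ K ^ (p - 1) * r ^ (-p)) (hgK : g ≤ (K / r) ^ p)
    {CS : ℝ} (hCS : 1 ≤ CS)
    (hSav : ∀ (w : E n → ℝ) (g : E n → E n), MemWZero p Q D w g →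
      avgNorm w (ENNReal.ofReal (p * σ)) D ≤ ENNReal.ofReal CS * (ENNReal.ofReal r *
        avgNorm (fun x => sqrtQ Q x (g x)) (ENNReal.ofReal p) D + avgNorm w (ENNReal.ofReal p) D))
    {ε U : ℝ} (hε : 0 < ε) (hεp : 1 + ε ≤ p.conjExponent) (hU0 : 0 ≤ U)
    (hU : avgNorm u (ENNReal.ofReal (theta p σ γ ψ δ ε)) D ≤ ENNReal.ofReal U)
    {s A' : ℝ} {s' : ℝ≥0∞} (hs : 1 ≤ s) (hss : ENNReal.HolderConjugate (ENNReal.ofReal s) s')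
    (hA' : 1 ≤ A') {η : E n → ℝ} (hη : η ∈ LipZero D) (hη1 : ∀ x, η x ∈ Icc (0 : ℝ) 1)
    (hηt : eLpNorm (fun x => sqrtQ Q x (gradient η x)) (t * ENNReal.ofReal p)
      (volume.restrict D) < ∞)
    (hηs : avgNorm (fun x => sqrtQ Q x (gradient η x)) (s' * ENNReal.ofReal p) D ≤
      ENNReal.ofReal (A' / r)) {S : Set (E n)} (hSm : MeasurableSet S) (hηS : tsupport η ⊆ S)
    {l q : ℝ} (hl : 0 < l) (hq : 1 ≤ q) :
    avgNorm (fun x => η x * truncPow K l q (u x)) (ENNReal.ofReal (p * σ)) D ≤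
      ENNReal.ofReal ((6 * ((2 * CS * q * A') ^ p * (1 + 2 * a * (energyConst p ψ a * q)))) ^
          (1 + (1 + ε) / (p * ε)) *
        (1 + b * U ^ (γ - p) +
          potentialBound K p γ ψ δ c d h U ^ ((1 + ε) / (p * ε)))) *
      avgNorm (S.indicator fun x => ubar K (u x) ^ q) (ENNReal.ofReal (p * s)) D := by
  have hp0 : 0 < p := by linarith
  have hs0 : 0 < s := by linarith
  have hσ0 : 0 < σ := by linarith
  have hσi : σ⁻¹ < 1 := inv_lt_one_of_one_lt₀ hσ
  have hσi0 : 0 < σ⁻¹ := by positivity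
  have hpi : p⁻¹ < 1 := inv_lt_one_of_one_lt₀ hp
  have hψ1 : 0 < p + 1 - ψ := by linarith
  have hpσ : 0 < p * σ := by positivity
  have hprob := isProbabilityMeasure_avgMeasure hD0 hDfin.ne
  have hac : avgMeasure D ≪ volume.restrict D := avgMeasure_absolutelyContinuous
  set μ := avgMeasure D with hμ
  have hpc : p.conjExponent⁻¹ = 1 - p⁻¹ := by
    rw [Real.conjExponent, inv_div, sub_div, div_self hp0.ne', one_div]
  have hσc : σ.conjExponent⁻¹ = 1 - σ⁻¹ := by
    rw [Real.conjExponent, inv_div, sub_div, div_self hσ0.ne', one_div]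
  have hpc1 : 1 ≤ p.conjExponent := by linarith
  have hσc1 : 1 < σ.conjExponent := by
    rw [Real.conjExponent, lt_div_iff₀ (by linarith)]; linarith
  set k := σ.conjExponent * (1 + ε) with hk
  have hk1 : 1 ≤ k := by rw [hk]; nlinarith
  have hθγ : (γ - p) * (p.conjExponent * σ.conjExponent) ≤ theta p σ γ ψ δ ε :=
    le_trans (by rw [mul_assoc]) ((le_max_left _ _).trans (le_max_left _ _))
  have hθψ : p * (ψ - p) / (p + 1 - ψ) * k ≤ theta p σ γ ψ δ ε :=
    le_trans (le_of_eq (by rw [hk]; ring)) ((le_max_right _ _).trans (le_max_left _ _))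
  have hθδ : (δ - p) * k ≤ theta p σ γ ψ δ ε :=
    le_trans (le_of_eq (by rw [hk]; ring)) (le_max_right _ _)
  -- The h-term needs order (γ-p)σ'(1+ε), which the first entry of θ covers because 1+ε ≤ p'.
  have hθγ' : (γ - p) * k ≤ theta p σ γ ψ δ ε := by
    refine le_trans (mul_le_mul_of_nonneg_left ?_ (by linarith)) hθγ
    rw [hk, mul_comm]
    exact mul_le_mul_of_nonneg_right hεp (by linarith)
  -- measurability
  have hum : AEMeasurable u (volume.restrict D) := hu.1.aemeasurable
  have hum' : AEMeasurable u μ := hum.mono_ac hac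
  have hηm : Measurable η := by
    obtain ⟨⟨C, hC⟩, -⟩ := hη
    exact hC.continuous.measurable
  have hGm : AEMeasurable (fun x => ‖sqrtQ Q x (gradient η x)‖) μ :=
    (hQ.aestronglyMeasurable_norm_sqrtQ hDm hD
      (measurable_gradient η).aestronglyMeasurable).aemeasurable.mono_ac hac
  have hXm : AEMeasurable (fun x => ‖sqrtQ Q x (v x)‖) μ :=
    (hQ.aestronglyMeasurable_norm_sqrtQ hDm hD
      (hsol.1.2.1.mono_measure (Measure.restrict_mono hD le_rfl))).aemeasurable.mono_ac hac
  have hPm : AEMeasurable (fun x => truncPow K l q (u x)) μ :=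
    (continuous_truncPow hK hl q).measurable.comp_aemeasurable hum'
  have hhm : AEMeasurable (fun x => trunc K l (u x) ^ (q - 1)) μ :=
    (continuous_trunc_rpow hK hl (q - 1)).measurable.comp_aemeasurable hum'
  have hVm : AEMeasurable (fun x => potential K p γ ψ δ c d h (u x)) μ :=
    (measurable_potential K p γ ψ δ c d h).comp_aemeasurable hum'
  -- nonnegativity
  have hP0 : ∀ x, 0 < truncPow K l q (u x) := fun x => truncPow_pos hK hl q _
  have hT0 : ∀ x, 0 < trunc K l (u x) ^ (q - 1) := fun x =>
    Real.rpow_pos_of_pos (trunc_pos hK hl _) _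
  set f₁ : E n → ℝ := fun x => η x * truncPow K l q (u x) with hf₁
  set f₂ : E n → ℝ := fun x => ‖sqrtQ Q x (gradient η x)‖ * truncPow K l q (u x) with hf₂
  set fm : E n → ℝ := fun x => η x * trunc K l (u x) ^ (q - 1) * ‖sqrtQ Q x (v x)‖ with hfm
  have hf₁0 : ∀ x, 0 ≤ f₁ x := fun x => mul_nonneg (hη1 x).1 (hP0 x).le
  have hf₂0 : ∀ x, 0 ≤ f₂ x := fun x => mul_nonneg (norm_nonneg _) (hP0 x).le
  have hfm0 : ∀ x, 0 ≤ fm x := fun x => mul_nonneg (mul_nonneg (hη1 x).1 (hT0 x).le)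
    (norm_nonneg _)
  have hf₁m : AEMeasurable f₁ μ := hηm.aemeasurable.mul hPm
  have hf₂m : AEMeasurable f₂ μ := hGm.mul hPm
  have hfmm : AEMeasurable fm μ := (hηm.aemeasurable.mul hhm).mul hXm
  set Y := avgNorm (S.indicator fun x => ubar K (u x) ^ q) (ENNReal.ofReal (p * s)) D with hY
  have hY' : Y = eLpNorm (S.indicator fun x => ubar K (u x) ^ q) (ENNReal.ofReal (p * s)) μ := rfl
  -- the test function
  have hw := memWZero_mul_comp hp hΩ hQ hDm hD hDfin hη
    (fun x => abs_le.2 ⟨by linarith [(hη1 x).1], (hη1 x).2⟩) htt hηt hgain hsol.1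
    (fun z => hasDerivAt_truncPow hK hl q z) (continuous_truncPowDeriv hK hl q)
    (M := q * l ^ (q - 1)) (fun z => (abs_truncPowDeriv_le hK hl hq z).trans
      (mul_le_mul_of_nonneg_left (trunc_rpow_le hK hl (by linarith) z) (by linarith)))
  have henergy := hsol.energy_le hp hσ hpγ hγ hpψ hψ hpδ hδ hQ hΩ hDm hD hDfin hCt hS hu htt
    hgain ha hb hc hd hg hh hstr hr hK hl hq heK hfK hgK hη hη1 hηt
  have hW := energyConst_pos (ψ := ψ) hp ha
  have hlam : (1 + ε)⁻¹ < 1 := inv_lt_one_of_one_lt₀ (by linarith)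
  -- With lam = 1/(1+ε), this is the exponent of the potential after absorption.
  have hexp : 1 / (p * (1 - (1 + ε)⁻¹)) = (1 + ε) / (p * ε) := by
    rw [show 1 - (1 + ε)⁻¹ = ε / (1 + ε) by field_simp; ring]
    field_simp
  rw [← hexp]
  change eLpNorm f₁ _ μ ≤ _
  rw [← rpow_lintegral_ofReal hpσ hf₁0]
  refine moser_step (κ := k) (lam := (1 + ε)⁻¹) (s₂ := p.conjExponent * σ.conjExponent)
    (r := r) (b := b) hp hσ (by positivity) hlam (by linarith)
    (by rw [hk, mul_inv, hσc, mul_comm]) (by positivity) (by rw [mul_inv, hpc, hσc]) hr hr1 hCS hq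
    hA' (by have : 0 < 2 * a * (energyConst p ψ a * q) := by positivity
            linarith) (by positivity)
    (by unfold potentialBound; positivity)
    (e₂ := fun x => ENNReal.ofReal (f₂ x)) (m := fun x => ENNReal.ofReal (fm x))
    (S := fun x => ENNReal.ofReal (|u x| ^ (γ - p)))
    (V := fun x => ENNReal.ofReal (potential K p γ ψ δ c d h (u x)))
    hf₁m.ennreal_ofReal hf₂m.ennreal_ofReal hfmm.ennreal_ofReal
    (hum'.norm.pow_const (γ - p)).ennreal_ofReal hVm.ennreal_ofReal ?_ ?_ ?_ ?_ ?_ ?_ ?_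
  · rw [hμ, lintegral_smul_measure, lintegral_smul_measure, smul_eq_mul, smul_eq_mul,
      mul_left_comm]
    refine mul_le_mul' le_rfl (henergy.trans (mul_le_mul' (ENNReal.ofReal_le_ofReal ?_) le_rfl))
    linarith
  · have h1 := hSav _ _ hw
    refine (le_of_eq (rpow_lintegral_ofReal hpσ hf₁0)).trans (h1.trans ?_)
    rw [rpow_lintegral_ofReal hp0 hf₁0]
    refine mul_le_mul' le_rfl (add_le_add (mul_le_mul' le_rfl ?_) le_rfl)
    have h2 : ∀ x, ENNReal.ofReal (f₂ x) + ENNReal.ofReal q * ENNReal.ofReal (fm x) =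
        ENNReal.ofReal (f₂ x + q * fm x) := fun x => by
      rw [ENNReal.ofReal_add (hf₂0 x) (mul_nonneg (by linarith) (hfm0 x)),
        ENNReal.ofReal_mul (p := q) (q := fm x) (by linarith)]
    simp only [h2]
    rw [rpow_lintegral_ofReal hp0 fun x => by
      have := hf₂0 x
      have := hfm0 x
      positivity]
    refine eLpNorm_mono fun x => ?_
    have := hf₂0 x
    have := hfm0 x
    rw [Real.norm_of_nonneg (by positivity : 0 ≤ f₂ x + q * fm x), sqrtQ_add, sqrtQ_smul,
      sqrtQ_smul]
    refine (norm_add_le _ _).trans (add_le_add ?_ ?_)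
    · rw [norm_smul, Real.norm_of_nonneg (hP0 x).le, mul_comm]
    · rw [norm_smul, norm_mul, Real.norm_of_nonneg (hη1 x).1, Real.norm_eq_abs, hfm]
      have h3 := mul_le_mul_of_nonneg_left (abs_truncPowDeriv_le hK hl hq (u x)) (hη1 x).1
      have h4 := mul_le_mul_of_nonneg_right h3 (norm_nonneg (sqrtQ Q x (v x)))
      refine h4.trans (le_of_eq ?_)
      ring
  · rw [rpow_lintegral_ofReal hpσ hf₁0]
    -- A priori finiteness of the norm to be absorbed: for fixed l the truncated function belongs to
    -- the zero-boundary space, so the Sobolev inequality bounds it.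
    have h1 := (hS _ _ hw).trans_lt
      (ENNReal.mul_lt_top hCt.lt_top (hw.wNorm_lt_top hp.le hQ hΩ hDm hD))
    rw [hμ]
    refine (eLpNorm_smul_measure_of_ne_top ENNReal.ofReal_ne_top _ _).trans_ne ?_
    rw [smul_eq_mul]
    exact ENNReal.mul_ne_top (ENNReal.rpow_ne_top_of_nonneg (by positivity)
      (ENNReal.inv_ne_top.2 hD0)) h1.ne
  · rw [rpow_lintegral_ofReal hp0 hf₂0]
    -- The gradient of η vanishes off `tsupport η`, so the indicator of S can be inserted for free.
    -- Hölder's inequality with 1/(s'p) + 1/(sp) = 1/p then separates √Q∇η from the power of ū.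
    have h1 : eLpNorm f₂ (ENNReal.ofReal p) μ =
        eLpNorm (fun x => ‖sqrtQ Q x (gradient η x)‖ *
          S.indicator (fun x => truncPow K l q (u x)) x) (ENNReal.ofReal p) μ := by
      congr 1
      funext x
      by_cases hx : x ∈ S
      · rw [Set.indicator_of_mem hx]
      · have : gradient η x = 0 := gradient_eq_zero_of_notMem_tsupport fun h => hx (hηS h)
        rw [Set.indicator_of_notMem hx, hf₂]
        simp [this, sqrtQ_zero]
    have h2 : (s' * ENNReal.ofReal p)⁻¹ + (ENNReal.ofReal (p * s))⁻¹ = (ENNReal.ofReal p)⁻¹ := by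
      rw [ENNReal.ofReal_mul hp0.le]
      exact inv_mul_add_inv_mul_of_holderConjugate hss.symm hp0
    rw [h1]
    have h3 := eLpNorm_mul_le_of_holder h2 hGm.aestronglyMeasurable
      (hPm.indicator hSm).aestronglyMeasurable
    rw [eLpNorm_norm] at h3
    have h4 : eLpNorm (S.indicator fun x => truncPow K l q (u x)) (ENNReal.ofReal (p * s)) μ ≤ Y := by
      rw [hY']
      refine eLpNorm_mono fun x => ?_
      by_cases hx : x ∈ S
      · rw [Set.indicator_of_mem hx, Set.indicator_of_mem hx, Real.norm_of_nonneg (hP0 x).le]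
        exact (truncPow_le hK hl hq _).trans (Real.le_norm_self _)
      · rw [Set.indicator_of_notMem hx, Set.indicator_of_notMem hx]
    refine (mul_le_mul' le_rfl (h3.trans (mul_le_mul' hηs h4))).trans (le_of_eq ?_)
    rw [← mul_assoc, ← ENNReal.ofReal_mul hr.le, mul_div_cancel₀ _ hr.ne']
  · rw [rpow_lintegral_ofReal hp0 hf₁0, hY']
    refine (eLpNorm_le_eLpNorm_of_exponent_le (ENNReal.ofReal_le_ofReal
      (by nlinarith : p ≤ p * s)) hf₁m.aestronglyMeasurable).trans (eLpNorm_mono fun x => ?_)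
    by_cases hx : x ∈ S
    · rw [Set.indicator_of_mem hx, Real.norm_of_nonneg (hf₁0 x)]
      refine (mul_le_of_le_one_left (hP0 x).le (hη1 x).2).trans
        ((truncPow_le hK hl hq _).trans (Real.le_norm_self _))
    · have : η x = 0 := image_eq_zero_of_notMem_tsupport fun h => hx (hηS h)
      rw [Set.indicator_of_notMem hx, hf₁]
      simp [this]
  · rw [rpow_lintegral_ofReal (by positivity) fun x => by positivity, ENNReal.ofReal_mul hb]
    exact mul_le_mul' le_rfl (eLpNorm_abs_rpow_le hum'.aestronglyMeasurable (by linarith)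
      (by positivity) hθγ hU0 hU)
  · rw [rpow_lintegral_ofReal (by linarith) fun x => potential_nonneg hK hc hd hh _]
    exact eLpNorm_potential_le hum'.aestronglyMeasurable hp hpγ hpψ (by linarith) hpδ hk1 hθγ' hθδ
      hθψ hK hc hd hh hU0 hU

end Step

/-! ### The iteration -/

section Iteration

variable {α : Type*} [MeasurableSpace α] {μ : Measure α}

lemma eLpNorm_le_of_tendsto {q : ℝ≥0∞} {f : ℕ → α → ℝ} {g : α → ℝ} {M : ℝ≥0∞}
    (hf : ∀ k, AEStronglyMeasurable (f k) μ)
    (hlim : ∀ᵐ x ∂μ, Tendsto (fun k => f k x) atTop (𝓝 (g x)))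
    (hM : ∀ k, eLpNorm (f k) q μ ≤ M) : eLpNorm g q μ ≤ M :=
  (Lp.eLpNorm_lim_le_liminf_eLpNorm hf g hlim).trans
    (liminf_le_of_le (by isBoundedDefault) fun b hb => by
      obtain ⟨k, hk⟩ := hb.exists
      exact hk.trans (hM k))

/-- By Chebyshev, the set where |w| ≥ b' with b' > m has measure at most (m/b')^{P j}, which tends
to 0. -/
lemma eLpNorm_top_le_of_forall {ν : Measure α} [IsFiniteMeasure ν] {w : α → ℝ}
    (hw : AEStronglyMeasurable w ν) {P : ℕ → ℝ} (hP0 : ∀ j, 0 < P j)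
    (hP : Tendsto P atTop atTop) {m : ℝ≥0∞}
    (hm : ∀ j, eLpNorm w (ENNReal.ofReal (P j)) ν ≤ m) : eLpNorm w ∞ ν ≤ m := by
  rw [eLpNorm_exponent_top]
  refine eLpNormEssSup_le_of_ae_enorm_bound ?_
  rw [ae_le_const_iff_forall_gt_measure_zero]
  intro b hb
  obtain ⟨b', hmb, hbb⟩ := exists_between hb
  refine measure_mono_null (t := {x | b' ≤ ‖w x‖ₑ}) (fun x hx => hbb.le.trans hx) ?_
  have hb0 : b' ≠ 0 := (bot_le.trans_lt hmb).ne'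
  have hbt : b' ≠ ∞ := (hbb.trans_le le_top).ne
  have hlt : m / b' < 1 := (ENNReal.div_lt_iff (Or.inl hb0) (Or.inl hbt)).2 (by rwa [one_mul])
  have hle : ∀ j, ν {x | b' ≤ ‖w x‖ₑ} ≤ (m / b') ^ P j := fun j => by
    have h1 := mul_meas_ge_le_pow_eLpNorm' ν (by simpa using hP0 j : ENNReal.ofReal (P j) ≠ 0)
      ENNReal.ofReal_ne_top hw b'
    rw [ENNReal.toReal_ofReal (hP0 j).le] at h1
    have h2 := h1.trans (ENNReal.rpow_le_rpow (hm j) (hP0 j).le)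
    rw [ENNReal.div_rpow_of_nonneg _ _ (hP0 j).le, ENNReal.le_div_iff_mul_le
      (Or.inl (ENNReal.rpow_pos (pos_iff_ne_zero.2 hb0) hbt).ne') (Or.inl
      (ENNReal.rpow_ne_top_of_nonneg (hP0 j).le hbt)), mul_comm]
    exact h2
  have hlim := (ENNReal.tendsto_rpow_atTop_of_base_lt_one hlt).comp hP
  exact le_antisymm (ge_of_tendsto' hlim hle) bot_le

/-- The accumulated factor is a to the power Σ χ^{-i} times b to the power Σ i χ^{-i}. Both series
converge, so geometric growth of the step constants is harmless. -/
lemma le_of_iterate {M : ℕ → ℝ≥0∞} {χ a b : ℝ} (hχ : 1 < χ) (ha : 1 ≤ a) (hb : 1 ≤ b)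
    (hM : ∀ j, M (j + 1) ≤ ENNReal.ofReal ((a * b ^ j) ^ ((χ⁻¹) ^ j)) * M j) (j : ℕ) :
    M j ≤ ENNReal.ofReal (a ^ (1 - χ⁻¹)⁻¹ * b ^ (∑' i : ℕ, (i : ℝ) * (χ⁻¹) ^ i)) * M 0 := by
  have hx0 : 0 ≤ χ⁻¹ := by positivity
  have hx1 : χ⁻¹ < 1 := inv_lt_one_of_one_lt₀ hχ
  have ha0 : 0 < a := by linarith
  have hb0 : 0 < b := by linarith
  have hfin : ∀ j, M j ≤ ENNReal.ofReal (a ^ (∑ i ∈ Finset.range j, (χ⁻¹) ^ i) *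
      b ^ (∑ i ∈ Finset.range j, (i : ℝ) * (χ⁻¹) ^ i)) * M 0 := by
    intro j
    induction j with
    | zero => simp
    | succ j ih =>
      refine (hM j).trans ((mul_le_mul' le_rfl ih).trans (le_of_eq ?_))
      rw [← mul_assoc, ← ENNReal.ofReal_mul (by positivity), Finset.sum_range_succ,
        Finset.sum_range_succ, Real.rpow_add ha0, Real.rpow_add hb0,
        Real.mul_rpow ha0.le (by positivity), ← Real.rpow_natCast b j, ← Real.rpow_mul hb0.le]
      congr 2
      ring
  refine (hfin j).trans (mul_le_mul' (ENNReal.ofReal_le_ofReal (mul_le_mul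
    (Real.rpow_le_rpow_of_exponent_le ha ?_) (Real.rpow_le_rpow_of_exponent_le hb ?_)
    (by positivity) (by positivity))) le_rfl)
  · rw [← tsum_geometric_of_lt_one hx0 hx1]
    exact (summable_geometric_of_lt_one hx0 hx1).sum_le_tsum _ fun i _ => by positivity
  · have h := summable_pow_mul_geometric_of_norm_lt_one 1
      (by rwa [Real.norm_of_nonneg hx0] : ‖χ⁻¹‖ < 1)
    simp only [pow_one] at h
    exact h.sum_le_tsum _ fun i _ => by positivity

/-- Moser iteration along a decreasing sequence of sets. -/
theorem eLpNorm_top_le_of_moser [IsFiniteMeasure μ] {w : α → ℝ} (hw : AEStronglyMeasurable w μ)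
    (hw0 : ∀ x, 0 ≤ w x) {P χ a b : ℝ} (hP : 0 < P) (hχ : 1 < χ) (ha : 1 ≤ a) (hb : 1 ≤ b)
    {S : ℕ → Set α} (hSm : ∀ j, MeasurableSet (S j)) {T : Set α} (hT : ∀ j, T ⊆ S j)
    (hstep : ∀ j, eLpNorm ((S (j + 1)).indicator fun x => w x ^ χ ^ j) (ENNReal.ofReal (P * χ)) μ ≤
      ENNReal.ofReal (a * b ^ j) *
        eLpNorm ((S j).indicator fun x => w x ^ χ ^ j) (ENNReal.ofReal P) μ) :
    eLpNorm w ∞ (μ.restrict T) ≤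
      ENNReal.ofReal (a ^ (1 - χ⁻¹)⁻¹ * b ^ (∑' i : ℕ, (i : ℝ) * (χ⁻¹) ^ i)) *
        eLpNorm w (ENNReal.ofReal P) μ := by
  have hχ0 : 0 < χ := by linarith
  -- A norm of w^{χ^j} is a power of a norm of w of higher order; the χ^{-j}-th root of each step
  -- links the orders Pχ^j and Pχ^{j+1}.
  have hpow : ∀ (j : ℕ) (q : ℝ) (ν : Measure α), 0 < q →
      eLpNorm (fun x => w x ^ χ ^ j) (ENNReal.ofReal q) ν =
        eLpNorm w (ENNReal.ofReal (q * χ ^ j)) ν ^ χ ^ j := fun j q ν hq => by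
    rw [ENNReal.ofReal_mul hq.le, ← eLpNorm_norm_rpow w (by positivity)]
    simp only [Real.norm_of_nonneg (hw0 _)]
  have hiter := le_of_iterate (M := fun j => eLpNorm w (ENNReal.ofReal (P * χ ^ j))
    (μ.restrict (S j))) hχ ha hb fun j => by
      have hj : 0 < χ ^ j := by positivity
      have h1 := hstep j
      rw [eLpNorm_indicator_eq_eLpNorm_restrict (hSm _),
        eLpNorm_indicator_eq_eLpNorm_restrict (hSm _), hpow _ _ _ (by positivity),
        hpow _ _ _ hP, mul_assoc, ← pow_succ'] at h1
      have h2 := ENNReal.rpow_le_rpow h1 (inv_nonneg.2 hj.le)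
      rw [ENNReal.mul_rpow_of_nonneg _ _ (by positivity), ← ENNReal.rpow_mul, ← ENNReal.rpow_mul,
        mul_inv_cancel₀ hj.ne', ENNReal.rpow_one, ENNReal.rpow_one,
        ENNReal.ofReal_rpow_of_pos (by positivity)] at h2
      rwa [inv_pow]
  refine eLpNorm_top_le_of_forall (P := fun j => P * χ ^ j)
    (hw.mono_measure Measure.restrict_le_self) (fun j => by positivity)
    ((tendsto_pow_atTop_atTop_of_one_lt hχ).const_mul_atTop hP) fun j => ?_
  refine (eLpNorm_mono_measure _ (Measure.restrict_mono (hT j) le_rfl)).trans ((hiter j).trans ?_)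
  refine mul_le_mul' le_rfl ?_
  simp only [pow_zero, mul_one]
  exact eLpNorm_mono_measure _ Measure.restrict_le_self

end Iteration

/-! ### Local boundedness on a ball -/

section LocalBoundedness

variable {p σ γ ψ δ a b c d e f g h : ℝ} {Q : E n → Matrix (Fin n) (Fin n) ℝ} {Ω : Set (E n)}
  {ρ : E n → E n → ℝ} {A : E n → ℝ → E n → E n} {B : E n → ℝ → E n → ℝ} {u : E n → ℝ}
  {v : E n → E n}

/-- Lets N and C_{s*} be taken at least 1, so that the step constants are at least 1. -/
lemma IsCutoffSequence.mono {τ N Cs N' Cs' r : ℝ} {sStar : ℝ≥0∞} {y : E n} {η : ℕ → E n → ℝ}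
    (h : IsCutoffSequence Ω ρ Q τ N Cs sStar y r η) (hr : 0 < r) (hN0 : 0 < N) (hCs0 : 0 < Cs)
    (hN : N ≤ N') (hCs : Cs ≤ Cs') : IsCutoffSequence Ω ρ Q τ N' Cs' sStar y r η :=
  { h with
    gradient_bound := fun j hj => (h.gradient_bound j hj).trans
      (ENNReal.ofReal_le_ofReal (by have := hCs0.trans_le hCs; gcongr)) }

/-- The factor accumulated in the iteration from the cutoff functions and the exponents. -/
def iterConst (p σ ψ ε a s CS Cs N : ℝ) : ℝ :=
  ((6 * ((2 * CS * Cs * N) ^ p * (1 + 2 * a * energyConst p ψ a))) ^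
      (1 + (1 + ε) / (p * ε))) ^ (1 - (σ / s)⁻¹)⁻¹ *
    ((((σ / s * N) ^ p * (σ / s)) ^ (1 + (1 + ε) / (p * ε))) ^
      (∑' i : ℕ, (i : ℝ) * ((σ / s)⁻¹) ^ i))

/-- At step j the exponent is χ^j and the cutoff constant is C_{s*}N^{j+1}; the step constant
therefore grows at most geometrically in j. -/
lemma stepConst_le {p χ a W CS Cs N ω : ℝ} (hχ : 1 < χ) (ha : 0 ≤ a) (hW : 0 ≤ W)
    (hCS : 1 ≤ CS) (hCs : 1 ≤ Cs) (hN : 1 ≤ N) (hω : 0 ≤ ω) (j : ℕ) :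
    (6 * ((2 * CS * χ ^ j * (Cs * N ^ (j + 1))) ^ p * (1 + 2 * a * (W * χ ^ j)))) ^ ω ≤
      (6 * ((2 * CS * Cs * N) ^ p * (1 + 2 * a * W))) ^ ω *
        (((χ * N) ^ p * χ) ^ ω) ^ j := by
  have hχ0 : 0 < χ := by linarith
  have hCS0 : 0 < CS := by linarith
  have hCs0 : 0 < Cs := by linarith
  have hN0 : 0 < N := by linarith
  have hχj : 1 ≤ χ ^ j := one_le_pow₀ hχ.le
  rw [Real.rpow_pow_comm (by positivity), ← Real.mul_rpow (by positivity) (by positivity)]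
  refine Real.rpow_le_rpow (by positivity) ?_ hω
  have h1 : (2 * CS * χ ^ j * (Cs * N ^ (j + 1))) ^ p =
      (2 * CS * Cs * N) ^ p * ((χ * N) ^ p) ^ j := by
    rw [Real.rpow_pow_comm (by positivity), ← Real.mul_rpow (by positivity) (by positivity)]
    congr 1
    ring
  have h2 : 1 + 2 * a * (W * χ ^ j) ≤ (1 + 2 * a * W) * χ ^ j := by
    nlinarith
  calc _ = 6 * ((2 * CS * Cs * N) ^ p * ((χ * N) ^ p) ^ j * (1 + 2 * a * (W * χ ^ j))) := by
        rw [h1]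
    _ ≤ 6 * ((2 * CS * Cs * N) ^ p * ((χ * N) ^ p) ^ j * ((1 + 2 * a * W) * χ ^ j)) := by
        gcongr
    _ = _ := by ring

/-- Step j uses q = χ^j with χ = σ/s and passes from order ps to order pσ = psχ. Each step
contributes the same factor Z, so the iteration produces Z to the power Σ χ^{-j} = (1 - χ⁻¹)⁻¹. -/
theorem IsWeakSolution.eLpNorm_top_le {y : E n} {r : ℝ} (hsol : IsWeakSolution Ω p Q A B u v)
    (hp : 1 < p) (hσ : 1 < σ) (hpγ : p < γ) (hγ : γ < σ * (p - 1) + 1) (hpψ : p < ψ)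
    (hψ : ψ < p + 1 - σ⁻¹) (hpδ : p < δ) (hδ : δ < p * σ) (hQ : IsWeight Ω p Q) (hΩ : IsOpen Ω)
    (hDm : NullMeasurableSet (qball Ω ρ y r) volume) (hD0 : volume (qball Ω ρ y r) ≠ 0)
    (hDfin : volume (qball Ω ρ y r) < ∞) {C : ℝ≥0∞} (hCt : C ≠ ∞)
    (hS : ∀ (w : E n → ℝ) (g : E n → E n), MemWZero p Q (qball Ω ρ y r) w g →
      eLpNorm w (ENNReal.ofReal (p * σ)) (volume.restrict (qball Ω ρ y r)) ≤
        C * wNorm p Q (qball Ω ρ y r) w g)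
    (hu : MemLp u (ENNReal.ofReal (p * σ)) (volume.restrict (qball Ω ρ y r))) {t t' : ℝ≥0∞}
    (htt : ENNReal.HolderConjugate t t') {c' : ℝ}
    (hgain : ∀ f ∈ LipLoc Ω, eLpNorm f (ENNReal.ofReal p * t')
      (volume.restrict (qball Ω ρ y r)) ≤ ENNReal.ofReal c' * wNorm p Q Ω f (gradient f))
    (ha : 1 < a) (hb : 0 ≤ b) (hc : 0 ≤ c) (hd : 0 ≤ d) (hg : 0 ≤ g) (hh : 0 ≤ h)
    (hstr : StructuralBounds (qball Ω ρ y r) Q p γ ψ δ a b c d e f g h A B)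
    {K : ℝ} (hr : 0 < r) (hr1 : r ≤ 1) (hK : 0 < K)
    (heK : e ≤ (K / r) ^ (p - 1)) (hfK : f ≤ K ^ (p - 1) * r ^ (-p)) (hgK : g ≤ (K / r) ^ p)
    {CS : ℝ} (hCS : 1 ≤ CS)
    (hSav : ∀ (w : E n → ℝ) (g : E n → E n), MemWZero p Q (qball Ω ρ y r) w g →
      avgNorm w (ENNReal.ofReal (p * σ)) (qball Ω ρ y r) ≤ ENNReal.ofReal CS * (ENNReal.ofReal r *
        avgNorm (fun x => sqrtQ Q x (g x)) (ENNReal.ofReal p) (qball Ω ρ y r) +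
          avgNorm w (ENNReal.ofReal p) (qball Ω ρ y r)))
    {ε U : ℝ} (hε : 0 < ε) (hεp : 1 + ε ≤ p.conjExponent) (hU0 : 0 ≤ U)
    (hU : avgNorm u (ENNReal.ofReal (theta p σ γ ψ δ ε)) (qball Ω ρ y r) ≤ ENNReal.ofReal U)
    {s : ℝ} {s' : ℝ≥0∞} (hs : 1 ≤ s) (hsσ : s < σ)
    (hss : ENNReal.HolderConjugate (ENNReal.ofReal s) s')
    {τ N Cs : ℝ} (hτ1 : τ ≤ 1) (hN : 1 ≤ N) (hCs : 1 ≤ Cs) {η : ℕ → E n → ℝ}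
    (hη : IsCutoffSequence Ω ρ Q τ N Cs (s' * ENNReal.ofReal p) y r η)
    (hηt : ∀ j ≥ 1, eLpNorm (fun x => sqrtQ Q x (gradient (η j) x)) (t * ENNReal.ofReal p)
        (volume.restrict (qball Ω ρ y r)) < ∞) :
    eLpNorm u ∞ (volume.restrict (qball Ω ρ y (τ * r))) ≤
      ENNReal.ofReal (iterConst p σ ψ ε a s CS Cs N *
        (1 + b * U ^ (γ - p) + potentialBound K p γ ψ δ c d h U ^ ((1 + ε) / (p * ε))) ^
          (1 - (σ / s)⁻¹)⁻¹) *
      (avgNorm u (ENNReal.ofReal (p * s)) (qball Ω ρ y r) + ENNReal.ofReal K) := by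
  have hp0 : 0 < p := by linarith
  have hs0 : 0 < s := by linarith
  have hχ : 1 < σ / s := by rwa [one_lt_div hs0]
  have hW := energyConst_pos (ψ := ψ) hp ha
  have hψ1 : 0 < p + 1 - ψ := by have : 0 < σ⁻¹ := by positivity
                                 linarith
  set D := qball Ω ρ y r with hDdef
  set χ := σ / s with hχdef
  set ω := 1 + (1 + ε) / (p * ε) with hω
  have hω0 : 0 ≤ ω := by positivity
  set V := potentialBound K p γ ψ δ c d h U with hV
  have hV0 : 0 ≤ V := by rw [hV]; unfold potentialBound; positivity
  set Z := 1 + b * U ^ (γ - p) + V ^ ((1 + ε) / (p * ε)) with hZ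
  have hZ1 : 1 ≤ Z := by
    have h1 : 0 ≤ b * U ^ (γ - p) := by positivity
    have h2 : 0 ≤ V ^ ((1 + ε) / (p * ε)) := by positivity
    linarith
  have hprob := isProbabilityMeasure_avgMeasure hD0 hDfin.ne
  have hum : AEMeasurable u (avgMeasure D) :=
    hu.1.aemeasurable.mono_ac avgMeasure_absolutelyContinuous
  have hwm : AEStronglyMeasurable (fun x => ubar K (u x)) (avgMeasure D) :=
    ((measurable_ubar K).comp_aemeasurable hum).aestronglyMeasurable
  have hηm : ∀ j ≥ 1, Measurable (η j) := fun j hj => by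
    obtain ⟨⟨C, hC⟩, -⟩ := hη.lipZero j hj
    exact hC.continuous.measurable
  -- The cutoffs are numbered from 1, so the iteration starts from the whole space, on which the
  -- averaged measure only sees the ball. Afterwards supp η_{j+1} ⊆ {η_j = 1} chains the steps.
  set S : ℕ → Set (E n) := fun j => if j = 0 then univ else {x | η j x = 1} with hSdef
  have hSm : ∀ j, MeasurableSet (S j) := fun j => by
    rcases Nat.eq_zero_or_pos j with rfl | hj
    · simp [hSdef]
    · simp only [hSdef, if_neg hj.ne']
      exact hηm j hj (measurableSet_singleton 1)
  have hTS : ∀ j, qball Ω ρ y (τ * r) ⊆ S j := fun j => by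
    rcases Nat.eq_zero_or_pos j with rfl | hj
    · simp [hSdef]
    · simp only [hSdef, if_neg hj.ne']
      exact fun x hx => (hη.eq_one j hj hx).2
  have hsupp : ∀ j, tsupport (η (j + 1)) ⊆ S j := fun j => by
    rcases Nat.eq_zero_or_pos j with rfl | hj
    · simp [hSdef]
    · simp only [hSdef, if_neg hj.ne']
      exact fun x hx => (hη.tsupport_succ j hj hx).2
  have hmain := eLpNorm_top_le_of_moser (μ := avgMeasure D) (w := fun x => ubar K (u x))
    (P := p * s) (χ := χ) (S := S) (T := qball Ω ρ y (τ * r))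
    (a := (6 * ((2 * CS * Cs * N) ^ p * (1 + 2 * a * energyConst p ψ a))) ^ ω * Z)
    (b := ((χ * N) ^ p * χ) ^ ω) hwm
    (fun x => (ubar_pos hK _).le) (by positivity) hχ
    (one_le_mul_of_one_le_of_one_le (Real.one_le_rpow (by
      have h1 : 1 ≤ (2 * CS * Cs * N) ^ p := Real.one_le_rpow (by
        have := one_le_mul_of_one_le_of_one_le (one_le_mul_of_one_le_of_one_le hCS hCs) hN
        linarith) hp0.le
      have h2 : 1 ≤ 1 + 2 * a * energyConst p ψ a := by
        have : 0 < 2 * a * energyConst p ψ a := by positivity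
        linarith
      linarith [one_le_mul_of_one_le_of_one_le h1 h2]) hω0) hZ1)
    (Real.one_le_rpow (one_le_mul_of_one_le_of_one_le (Real.one_le_rpow
      (one_le_mul_of_one_le_of_one_le hχ.le hN) hp0.le) hχ.le) hω0)
    hSm hTS fun j => by
      have hq : 1 ≤ χ ^ j := one_le_pow₀ hχ.le
      have hj : 1 ≤ j + 1 := by omega
      have hstep : ∀ k : ℕ, _ := fun k =>
        hsol.avgNorm_step_le hp hσ hpγ hγ hpψ hψ hpδ hδ hQ hΩ hDm (qball_subset y r) hD0 hDfin hCt
          hS hu htt hgain ha hb hc hd hg hh hstr hr hr1 hK heK hfK hgK hCS hSav hε hεp hU0 hU hs hss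
          (A' := Cs * N ^ (j + 1))
          (one_le_mul_of_one_le_of_one_le hCs (one_le_pow₀ hN)) (hη.lipZero _ hj)
          (hη.mem_Icc _ hj) (hηt _ hj) (hη.gradient_bound _ hj) (hSm j) (hsupp j)
          (l := (k : ℝ) + 1) (q := χ ^ j) (by positivity) hq
      have hpχ : p * s * χ = p * σ := by rw [hχdef]; field_simp
      rw [hpχ]
      have hSj : S (j + 1) = {x | η (j + 1) x = 1} := by simp [hSdef]
      -- The truncation height k+1 tends to infinity: the step estimate is uniform in it, and
      -- Fatou's lemma gives the estimate for the full power ū^q.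
      refine eLpNorm_le_of_tendsto (f := fun k : ℕ => (S (j + 1)).indicator fun x =>
        truncPow K (k + 1) (χ ^ j) (u x)) (fun k => ?_) (.of_forall fun x => ?_) fun k => ?_
      · exact (((continuous_truncPow hK (by positivity) _).measurable.comp_aemeasurable
          hum).indicator (hSm _)).aestronglyMeasurable
      · by_cases hx : x ∈ S (j + 1)
        · simp only [Set.indicator_of_mem hx]
          exact tendsto_truncPow hK _ _
        · simp only [Set.indicator_of_notMem hx]
          exact tendsto_const_nhds
      · refine le_trans (eLpNorm_mono fun x => ?_) ((hstep k).trans (mul_le_mul'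
          (ENNReal.ofReal_le_ofReal ?_) le_rfl))
        · by_cases hx : x ∈ S (j + 1)
          · rw [Set.indicator_of_mem hx]
            rw [hSj] at hx
            rw [hx, one_mul]
          · rw [Set.indicator_of_notMem hx, norm_zero]
            exact norm_nonneg _
        · exact (mul_le_mul_of_nonneg_right (stepConst_le hχ (by linarith) hW.le hCS hCs hN hω0 j)
            (by linarith)).trans (le_of_eq (mul_right_comm _ _ _))
  have hT : qball Ω ρ y (τ * r) ⊆ D := qball_mono y (by nlinarith)
  have hμT : (avgMeasure D).restrict (qball Ω ρ y (τ * r)) =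
      (volume D)⁻¹ • volume.restrict (qball Ω ρ y (τ * r)) := by
    rw [avgMeasure, Measure.restrict_smul, Measure.restrict_restrict_of_subset hT]
  -- An essential supremum is unaffected by the normalizing factor, which is nonzero because the
  -- ball has finite measure.
  rw [hμT, eLpNorm_exponent_top, eLpNormEssSup_ennreal_smul_measure (ENNReal.inv_ne_zero.2 hDfin.ne),
    ← eLpNorm_exponent_top] at hmain
  have hps : 1 ≤ ENNReal.ofReal (p * s) := by
    simpa using one_le_mul_of_one_le_of_one_le hp.le hs
  have hps0 : ENNReal.ofReal (p * s) ≠ 0 := (one_pos.trans_le hps).ne'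
  have hw1 : eLpNorm (fun x => ubar K (u x)) (ENNReal.ofReal (p * s)) (avgMeasure D) ≤
      avgNorm u (ENNReal.ofReal (p * s)) D + ENNReal.ofReal K := by
    refine (eLpNorm_le_add_of_ae_le hps (g := fun x => ‖u x‖) (h := fun _ => K)
      hum.aestronglyMeasurable.norm aestronglyMeasurable_const (.of_forall fun x => ?_)).trans
        (add_le_add (eLpNorm_norm u).le ?_)
    · rw [Real.norm_of_nonneg (ubar_pos hK _).le]
      exact ubar_le hK _
    · rw [eLpNorm_const _ hps0 (IsProbabilityMeasure.ne_zero _),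
        Real.enorm_eq_ofReal hK.le]
      simp
  refine (eLpNorm_mono fun x => ?_).trans (hmain.trans (mul_le_mul'
    (ENNReal.ofReal_le_ofReal (le_of_eq ?_)) hw1))
  · rw [Real.norm_of_nonneg (ubar_pos hK _).le]
    exact abs_le_ubar _
  · rw [Real.mul_rpow (by positivity) (by linarith), iterConst]
    ring

end LocalBoundedness

/-! ### The constants -/

section Constants

/-- The constant carrying the dependence on the inhomogeneous terms. -/
def firstConst (ε p ψ c e f g : ℝ) : ℝ :=
  if c = 0 ∨ (e = 0 ∧ f = 0 ∧ g = 0) then 0 else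
    |(2 * (c ^ (p / (p + 1 - ψ)) * (2 ^ (p * (ψ - p) / (p + 1 - ψ)) *
      (e ^ (1 / (p - 1)) + f ^ (1 / (p - 1)) + g ^ (1 / p)) ^ (p * (ψ - p) / (p + 1 - ψ))))) ^
        ((1 + ε) / (p * ε))| ^ (1 / ε)

/-- The constant in front of the power of the norm of the solution. -/
def secondConst (ε p ψ b c d h : ℝ) : ℝ :=
  if b = 0 ∧ c = 0 ∧ d = 0 ∧ h = 0 then 0 else
    |b + (2 * (h + d + c ^ (p / (p + 1 - ψ)) * 2 ^ (p * (ψ - p) / (p + 1 - ψ)))) ^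
      ((1 + ε) / (p * ε))| ^ (1 / ε)

/-- The power of the norm of the solution. -/
def growthExp (ε p γ ψ δ : ℝ) : ℝ :=
  |((γ - p) + (δ - p) + p * (ψ - p) / (p + 1 - ψ)) * (1 + (1 + ε) / (p * ε)) * (1 / ε)| + 1

/-- Nonnegativity is required for all real arguments, admissible or not, hence the absolute value in
the definition. The case distinction similarly secures the vanishing where real powers of zero could
have exponent 0. For admissible arguments neither changes the value. -/
lemma firstConst_nonneg (ε p ψ c e f g : ℝ) : 0 ≤ firstConst ε p ψ c e f g := by
  unfold firstConst
  split_ifs <;> positivity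

lemma secondConst_nonneg (ε p ψ b c d h : ℝ) : 0 ≤ secondConst ε p ψ b c d h := by
  unfold secondConst
  split_ifs <;> positivity

/-- The added 1 in the definition secures strict positivity for arbitrary real arguments. -/
lemma growthExp_pos (ε p γ ψ δ : ℝ) : 0 < growthExp ε p γ ψ δ := by
  unfold growthExp
  positivity

lemma add_rpow_le {x y k : ℝ} (hx : 0 ≤ x) (hy : 0 ≤ y) (hk : 0 ≤ k) :
    (x + y) ^ k ≤ (2 * x) ^ k + (2 * y) ^ k := by
  have h1 : 0 ≤ (2 * x) ^ k := by positivity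
  have h2 : 0 ≤ (2 * y) ^ k := by positivity
  rcases le_total x y with h | h
  · exact (Real.rpow_le_rpow (by positivity) (by linarith) hk).trans (le_add_of_nonneg_left h1)
  · exact (Real.rpow_le_rpow (by positivity) (by linarith) hk).trans (le_add_of_nonneg_right h2)

lemma add_add_rpow_le {x y z k : ℝ} (hx : 0 ≤ x) (hy : 0 ≤ y) (hz : 0 ≤ z) (hk : 0 ≤ k) :
    (x + y + z) ^ k ≤ 3 ^ k * (x ^ k + y ^ k + z ^ k) := by
  have hX : 0 ≤ x ^ k := by positivity
  have hY : 0 ≤ y ^ k := by positivity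
  have hZ : 0 ≤ z ^ k := by positivity
  have hm : ∀ m : ℝ, 0 ≤ m → x + y + z ≤ 3 * m → m ^ k ≤ x ^ k + y ^ k + z ^ k →
      (x + y + z) ^ k ≤ 3 ^ k * (x ^ k + y ^ k + z ^ k) := fun m hm0 h1 h2 =>
    (Real.rpow_le_rpow (by positivity) h1 hk).trans (by
      rw [Real.mul_rpow (by norm_num) hm0]
      exact mul_le_mul_of_nonneg_left h2 (by positivity))
  rcases le_total x y with h | h
  · rcases le_total y z with h' | h'
    · exact hm z hz (by linarith) (by linarith)
    · exact hm y hy (by linarith) (by linarith)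
  · rcases le_total x z with h' | h'
    · exact hm z hz (by linarith) (by linarith)
    · exact hm x hx (by linarith) (by linarith)

/-- The bound for the potential is at most D₁ + M(1+U)^{lam}, with D₁ independent of U. Powers of
sums split at the cost of factors 2 and 3, so the part carrying e, f, g separates from the part
multiplied by a power of 1+U; these are the two constants. -/
lemma factor_rpow_le {ε p γ ψ δ b c d e f g h U K : ℝ} (hε : 0 < ε) (hp : 1 < p) (hγ : p < γ)
    (hψ : p < ψ) (hψ' : ψ < p + 1) (hδ : p < δ) (hb : 0 ≤ b) (hc : 0 ≤ c) (hd : 0 ≤ d)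
    (he : 0 ≤ e) (hf : 0 ≤ f) (hg : 0 ≤ g) (hh : 0 ≤ h) (hU : 0 ≤ U) (hK : 0 ≤ K)
    (hK' : K ≤ e ^ (1 / (p - 1)) + f ^ (1 / (p - 1)) + g ^ (1 / p)) :
    (1 + b * U ^ (γ - p) + potentialBound K p γ ψ δ c d h U ^ ((1 + ε) / (p * ε))) ^ (1 / ε) ≤
      3 ^ (1 / ε) * (1 + firstConst ε p ψ c e f g +
        secondConst ε p ψ b c d h * (1 + U) ^ growthExp ε p γ ψ δ) := by
  have hp0 : 0 < p := by linarith
  have hp1 : 0 < p - 1 := by linarith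
  have hψ1 : 0 < p + 1 - ψ := by linarith
  have hγ0 : 0 < γ - p := by linarith
  have hδ0 : 0 < δ - p := by linarith
  have hψ0 : 0 < ψ - p := by linarith
  set α' := p * (ψ - p) / (p + 1 - ψ) with hα
  have hα0 : 0 < α' := by positivity
  set k := (1 + ε) / (p * ε) with hk
  have hk0 : 0 < k := by positivity
  set c' := c ^ (p / (p + 1 - ψ)) with hc'
  have hc'0 : 0 ≤ c' := Real.rpow_nonneg hc _
  set K₀ := e ^ (1 / (p - 1)) + f ^ (1 / (p - 1)) + g ^ (1 / p) with hK₀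
  have hK₀0 : 0 ≤ K₀ := hK.trans hK'
  set lam := (γ - p) + (δ - p) + α' with hlam
  have hlam0 : 0 < lam := by positivity
  have hU1 : 1 ≤ 1 + U := by linarith
  -- As 1+U ≥ 1 and lam is the sum of the three exponents, W dominates all three powers of U at
  -- once.
  set W := (1 + U) ^ lam with hW
  have hW1 : 1 ≤ W := Real.one_le_rpow hU1 hlam0.le
  have hUW : ∀ x : ℝ, 0 ≤ x → x ≤ lam → U ^ x ≤ W := fun x hx0 hx =>
    (Real.rpow_le_rpow hU (by linarith) hx0).trans (Real.rpow_le_rpow_of_exponent_le hU1 hx)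
  set D₁ := c' * (2 ^ α' * K₀ ^ α') with hD₁
  set M := h + d + c' * 2 ^ α' with hM
  have hD₁0 : 0 ≤ D₁ := by positivity
  have hM0 : 0 ≤ M := by positivity
  have hV : potentialBound K p γ ψ δ c d h U ≤ D₁ + M * W := by
    have h1 := mul_le_mul_of_nonneg_left (hUW (γ - p) hγ0.le (by linarith)) hh
    have h2 := mul_le_mul_of_nonneg_left (hUW (δ - p) hδ0.le (by linarith)) hd
    have h3 := hUW α' hα0.le (by linarith)
    have h4 : K ^ α' ≤ K₀ ^ α' := Real.rpow_le_rpow hK hK' hα0.le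
    have h5 : c' * (2 ^ α' * (U ^ α' + K ^ α')) ≤ c' * (2 ^ α' * (W + K₀ ^ α')) := by
      gcongr
    calc potentialBound K p γ ψ δ c d h U ≤ h * W + d * W + c' * (2 ^ α' * (W + K₀ ^ α')) :=
          add_le_add (add_le_add h1 h2) h5
      _ = _ := by rw [hD₁, hM]; ring
  have hV0 : 0 ≤ potentialBound K p γ ψ δ c d h U := by unfold potentialBound; positivity
  -- The powers W and W^k that arise are both at most W^{1+k}, so a single growth exponent serves
  -- both.
  have hZ : 1 + b * U ^ (γ - p) + potentialBound K p γ ψ δ c d h U ^ k ≤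
      1 + (2 * D₁) ^ k + (b + (2 * M) ^ k) * W ^ (1 + k) := by
    have h1 := mul_le_mul_of_nonneg_left (hUW (γ - p) hγ0.le (by linarith)) hb
    have h2 : W ≤ W ^ (1 + k) := by
      conv_lhs => rw [← Real.rpow_one W]
      exact Real.rpow_le_rpow_of_exponent_le hW1 (by linarith)
    have h3 : W ^ k ≤ W ^ (1 + k) := Real.rpow_le_rpow_of_exponent_le hW1 (by linarith)
    have h4 := (Real.rpow_le_rpow hV0 hV hk0.le).trans (add_rpow_le hD₁0 (by positivity) hk0.le)
    rw [show 2 * (M * W) = 2 * M * W by ring, Real.mul_rpow (x := 2 * M) (by positivity)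
      (by positivity)] at h4
    have h5 := mul_le_mul_of_nonneg_left h2 hb
    have h6 := mul_le_mul_of_nonneg_left h3 (by positivity : 0 ≤ (2 * M) ^ k)
    linarith
  have hWk : W ^ (1 + k) = (1 + U) ^ (lam * (1 + k)) := by
    rw [hW, ← Real.rpow_mul (by linarith)]
  refine (Real.rpow_le_rpow (by positivity) hZ (by positivity)).trans
    ((add_add_rpow_le zero_le_one (by positivity) (by positivity) (by positivity)).trans ?_)
  refine mul_le_mul_of_nonneg_left (add_le_add (add_le_add (Real.one_rpow _).le ?_) ?_)
    (by positivity)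
  · unfold firstConst
    split_ifs with h0
    · have : D₁ = 0 := by
        rcases h0 with h0 | ⟨h1, h2, h3⟩
        · rw [hD₁, hc', h0, Real.zero_rpow (by positivity), zero_mul]
        · have : K₀ = 0 := by
            rw [hK₀, h1, h2, h3, Real.zero_rpow (by positivity), Real.zero_rpow (by positivity)]
            norm_num
          rw [hD₁, this, Real.zero_rpow hα0.ne', mul_zero, mul_zero]
      rw [this, mul_zero, Real.zero_rpow hk0.ne', Real.zero_rpow (by positivity)]
    · rw [abs_of_nonneg (by positivity)]
  · rw [Real.mul_rpow (by positivity) (by positivity), hWk, ← Real.rpow_mul (by linarith)]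
    refine mul_le_mul ?_ ?_ (by positivity) (secondConst_nonneg _ _ _ _ _ _ _)
    · unfold secondConst
      split_ifs with h0
      · obtain ⟨h1, h2, h3, h4⟩ := h0
        have : M = 0 := by
          rw [hM, hc', h2, h3, h4, Real.zero_rpow (by positivity)]
          norm_num
        rw [this, mul_zero, Real.zero_rpow hk0.ne', h1, add_zero, Real.zero_rpow (by positivity)]
      · rw [abs_of_nonneg (by positivity)]
    · refine Real.rpow_le_rpow_of_exponent_le hU1 ?_
      unfold growthExp
      linarith [le_abs_self (lam * (1 + k) * (1 / ε))]

/-- At ε = 0 the upper bounds on γ, ψ and δ say precisely that the three entries of θ are below pσ;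
continuity in ε does the rest. The two extra smallness conditions serve the h-term (1+ε ≤ p') and
the removal of σ from the constants (σ ≤ 1/ε). -/
lemma exists_theta_lt {p σ γ ψ δ : ℝ} (hp : 1 < p) (hσ : 1 < σ) (hγ' : γ < σ * (p - 1) + 1)
    (hψ' : ψ < p + 1 - σ⁻¹) (hδ' : δ < p * σ) :
    ∃ ε₀ : ℝ, 0 < ε₀ ∧ ∀ ε : ℝ, 0 < ε → ε < ε₀ →
      theta p σ γ ψ δ ε < p * σ ∧ 1 + ε ≤ p.conjExponent ∧ σ ≤ 1 / ε := by
  have hp0 : 0 < p := by linarith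
  have hp1 : 0 < p - 1 := by linarith
  have hσ0 : 0 < σ := by linarith
  have hσ1 : 0 < σ - 1 := by linarith
  have hσi : 0 < σ⁻¹ := by positivity
  have hψ1 : 0 < p + 1 - ψ := by linarith
  have h1 : (γ - p) * p.conjExponent * σ.conjExponent < p * σ := by
    have : γ - p < (σ - 1) * (p - 1) := by linarith
    calc _ = (γ - p) * (p * σ / ((σ - 1) * (p - 1))) := by
          rw [Real.conjExponent, Real.conjExponent]; field_simp
      _ < (σ - 1) * (p - 1) * (p * σ / ((σ - 1) * (p - 1))) :=
          mul_lt_mul_of_pos_right this (by positivity)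
      _ = p * σ := by field_simp
  have h2 : (ψ - p) * p * σ.conjExponent * (1 + 0) / (p + 1 - ψ) < p * σ := by
    have h3 : (ψ - p) * σ < σ - 1 := by
      have : (ψ - p) * σ < (1 - σ⁻¹) * σ := mul_lt_mul_of_pos_right (by linarith) hσ0
      rwa [sub_mul 1, inv_mul_cancel₀ hσ0.ne', one_mul] at this
    have h4 : ψ - p < (σ - 1) * (p + 1 - ψ) := by linarith
    calc _ = (ψ - p) * (p * σ / ((σ - 1) * (p + 1 - ψ))) := by
          rw [Real.conjExponent]; field_simp; ring
      _ < (σ - 1) * (p + 1 - ψ) * (p * σ / ((σ - 1) * (p + 1 - ψ))) :=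
          mul_lt_mul_of_pos_right h4 (by positivity)
      _ = p * σ := by field_simp
  have h3 : (δ - p) * σ.conjExponent * (1 + 0) < p * σ := by
    have : δ - p < p * (σ - 1) := by linarith
    calc _ = (δ - p) * (σ / (σ - 1)) := by rw [Real.conjExponent]; ring
      _ < p * (σ - 1) * (σ / (σ - 1)) := mul_lt_mul_of_pos_right this (by positivity)
      _ = p * σ := by field_simp
  have e2 : ∀ᶠ ε in 𝓝 (0 : ℝ), (ψ - p) * p * σ.conjExponent * (1 + ε) / (p + 1 - ψ) < p * σ :=
    (Continuous.tendsto (by fun_prop) 0).eventually_lt_const h2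
  have e3 : ∀ᶠ ε in 𝓝 (0 : ℝ), (δ - p) * σ.conjExponent * (1 + ε) < p * σ :=
    (Continuous.tendsto (by fun_prop) 0).eventually_lt_const h3
  have e4 : ∀ᶠ ε in 𝓝 (0 : ℝ), ε < 1 / (p - 1) := eventually_lt_nhds (by positivity)
  have e5 : ∀ᶠ ε in 𝓝 (0 : ℝ), ε < 1 / σ := eventually_lt_nhds (by positivity)
  obtain ⟨ε₀, hε₀, h⟩ := Metric.eventually_nhds_iff.1 (((e2.and e3).and e4).and e5)
  refine ⟨ε₀, hε₀, fun ε hε hεε => ?_⟩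
  obtain ⟨⟨⟨h4, h5⟩, h6⟩, h7⟩ := h (y := ε) (by rwa [Real.dist_eq, sub_zero, abs_of_pos hε])
  refine ⟨max_lt (max_lt h1 h4) h5, ?_, ?_⟩
  · have : p.conjExponent = 1 + 1 / (p - 1) := by rw [Real.conjExponent]; field_simp; ring
    linarith
  · rw [le_div_iff₀ hε]
    rw [lt_div_iff₀ hσ0] at h7
    linarith

lemma kTerm_nonneg {p r : ℝ} (hr : 0 ≤ r) (κ : Coefficients n) (D : Set (E n)) :
    0 ≤ kTerm p r κ D := by
  have h1 := supNorm_nonneg κ.e D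
  have h2 := supNorm_nonneg κ.f D
  have h3 := supNorm_nonneg κ.g D
  unfold kTerm
  positivity

/-- Since r ≤ 1, the radius disappears from the bound on K that enters C₁. -/
lemma kTerm_le {p r : ℝ} (hp : 1 < p) (hr : 0 ≤ r) (hr1 : r ≤ 1) (κ : Coefficients n)
    (D : Set (E n)) : kTerm p r κ D ≤ supNorm κ.e D ^ (1 / (p - 1)) +
      supNorm κ.f D ^ (1 / (p - 1)) + supNorm κ.g D ^ (1 / p) := by
  have h1 := supNorm_nonneg κ.e D
  have h2 := supNorm_nonneg κ.f D
  have h3 := supNorm_nonneg κ.g D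
  have h4 : 0 ≤ p.conjExponent := div_nonneg (by linarith) (by linarith)
  unfold kTerm
  refine add_le_add (add_le_add ?_ ?_) ?_
  · exact mul_le_of_le_one_left (by positivity) hr1
  · exact mul_le_of_le_one_left (by positivity) (Real.rpow_le_one hr hr1 h4)
  · exact mul_le_of_le_one_left (by positivity) hr1

/-- Each summand of K(y,r) alone is at most K, and solving for the coefficient gives the comparison
with powers of K/r that lets ū absorb e, f and g. -/
lemma le_of_kTerm_le {p r K : ℝ} (hp : 1 < p) (hr : 0 < r) (κ : Coefficients n) (D : Set (E n))
    (hK : kTerm p r κ D ≤ K) :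
    supNorm κ.e D ≤ (K / r) ^ (p - 1) ∧ supNorm κ.f D ≤ K ^ (p - 1) * r ^ (-p) ∧
      supNorm κ.g D ≤ (K / r) ^ p := by
  have hp0 : 0 < p := by linarith
  have hp1 : 0 < p - 1 := by linarith
  have h1 := supNorm_nonneg κ.e D
  have h2 := supNorm_nonneg κ.f D
  have h3 := supNorm_nonneg κ.g D
  have t1 : 0 ≤ r * supNorm κ.e D ^ (1 / (p - 1)) := by positivity
  have t2 : 0 ≤ r ^ p.conjExponent * supNorm κ.f D ^ (1 / (p - 1)) := by positivity
  have t3 : 0 ≤ r * supNorm κ.g D ^ (1 / p) := by positivity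
  unfold kTerm at hK
  have hroot : ∀ {x y q : ℝ}, 0 ≤ x → 0 < q → x ^ (1 / q) ≤ y → x ≤ y ^ q := by
    intro x y q hx hq hxy
    have := Real.rpow_le_rpow (by positivity) hxy hq.le
    rwa [← Real.rpow_mul hx, one_div_mul_cancel hq.ne', Real.rpow_one] at this
  refine ⟨hroot h1 hp1 ?_, ?_, hroot h3 hp0 ?_⟩
  · rw [le_div_iff₀ hr]; linarith
  · have h4 := Real.rpow_le_rpow t2 (by linarith : _ ≤ K) hp1.le
    have h5 : p.conjExponent * (p - 1) = p := by rw [Real.conjExponent]; field_simp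
    rw [Real.mul_rpow (by positivity) (by positivity), ← Real.rpow_mul h2,
      one_div_mul_cancel hp1.ne', Real.rpow_one, ← Real.rpow_mul hr.le, h5] at h4
    rw [Real.rpow_neg hr.le, ← div_eq_mul_inv, le_div_iff₀ (by positivity)]
    linarith
  · rw [le_div_iff₀ hr]; linarith

/-- The condition s* > pσ' says s' > σ', which by duality is s < σ; this makes the ratio σ/s exceed
1. -/
lemma one_le_and_lt_of_holderConjugate {p σ s : ℝ} {s' : ℝ≥0∞} (hp : 1 < p) (hσ : 1 < σ)
    (hss : ENNReal.HolderConjugate (ENNReal.ofReal s) s')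
    (h : ENNReal.ofReal (p * σ.conjExponent) < s' * ENNReal.ofReal p) : 1 ≤ s ∧ s < σ := by
  have hp0 : 0 < p := by linarith
  refine ⟨ENNReal.one_le_ofReal.1 hss.one_le, ?_⟩
  by_contra! hsσ
  have hσ' := (Real.HolderConjugate.conjExponent hσ).ennrealOfReal
  have h1 : ENNReal.ofReal σ.conjExponent < s' := by
    rw [ENNReal.ofReal_mul hp0.le, mul_comm] at h
    exact lt_of_mul_lt_mul_right' h
  have h2 : (ENNReal.ofReal s)⁻¹ ≤ (ENNReal.ofReal σ)⁻¹ :=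
    ENNReal.inv_le_inv.2 (ENNReal.ofReal_le_ofReal hsσ)
  have h3 : (s')⁻¹ < (ENNReal.ofReal σ.conjExponent)⁻¹ := ENNReal.inv_lt_inv.2 h1
  have h4 := ENNReal.add_lt_add_of_le_of_lt
    (ne_top_of_le_ne_top ENNReal.one_ne_top (by
      rw [← inv_one, ENNReal.inv_le_inv]; exact hss.one_le)) h2 h3
  rw [hss.inv_add_inv_eq_inv, hσ'.inv_add_inv_eq_inv] at h4
  exact lt_irrefl _ h4

end Constants

/-! ### The local estimate -/

section Main

variable {p σ γ ψ δ a : ℝ} {Q : E n → Matrix (Fin n) (Fin n) ℝ} {Ω : Set (E n)}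
  {ρ : E n → E n → ℝ} {r₁ : E n → ℝ} {A : E n → ℝ → E n → E n} {B : E n → ℝ → E n → ℝ}
  {u : E n → ℝ} {v : E n → E n}

lemma avgNorm_ne_top_of_memLp {D : Set (E n)} (hfin : volume D < ∞) {q P : ℝ} (hq : q ≤ P)
    (hu : MemLp u (ENNReal.ofReal P) (volume.restrict D)) :
    avgNorm u (ENNReal.ofReal q) D < ∞ := by
  by_cases h0 : volume D = 0
  · simp [avgNorm, Measure.restrict_eq_zero.2 h0]
  have hprob := isProbabilityMeasure_avgMeasure h0 hfin.ne
  have hu' : MemLp u (ENNReal.ofReal P) (avgMeasure D) := hu.smul_measure (ENNReal.inv_ne_top.2 h0)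
  exact (hu'.mono_exponent (ENNReal.ofReal_le_ofReal hq)).2

/-- A bound for all `K' > K` holds for `K`, by continuity. -/
lemma le_of_forall_gt_potentialBound {x Y : ℝ≥0∞} {p γ ψ δ b c d h U I m k K : ℝ} (hp : 0 ≤ p)
    (hψ : p ≤ ψ) (hψ' : ψ ≤ p + 1) (hk : 0 ≤ k) (hm : 0 ≤ m) (hK : 0 ≤ K) (hI : 0 ≤ I)
    (hb : 0 ≤ b) (hc : 0 ≤ c) (hd : 0 ≤ d) (hh : 0 ≤ h) (hU : 0 ≤ U) (hY : Y ≠ ∞)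
    (hle : ∀ K' > K, x ≤ ENNReal.ofReal
      (I * (1 + b * U ^ (γ - p) + potentialBound K' p γ ψ δ c d h U ^ k) ^ m) *
        (Y + ENNReal.ofReal K')) :
    x ≤ ENNReal.ofReal
      (I * (1 + b * U ^ (γ - p) + potentialBound K p γ ψ δ c d h U ^ k) ^ m *
        (Y.toReal + K)) := by
  have hα : 0 ≤ p * (ψ - p) / (p + 1 - ψ) :=
    div_nonneg (mul_nonneg hp (by linarith)) (by linarith)
  have hcont : Continuous fun K => ENNReal.ofReal
      (I * (1 + b * U ^ (γ - p) + potentialBound K p γ ψ δ c d h U ^ k) ^ m *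
        (Y.toReal + K)) := by
    have h1 : Continuous fun K : ℝ => K ^ (p * (ψ - p) / (p + 1 - ψ)) :=
      Real.continuous_rpow_const hα
    have h2 : Continuous fun K => potentialBound K p γ ψ δ c d h U := by
      unfold potentialBound
      fun_prop
    have h3 : Continuous fun K => potentialBound K p γ ψ δ c d h U ^ k :=
      (Real.continuous_rpow_const hk).comp h2
    have h4 : Continuous fun K =>
        (1 + b * U ^ (γ - p) + potentialBound K p γ ψ δ c d h U ^ k) ^ m :=
      (Real.continuous_rpow_const hm).comp (by fun_prop)
    exact ENNReal.continuous_ofReal.comp (by fun_prop)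
  have hlim := (hcont.tendsto K).mono_left (nhdsWithin_le_nhds (s := Ioi K))
  refine ge_of_tendsto hlim (eventually_nhdsWithin_of_forall fun K' hK' => ?_)
  have hK'0 : 0 ≤ K' := hK.trans (le_of_lt hK')
  have hV : 0 ≤ potentialBound K' p γ ψ δ c d h U := by unfold potentialBound; positivity
  refine (hle K' hK').trans (le_of_eq ?_)
  rw [ENNReal.ofReal_mul (q := Y.toReal + K') (by positivity),
    ENNReal.ofReal_add ENNReal.toReal_nonneg hK'0,
    ENNReal.ofReal_toReal hY]

lemma iterConst_pos {ψ ε s CS Cs N : ℝ} (hp : 1 < p) (hσ : 0 < σ) (ha : 1 < a) (hs : 0 < s)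
    (hCS : 0 < CS) (hCs : 0 < Cs) (hN : 0 < N) : 0 < iterConst p σ ψ ε a s CS Cs N := by
  have := energyConst_pos (ψ := ψ) hp ha
  unfold iterConst
  positivity

/-- The estimate of `IsWeakSolution.eLpNorm_top_le` needs K > 0, whereas K(y,r) may vanish. It is
therefore used for every K' > K(y,r) and passed to the limit, after which the factor Z is rewritten
through C₁, C₂ and L. -/
theorem IsWeakSolution.eLpNorm_top_qball_le {ε s τ CS N Cs c₂ r : ℝ} {s' t t' : ℝ≥0∞}
    {κ : Coefficients n} {y : E n} (hp : 1 < p) (hσ : 1 < σ) (hpγ : p < γ)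
    (hγ : γ < σ * (p - 1) + 1) (hpψ : p < ψ) (hψ : ψ < p + 1 - σ⁻¹) (hpδ : p < δ)
    (hδ : δ < p * σ) (hε : 0 < ε) (hθ : theta p σ γ ψ δ ε < p * σ)
    (hεp : 1 + ε ≤ p.conjExponent) (hεσ : σ ≤ 1 / ε) (hΩ : IsOpen Ω) (hQ : IsWeight Ω p Q)
    (hρ : IsQuasimetric Ω ρ) (hr₁ : IsRadiusFunction Ω ρ r₁) (hS : SobolevEstimate Ω ρ r₁ p σ Q)
    (hy : y ∈ Ω) (hr : 0 < r) (hrr₁ : r < r₁ y) (hr1 : r ≤ 1) (hCS : 1 ≤ CS)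
    (hSav : ∀ (w : E n → ℝ) (g : E n → E n), MemWZero p Q (qball Ω ρ y r) w g →
      avgNorm w (ENNReal.ofReal (p * σ)) (qball Ω ρ y r) ≤ ENNReal.ofReal CS * (ENNReal.ofReal r *
        avgNorm (fun x => sqrtQ Q x (g x)) (ENNReal.ofReal p) (qball Ω ρ y r) +
          avgNorm w (ENNReal.ofReal p) (qball Ω ρ y r)))
    (hτ1 : τ < 1) (hs : 1 ≤ s) (hsσ : s < σ)
    (hss : ENNReal.HolderConjugate (ENNReal.ofReal s) s') (htt : ENNReal.HolderConjugate t t')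
    (hN : 1 ≤ N) (hCs : 1 ≤ Cs) {η : ℕ → E n → ℝ}
    (hη : IsCutoffSequence Ω ρ Q τ N Cs (s' * ENNReal.ofReal p) y r η)
    (hηt : ∀ j ≥ 1, eLpNorm (fun x => sqrtQ Q x (gradient (η j) x)) (t * ENNReal.ofReal p)
        (volume.restrict (qball Ω ρ y r)) < ∞)
    (hgain : ∀ f ∈ LipLoc Ω, eLpNorm f (ENNReal.ofReal p * t')
      (volume.restrict (qball Ω ρ y r)) ≤ ENNReal.ofReal c₂ * wNorm p Q Ω f (gradient f))
    (ha : 1 < a) (hκ : κ.Bounded Ω) (hstr : StructuralConditions Ω Q p γ ψ δ a κ A B)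
    (hsol : IsWeakSolution Ω p Q A B u v)
    (hu : MemLp u (ENNReal.ofReal (p * σ)) (volume.restrict (qball Ω ρ y r))) :
    eLpNorm u ∞ (volume.restrict (qball Ω ρ y (τ * r))) ≤
      ENNReal.ofReal (iterConst p σ ψ ε a s CS Cs N * (3 ^ (1 / ε)) ^ (s / (σ - s)) *
        (1 + firstConst ε p ψ (supNorm κ.c (qball Ω ρ y r)) (supNorm κ.e (qball Ω ρ y r))
            (supNorm κ.f (qball Ω ρ y r)) (supNorm κ.g (qball Ω ρ y r)) +
          secondConst ε p ψ (supNorm κ.b (qball Ω ρ y r)) (supNorm κ.c (qball Ω ρ y r))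
            (supNorm κ.d (qball Ω ρ y r)) (supNorm κ.h (qball Ω ρ y r)) *
          (1 + (avgNorm u (ENNReal.ofReal (theta p σ γ ψ δ ε)) (qball Ω ρ y r)).toReal) ^
            growthExp ε p γ ψ δ) ^ (s / (σ - s)) *
        ((avgNorm u (ENNReal.ofReal (s * p)) (qball Ω ρ y r)).toReal +
          kTerm p r κ (qball Ω ρ y r))) := by
  have hp0 : 0 < p := by linarith
  have hs0 : 0 < s := by linarith
  have hσ0 : 0 < σ := by linarith
  have hσs : 0 < σ - s := by linarith
  have hψ1 : ψ < p + 1 := by have : 0 < σ⁻¹ := by positivity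
                             linarith
  set D := qball Ω ρ y r with hD
  have hDm : NullMeasurableSet D volume := hρ.measurable_ball y hy r hr
  have hDfin : volume D < ∞ := hr₁.volume_lt_top y hy r hr hrr₁
  -- On a null ball the averaged measure is not a probability measure, but the left side is zero.
  by_cases h0 : volume D = 0
  · have hT : qball Ω ρ y (τ * r) ⊆ D := qball_mono y (by nlinarith)
    rw [Measure.restrict_eq_zero.2 (measure_mono_null hT h0)]
    simp
  obtain ⟨C, hCt, hC⟩ := hS.exists_eLpNorm_le hp.le hy hr hrr₁ h0 hDfin.ne
  have hUfin := avgNorm_ne_top_of_memLp hDfin hθ.le hu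
  have hYfin := avgNorm_ne_top_of_memLp hDfin
    (by rw [mul_comm]; exact mul_le_mul_of_nonneg_left hsσ.le hp0.le : s * p ≤ p * σ) hu
  set U := (avgNorm u (ENNReal.ofReal (theta p σ γ ψ δ ε)) D).toReal with hU
  have hU0 : 0 ≤ U := ENNReal.toReal_nonneg
  have hk := kTerm_nonneg (p := p) hr.le κ D
  have hb := supNorm_nonneg κ.b D
  have hc := supNorm_nonneg κ.c D
  have hd := supNorm_nonneg κ.d D
  have he := supNorm_nonneg κ.e D
  have hf := supNorm_nonneg κ.f D
  have hg := supNorm_nonneg κ.g D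
  have hh := supNorm_nonneg κ.h D
  have hI := iterConst_pos (ψ := ψ) (ε := ε) (s := s) (CS := CS) (Cs := Cs) (N := N) hp hσ0 ha hs0
    (by linarith) (by linarith) (by linarith)
  -- The power of Z is Ψ₀ times a surplus factor σ/s.
  have hexp : (1 - (σ / s)⁻¹)⁻¹ = σ / s * (s / (σ - s)) := by
    rw [inv_div]
    field_simp
  have hstep := le_of_forall_gt_potentialBound (γ := γ) (δ := δ) (b := supNorm κ.b D) (c := supNorm κ.c D)
    (d := supNorm κ.d D) (h := supNorm κ.h D) (U := U) (k := (1 + ε) / (p * ε))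
    (m := (1 - (σ / s)⁻¹)⁻¹) (K := kTerm p r κ D) (I := iterConst p σ ψ ε a s CS Cs N)
    (Y := avgNorm u (ENNReal.ofReal (s * p)) D)
    (x := eLpNorm u ∞ (volume.restrict (qball Ω ρ y (τ * r)))) hp0.le hpψ.le hψ1.le
    (by positivity) (by rw [hexp]; positivity) hk hI.le hb hc hd hh hU0 hYfin.ne fun K' hK' => by
      obtain ⟨heK, hfK, hgK⟩ := le_of_kTerm_le hp hr κ D (le_of_lt hK')
      rw [mul_comm s p]
      exact hsol.eLpNorm_top_le hp hσ hpγ hγ hpψ hψ hpδ hδ hQ hΩ hDm h0 hDfin hCt hC hu htt hgain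
        ha hb hc hd hg hh (hstr.structuralBounds hκ (qball_subset y r)) hr hr1
        (hk.trans_lt hK') heK hfK hgK hCS hSav hε hεp hU0 (ENNReal.ofReal_toReal hUfin.ne).ge hs
        hsσ hss hτ1.le hN hCs hη hηt
  refine hstep.trans (ENNReal.ofReal_le_ofReal ?_)
  refine mul_le_mul_of_nonneg_right ?_ (add_nonneg ENNReal.toReal_nonneg hk)
  set V := potentialBound (kTerm p r κ D) p γ ψ δ (supNorm κ.c D) (supNorm κ.d D)
    (supNorm κ.h D) U with hV
  have hV0 : 0 ≤ V := by
    have : 0 ≤ p + 1 - ψ := by linarith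
    rw [hV]; unfold potentialBound; positivity
  have hZ1 : 1 ≤ 1 + supNorm κ.b D * U ^ (γ - p) + V ^ ((1 + ε) / (p * ε)) := by
    have h1 : 0 ≤ supNorm κ.b D * U ^ (γ - p) := by positivity
    have h2 : 0 ≤ V ^ ((1 + ε) / (p * ε)) := by positivity
    linarith
  have hfac := factor_rpow_le hε hp hpγ hpψ hψ1 hpδ hb hc hd he hf hg hh hU0 hk
    (kTerm_le hp hr.le hr1 κ D)
  have hF := firstConst_nonneg ε p ψ (supNorm κ.c D) (supNorm κ.e D) (supNorm κ.f D)
    (supNorm κ.g D)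
  have hG := secondConst_nonneg ε p ψ (supNorm κ.b D) (supNorm κ.c D) (supNorm κ.d D)
    (supNorm κ.h D)
  rw [mul_assoc]
  refine mul_le_mul_of_nonneg_left ?_ hI.le
  rw [← Real.mul_rpow (by positivity) (by positivity), hexp, Real.rpow_mul (by linarith)]
  refine Real.rpow_le_rpow (by positivity) (le_trans ?_ hfac) (by positivity)
  -- The surplus exponent satisfies σ/s ≤ σ ≤ 1/ε and Z ≥ 1, so it may be replaced by 1/ε, which
  -- removes σ and s from the constants.
  refine Real.rpow_le_rpow_of_exponent_le hZ1 (le_trans ?_ hεσ)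
  exact div_le_self hσ0.le hs

end Main

end DegenerateQuasilinear

end

/-! ### The theorem: choice of the constants. -/

open DegenerateQuasilinear in
theorem corollary1p8 :
    -- the dependence: `C₁ ε p ψ ‖c‖ ‖e‖ ‖f‖ ‖g‖`, `C₂ ε p ψ ‖b‖ ‖c‖ ‖d‖ ‖h‖`, `L ε p γ ψ δ`
    ∃ (C₁ : ℝ → ℝ → ℝ → ℝ → ℝ → ℝ → ℝ → ℝ) (C₂ : ℝ → ℝ → ℝ → ℝ → ℝ → ℝ → ℝ → ℝ)
      (L : ℝ → ℝ → ℝ → ℝ → ℝ → ℝ),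
      (∀ ε p ψ c e f g, 0 ≤ C₁ ε p ψ c e f g) ∧
      (∀ ε p ψ e f g, C₁ ε p ψ 0 e f g = 0) ∧
      (∀ ε p ψ c, C₁ ε p ψ c 0 0 0 = 0) ∧
      (∀ ε p ψ b c d h, 0 ≤ C₂ ε p ψ b c d h) ∧
      (∀ ε p ψ, C₂ ε p ψ 0 0 0 0 = 0) ∧
      (∀ ε p γ ψ δ, 0 < L ε p γ ψ δ) ∧
      ∀ (p σ γ ψ δ : ℝ), 1 < p → 1 < σ →
        p < γ → γ < σ * (p - 1) + 1 →
        p < ψ → ψ < p + 1 - σ⁻¹ →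
        p < δ → δ < p * σ →
        ∃ ε₀ : ℝ, 0 < ε₀ ∧ ∀ ε : ℝ, 0 < ε → ε < ε₀ →
          theta p σ γ ψ δ ε < p * σ ∧
          ∀ (n : ℕ) (Ω : Set (E n)) (ρ : E n → E n → ℝ) (r₁ : E n → ℝ)
            (Q : E n → Matrix (Fin n) (Fin n) ℝ) (τ s a : ℝ) (sStar s' t t' : ℝ≥0∞),
            IsOpen Ω → IsWeight Ω p Q → IsQuasimetric Ω ρ → EuclideanControlled Ω ρ →
            IsRadiusFunction Ω ρ r₁ →
            SobolevEstimate Ω ρ r₁ p σ Q →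
            0 < τ → τ < 1 →
            ENNReal.ofReal (p * σ.conjExponent) < sStar →
            sStar = s' * ENNReal.ofReal p →
            ENNReal.HolderConjugate (ENNReal.ofReal s) s' →
            ENNReal.HolderConjugate t t' →
            CutoffCondition Ω ρ r₁ p Q τ sStar t →
            LocalIntegrabilityGain Ω ρ r₁ p Q t' →
            1 < a →
            ∃ C : ℝ, 0 < C ∧
              ∀ (κ : Coefficients n) (A : E n → ℝ → E n → E n) (B : E n → ℝ → E n → ℝ)
                (u : E n → ℝ) (v : E n → E n),
                κ.Bounded Ω →
                StructuralConditions Ω Q p γ ψ δ a κ A B →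
                IsWeakSolution Ω p Q A B u v →
                ∀ y ∈ Ω, ∀ r : ℝ, 0 < r → r < τ * r₁ y → r ≤ 1 →
                  avgNorm u (ENNReal.ofReal (theta p σ γ ψ δ ε)) (qball Ω ρ y r) < ∞ ∧
                  avgNorm u (ENNReal.ofReal (s * p)) (qball Ω ρ y r) < ∞ ∧
                  eLpNorm u ∞ (volume.restrict (qball Ω ρ y (τ * r))) ≤
                    ENNReal.ofReal
                      (C *
                        (1 +
                          C₁ ε p ψ (supNorm κ.c (qball Ω ρ y r)) (supNorm κ.e (qball Ω ρ y r))
                            (supNorm κ.f (qball Ω ρ y r)) (supNorm κ.g (qball Ω ρ y r)) +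
                          C₂ ε p ψ (supNorm κ.b (qball Ω ρ y r)) (supNorm κ.c (qball Ω ρ y r))
                            (supNorm κ.d (qball Ω ρ y r)) (supNorm κ.h (qball Ω ρ y r)) *
                          (1 + (avgNorm u (ENNReal.ofReal (theta p σ γ ψ δ ε))
                            (qball Ω ρ y r)).toReal) ^ L ε p γ ψ δ) ^ (s / (σ - s)) *
                        ((avgNorm u (ENNReal.ofReal (s * p)) (qball Ω ρ y r)).toReal +
                          kTerm p r κ (qball Ω ρ y r))) := by

  refine ⟨firstConst, secondConst, growthExp, firstConst_nonneg, fun ε p ψ e f g => by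
    simp [firstConst], fun ε p ψ c => by simp [firstConst], secondConst_nonneg, fun ε p ψ => by
    simp [secondConst], growthExp_pos, ?_⟩
  intro p σ γ ψ δ hp hσ hpγ hγ hpψ hψ hpδ hδ
  obtain ⟨ε₀, hε₀, hεε⟩ := exists_theta_lt hp hσ hγ hψ hδ
  refine ⟨ε₀, hε₀, fun ε hε hε' => ?_⟩
  obtain ⟨hθ, hεp, hεσ⟩ := hεε ε hε hε'
  refine ⟨hθ, ?_⟩
  intro n Ω ρ r₁ Q τ s a sStar s' t t' hΩ hQ hρ _ hr₁ hS hτ hτ1 hlt hsStar hss htt hcut hgain ha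
  subst hsStar
  obtain ⟨hs, hsσ⟩ := one_le_and_lt_of_holderConjugate hp hσ hss hlt
  obtain ⟨CS, hCS, hSav⟩ := id hS
  obtain ⟨N, Cs, hN, hCs, hcut'⟩ := id hcut
  have hI := iterConst_pos (ψ := ψ) (ε := ε) (s := s) (CS := max CS 1) (Cs := max Cs 1)
    (N := max N 1) hp (by linarith : 0 < σ) ha (by linarith) (by positivity) (by positivity)
    (by positivity)
  -- This constant involves only the exponents, a and the constants of the Sobolev and cutoff
  -- conditions, and is fixed before the equation, the solution and the ball. The maxima with 1
  -- provide the lower bounds required by the iteration.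
  refine ⟨iterConst p σ ψ ε a s (max CS 1) (max Cs 1) (max N 1) *
    (3 ^ (1 / ε)) ^ (s / (σ - s)), by positivity, ?_⟩
  intro κ A B u v hκ hstr hsol y hy r hr hrτ hr1
  have hrr₁ : r < r₁ y := hrτ.trans_le (mul_le_of_le_one_left (hr₁.pos y hy).le hτ1.le)
  have hu := hsol.1.memLp_qball hp hΩ hQ hρ hr₁ hS hτ htt hcut hgain hy hr hrτ
  have hDfin := hr₁.volume_lt_top y hy r hr hrr₁
  obtain ⟨η, hη, hηt⟩ := hcut' y hy r hr hrr₁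
  obtain ⟨c₂, -, hc₂⟩ := hgain y hy r hr hrr₁
  refine ⟨avgNorm_ne_top_of_memLp hDfin hθ.le hu, avgNorm_ne_top_of_memLp hDfin (by
    rw [mul_comm]; exact mul_le_mul_of_nonneg_left hsσ.le (by linarith)) hu, ?_⟩
  exact hsol.eLpNorm_top_qball_le hp hσ hpγ hγ hpψ hψ hpδ hδ hε hθ hεp hεσ hΩ hQ hρ hr₁ hS hy hr
    hrr₁ hr1 (le_max_right CS 1) (fun w g hw => (hSav y hy r hr hrr₁ w g hw).trans
      (mul_le_mul' (ENNReal.ofReal_le_ofReal (le_max_left _ _)) le_rfl)) hτ1 hs hsσ hss htt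
    (le_max_right N 1) (le_max_right Cs 1)
    (hη.mono hr hN hCs (le_max_left _ _) (le_max_left _ _)) hηt hc₂ ha hκ hstr hu
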